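/- **Hypergraphs.** A hypergraph $S$ consists of finite sets $S_k$ ($k\ge 0$) of faces, only finitely many of them non-empty, functions $\gamma:S_{k+1}\to S_k$, and, for each $a\in S_{k+1}$, a set $\delta(a)\subseteq S_k\sqcup\{1_u:u\in S_{k-1}\}$ (with $S_{-1}=\emptyset$) that is either a singleton or a non-empty subset of $S_k$, and is a singleton when $k=0$. For the empty faces $1_u$ put $\gamma(1_u)=u$ and $\delta(1_u)=\{u\}$. Faces and singletons are identified where convenient. Let $\dot\delta(a)=\delta(a)\cap S$, $\theta(a)=\delta(a)\cup\{\gamma(a)\}$, $\dot\theta(a)=\theta(a)\cap S$. A face $a$ of positive dimension is a *loop* if $\delta(a)=\{\gamma(a)\}$; $\dot\delta^{-\lambda}(a)$ is the set of non-loops in $\dot\delta(a)$; $S^\varepsilon$ is the set of faces whose domain is an empty face; $\iota(a)=\gamma\dot\delta^{-\lambda}(a)\cap\delta\dot\delta^{-\lambda}(a)\cap S$. On $S_k$, $<^+$ is the transitive closure of "$x\in\delta(\alpha)$, $\gamma(\alpha)=y$ for some non-loop $\alpha\in S_{k+1}$"; $<^-$ is the transitive closure of "$\gamma(a)\in\delta(b)$"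 if $k>0$ and is empty if $k=0$. For each of these relations $\perp$ denotes comparability ($a<b$ or $b<a$). For $A,B\subseteq S_k\sqcup 1_{S_{k-1}}$, $A\equiv_1B$ means $A\cup 1_{\dot\theta(A\cap S)}=B\cup 1_{\dot\theta(B\cap S)}$ (with $\dot\theta=\emptyset$ on faces of dimension $0$). **Ordered face structures.** An ordered face structure is a hypergraph $S$ with $S_0\ne\emptyset$ and binary relations $<^\sim$ on the sets $S_k$ such that: (1) $\gamma\gamma(a)=\gamma\delta(a)-\delta\dot\delta^{-\lambda}(a)$ and $\delta\gamma(a)\equiv_1\delta\delta(a)-\gamma\dot\delta^{-\lambda}(a)$ for $a\in S_{\ge2}$; (2) no two faces of $\dot\delta(a)$ are comparable by $<^+$; (3) $<^+$ and $<^\sim$ are irreflexive and transitive, and $<^+$ is linear on $S_0$; (4) $\perp^\sim\cap\perp^+=\emptyset$; $a<^\sim b$ implies $a<^-b$; and if $a,b$ have positive dimension and $\theta(a)\cap\theta(b)=\emptyset$, then $a<^\sim b$ iff $a<^-b$; (5) if $a\neq b$ and $\dot\theta(a)\cap\dot\theta(b)\ne\emptyset$, then $a\perp^\sim b$ or $a\perp^+b$;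 and if $a\in S^\varepsilon_{\ge 2}$ and $\gamma\gamma(a)\in\iota(b)$, then $a<^\sim b$ or $a<^+b$; (6) every loop is $\gamma(\xi)$ for some non-loop $\xi$. A monotone morphism is a family of maps $f_k:S_k\to T_k$ that commutes with $\gamma$, maps each $\delta(a)$ bijectively onto $\delta(f(a))$ (with $1_u\mapsto 1_{f(u)}$), and preserves $<^\sim$. **Positive face structures.** A positive hypergraph $T$ consists of finite sets $T_k$, only finitely many of them non-empty, functions $\gamma:T_{k+1}\to T_k$ and non-empty sets $\delta(a)\subseteq T_k$ for $a\in T_{k+1}$, with $\delta(a)$ a singleton for $a\in T_1$. Here $<^+$ is the transitive closure of "$x\in\delta(\alpha)$, $\gamma(\alpha)=y$ for some $\alpha$", and $<^-$ is as before. It is a positive face structure if $T_0\ne\emptyset$; $\gamma\gamma(a)=\gamma\delta(a)-\delta\delta(a)$ and $\delta\gamma(a)=\delta\delta(a)-\gamma\delta(a)$ for $a\in T_{\ge2}$; $<^+$ is irreflexive, and linear on $T_0$; $\perp^-\cap\perp^+=\emptyset$ in positive dimensions; and for each face $x$ the sets $\{a:\gamma(a)=x\}$ and $\{a:x\in\delta(a)\}$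 are linearly ordered by $<^+$. Its relation $<^\sim$ is $<^-$. A face $a$ of $T$ of positive dimension is *unary* if $|\delta(a)|=1$. An *ideal* of $T$ is a set $J$ of unary faces with $J\cap\gamma(T)=\emptyset$ and $J\cap\delta(J)=\emptyset$; it is a *unary ideal* if moreover $J\subseteq\delta(T^u)$, where $T^u$ is the set of unary faces. The quotient $T/J$ has faces $(T_k-J_k)/{\sim}$, where $\sim$ is the equivalence relation generated by $x\sim y$ whenever $\delta(a)=\{x\}$ and $\gamma(a)=y$ for some $a\in J_{k+1}$; $\gamma([a])=[\gamma(a)]$; $\delta([a])=1_{[\gamma\gamma(a)]}$ if $\delta(a)\subseteq J$ and $\delta([a])=\{[x]:x\in\delta(a)-J\}$ otherwise; and $[x]<^\sim[y]$ iff $x<^-y$. The map $p_J:T\to T/J$ sends $a\in J$ to $1_{[\gamma(a)]}$ and every other $a$ to $[a]$. A *collapsing morphism* $f:T\to S$ to an ordered face structure $S$ is a family of maps $f_k:T_k\to S_k\sqcup 1_{S_{k-1}}$ such that $f(\gamma(a))=\gamma(f(a))$, $f(\delta(a))\equiv_1\delta(f(a))$, and $a<^\sim b$ implies $f(a)<^\sim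 f(b)$ whenever $f(a),f(b)$ are not empty faces. Its kernel is the set of faces sent to empty faces. It is a *positive cover* if there are an ideal $J$ of $T$ and a monotone isomorphism $h:T/J\to S$ with $f=h\circ p_J$ (where $h(1_u)=1_{h(u)}$). **The construction.** Let $S$ be an ordered face structure. Let $\mathcal I=S^\varepsilon-\gamma(\{\text{non-loops of }S\})$ be the set of initial faces, $\mathcal I_k=\mathcal I\cap S_k$, $\mathcal I^{\le^+a}=\{\alpha\in\mathcal I:\alpha\le^+a\}$, and $\mathcal I_x=\{\alpha\in\mathcal I:\delta(\alpha)=1_x\}$ for a face $x$. An $x$-cut is a triple $(x,L,U)$ with $L\cup U=\mathcal I_x$ and $\gamma(\alpha)<^\sim\gamma(\beta)$ for all $\alpha\in L$, $\beta\in U$; write $(x,L,-)$ for $(x,L,\mathcal I_x-L)$ and $(x,-,U)$ for $(x,\mathcal I_x-U,U)$. Let ${\uparrow}a=\{\alpha\in\mathcal I_{\gamma(a)}:a<^\sim\gamma(\alpha)\}$ and ${\downarrow_x}a=\{\alpha\in\mathcal I_x:\gamma(\alpha)<^\sim a\}$. The faces of $S^\dag$ of dimension $k$ are all $x$-cuts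 with $x\in S_k$, together with a bar $\overline\alpha$ for each $\alpha\in\mathcal I_{k+1}$. Put $$\gamma^\dag(a,L,U)=(\gamma(a),-,{\uparrow}a),\qquad \delta^\dag(a,L,U)=\{\overline\alpha:\alpha\in\mathcal I^{\le^+a}\}\cup\{(x,{\downarrow_x}a,-):x\in\dot\delta(a)\},$$ $$\gamma^\dag(\overline\alpha)=(\gamma\gamma(\alpha),-,{\uparrow}\gamma(\alpha)),\qquad \delta^\dag(\overline\alpha)=\{(\gamma\gamma(\alpha),{\downarrow_{\gamma\gamma(\alpha)}}\gamma(\alpha),-)\}.$$ Let $q_S$ send a cut $(a,L,U)$ to $a$ and a bar $\overline\alpha$ to $1_{\gamma\gamma(\alpha)}$, and let $\overline{\mathcal I}$ be the set of all bars. **Theorem.** For every ordered face structure $S$: $S^\dag$ is a positive face structure (in particular a positive hypergraph), $\overline{\mathcal I}$ is a unary ideal in $S^\dag$, and $q_S:S^\dag\to S$ is a positive cover with kernel $\overline{\mathcal I}$. -/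

import Mathlib

universe u

/-! ## Hypergraphs -/

namespace FaceStr

/-- The `k`-dimensional faces, proper or empty, of a graded family `F`: either a face of
dimension `k`, or the empty face `1_u` on a face `u` of dimension `k - 1`. -/
inductive EFace (F : ℕ → Type u) : ℕ → Type u
  | face {k : ℕ} (x : F k) : EFace F k
  | one {k : ℕ} (x : F k) : EFace F (k + 1)

namespace EFace

variable {F G : ℕ → Type u}

/-- The possibly empty face `z` is an empty face. -/
def IsOne : {k : ℕ} → EFace F k → Prop
  | _, face _ => False
  | _, one _ => True

/-- The action `f + 1_f` of a graded map `f` on proper and empty faces. -/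
def map (f : ∀ k, F k → G k) : {k : ℕ} → EFace F k → EFace G k
  | _, face x => face (f _ x)
  | _, one x => one (f _ x)

end EFace

/-- A hypergraph. The values `γ(1_u) = u` and `δ(1_u) = {u}` on empty faces are the fixed ones
(see `gammaE` and `deltaE`), hence are no part of the data. -/
structure Hypergraph where
  /-- the faces of dimension `k` -/
  F : ℕ → Type u
  finite : ∀ k, Finite (F k)
  bounded : ∃ N, ∀ k, N ≤ k → IsEmpty (F k)
  /-- codomain -/
  γ : ∀ {k}, F (k + 1) → F k
  /-- domain -/
  δ : ∀ {k}, F (k + 1) → Set (EFace F k)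
  δ_shape : ∀ {k} (a : F (k + 1)),
    (∃ z, δ a = {z}) ∨ ((δ a).Nonempty ∧ δ a ⊆ Set.range EFace.face)
  δ_zero : ∀ a : F 1, ∃ z, δ a = {z}

namespace Hypergraph

variable (S : Hypergraph.{u})

/-- `γ` on proper and empty faces. -/
def gammaE : {k : ℕ} → EFace S.F (k + 1) → S.F k
  | _, .face x => S.γ x
  | _, .one x => x

/-- `δ` on proper and empty faces. -/
def deltaE : {k : ℕ} → EFace S.F (k + 1) → Set (EFace S.F k)
  | _, .face x => S.δ x
  | _, .one x => {.face x}

variable {S}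

/-- `a` is a loop: `δ(a) = γ(a)`. (Faces of dimension `0` are not loops.) -/
def IsLoop {k : ℕ} (a : S.F (k + 1)) : Prop := S.δ a = {.face (S.γ a)}

/-- `a` is an empty-domain face: `δ(a)` is an empty face. -/
def IsEmptyDom {k : ℕ} (a : S.F (k + 1)) : Prop := ∃ z, S.δ a = {z} ∧ z.IsOne

/-- `δ̇(a)`, the proper faces in `δ(a)`. -/
def dDot {k : ℕ} (a : S.F (k + 1)) : Set (S.F k) := {x | .face x ∈ S.δ a}

/-- `δ̇^{-λ}(a)`, the proper faces in `δ(a)` that are not loops. -/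
def dDotNL {k : ℕ} (a : S.F (k + 2)) : Set (S.F (k + 1)) := {x | x ∈ dDot a ∧ ¬ IsLoop x}

/-- `θ(a) = δ(a) ∪ γ(a)`. -/
def theta {k : ℕ} (a : S.F (k + 1)) : Set (EFace S.F k) := S.δ a ∪ {.face (S.γ a)}

/-- `θ̇(a)`, the proper faces in `θ(a)`. -/
def thetaDot {k : ℕ} (a : S.F (k + 1)) : Set (S.F k) := {x | .face x ∈ theta a}

/-- The internal faces `ι(α)`. -/
def iota {k : ℕ} (α : S.F (k + 2)) : Set (S.F k) :=
  {x | ∃ a ∈ dDotNL α, ∃ b ∈ dDotNL α, S.γ a = x ∧ x ∈ dDot b}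

/-- The initial faces `𝓘 = S^ε - γ(S^{-λ})`. -/
def IsInitial {k : ℕ} (a : S.F (k + 1)) : Prop :=
  IsEmptyDom a ∧ ¬ ∃ ξ : S.F (k + 2), ¬ IsLoop ξ ∧ S.γ ξ = a

/-- The elementary relation `x ⊲⁺ y`. -/
def upStep {k : ℕ} (x y : S.F k) : Prop :=
  ∃ α : S.F (k + 1), ¬ IsLoop α ∧ x ∈ dDot α ∧ S.γ α = y

/-- The upper order `x <⁺ y`. -/
def upLT {k : ℕ} : S.F k → S.F k → Prop := Relation.TransGen upStep

/-- `x ≤⁺ y`. -/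
def upLE {k : ℕ} (x y : S.F k) : Prop := x = y ∨ upLT x y

/-- The relation `a <⁻ b`; it is empty in dimension `0`. -/
def lowLT : {k : ℕ} → S.F k → S.F k → Prop
  | 0 => fun _ _ => False
  | _ + 1 => Relation.TransGen fun a b => S.γ a ∈ dDot b

/-- The empty faces `1_t` with `t ∈ θ̇(x)` for some proper face `x ∈ A`. -/
def onesTheta : {k : ℕ} → Set (EFace S.F k) → Set (EFace S.F k)
  | 0, _ => ∅
  | k + 1, A => {z | ∃ x : S.F (k + 1), .face x ∈ A ∧ ∃ t ∈ thetaDot x, z = .one t}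

/-- The relation `A ≡₁ B`: equality up to empty faces on faces of proper faces. -/
def Eqv1 {k : ℕ} (A B : Set (EFace S.F k)) : Prop := A ∪ onesTheta A = B ∪ onesTheta B

end Hypergraph

/-! ## Ordered face structures -/

/-- A hypergraph with a binary relation `<^∼` on the faces of each dimension. -/
structure OrderedHypergraph extends Hypergraph.{u} where
  /-- the relation `<^∼` -/
  lt : ∀ {k}, F k → F k → Prop

open FaceStr.Hypergraph

/-- The axioms of an ordered face structure. -/
structure OrderedHypergraph.IsOrderedFaceStructure (S : OrderedHypergraph.{u}) : Prop where
  nonempty : Nonempty (S.F 0)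
  globularity_γ : ∀ {k} (a : S.F (k + 2)),
    ({.face (S.γ (S.γ a))} : Set (EFace S.F k)) =
      (fun z => .face (S.gammaE z)) '' S.δ a \ ⋃ x ∈ dDotNL a, S.δ x
  globularity_δ : ∀ {k} (a : S.F (k + 2)),
    Eqv1 (S := S.toHypergraph) (S.δ (S.γ a))
      ((⋃ z ∈ S.δ a, S.deltaE z) \ (fun x => .face (S.γ x)) '' dDotNL a)
  local_discreteness : ∀ {k} (a : S.F (k + 1)), ∀ x ∈ dDot a, ∀ y ∈ dDot a, ¬ upLT x y
  upLT_irrefl : ∀ {k} (x : S.F k), ¬ upLT x x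
  upLT_linear : ∀ x y : S.F 0, x ≠ y → upLT x y ∨ upLT y x
  lt_irrefl : ∀ {k} (a : S.F k), ¬ S.lt a a
  lt_trans : ∀ {k} (a b c : S.F k), S.lt a b → S.lt b c → S.lt a c
  disjoint : ∀ {k} (a b : S.F (k + 1)), ¬ ((S.lt a b ∨ S.lt b a) ∧ (upLT a b ∨ upLT b a))
  lowLT_of_lt : ∀ {k} (a b : S.F k), S.lt a b → lowLT (S := S.toHypergraph) a b
  lt_iff_lowLT : ∀ {k} (a b : S.F (k + 1)), theta a ∩ theta b = ∅ →
    (S.lt a b ↔ lowLT (S := S.toHypergraph) a b)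
  pencil : ∀ {k} (a b : S.F (k + 1)), a ≠ b → (thetaDot a ∩ thetaDot b).Nonempty →
    (S.lt a b ∨ S.lt b a) ∨ (upLT a b ∨ upLT b a)
  pencil_empty : ∀ {k} (a b : S.F (k + 2)), IsEmptyDom a → S.γ (S.γ a) ∈ iota b →
    S.lt a b ∨ upLT a b
  loop_filling : ∀ {k} (a : S.F (k + 1)), IsLoop a →
    ∃ ξ : S.F (k + 2), ¬ IsLoop ξ ∧ S.γ ξ = a

/-- A monotone morphism: a hypergraph morphism that preserves `<^∼`. -/
structure IsMonotoneMorphism (S T : OrderedHypergraph.{u}) (f : ∀ k, S.F k → T.F k) : Prop where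
  map_γ : ∀ {k} (a : S.F (k + 1)), f k (S.γ a) = T.γ (f (k + 1) a)
  bijOn_δ : ∀ {k} (a : S.F (k + 1)), Set.BijOn (EFace.map f) (S.δ a) (T.δ (f (k + 1) a))
  map_lt : ∀ {k} (a b : S.F k), S.lt a b → T.lt (f k a) (f k b)

/-! ## Positive face structures, ideals and quotients -/

/-- The data of a positive hypergraph: `γ` is a function and `δ` is a relation. -/
structure PosData where
  /-- the faces of dimension `k` -/
  F : ℕ → Type u
  /-- codomain -/
  γ : ∀ {k}, F (k + 1) → F k
  /-- domain -/
  δ : ∀ {k}, F (k + 1) → Set (F k)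

namespace PosData

variable (T : PosData.{u})

/-- A positive hypergraph: finitely many faces, all domains nonempty, and `δ₀` is a function. -/
structure IsPositiveHypergraph : Prop where
  finite : ∀ k, Finite (T.F k)
  bounded : ∃ N, ∀ k, N ≤ k → IsEmpty (T.F k)
  δ_nonempty : ∀ {k} (a : T.F (k + 1)), (T.δ a).Nonempty
  δ_zero : ∀ a : T.F 1, ∃ x, T.δ a = {x}

variable {T}

/-- The upper order `<⁺` of positive data. -/
def upLT {k : ℕ} : T.F k → T.F k → Prop :=
  Relation.TransGen fun x y => ∃ α : T.F (k + 1), x ∈ T.δ α ∧ T.γ α = y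

/-- The lower order `<⁻` of positive data; it is empty in dimension `0`. -/
def lowLT : {k : ℕ} → T.F k → T.F k → Prop
  | 0 => fun _ _ => False
  | _ + 1 => Relation.TransGen fun a b => T.γ a ∈ T.δ b

variable (T)

/-- The axioms of a positive face structure. -/
structure IsPositiveFaceStructure : Prop extends IsPositiveHypergraph T where
  nonempty : Nonempty (T.F 0)
  globularity_γ : ∀ {k} (a : T.F (k + 2)),
    ({T.γ (T.γ a)} : Set (T.F k)) = T.γ '' T.δ a \ ⋃ x ∈ T.δ a, T.δ x
  globularity_δ : ∀ {k} (a : T.F (k + 2)),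
    T.δ (T.γ a) = (⋃ x ∈ T.δ a, T.δ x) \ T.γ '' T.δ a
  upLT_irrefl : ∀ {k} (x : T.F k), ¬ upLT x x
  upLT_linear : ∀ x y : T.F 0, x ≠ y → upLT x y ∨ upLT y x
  disjoint : ∀ {k} (a b : T.F (k + 1)), ¬ ((lowLT a b ∨ lowLT b a) ∧ (upLT a b ∨ upLT b a))
  pencil_γ : ∀ {k} (a b : T.F (k + 1)), a ≠ b → T.γ a = T.γ b → upLT a b ∨ upLT b a
  pencil_δ : ∀ {k} (a b : T.F (k + 1)), a ≠ b → (T.δ a ∩ T.δ b).Nonempty → upLT a b ∨ upLT b a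

variable {T}

/-- The unary faces: `δ(a)` has exactly one element. (Faces of dimension `0` are not unary.) -/
def IsUnary : {k : ℕ} → T.F k → Prop
  | 0, _ => False
  | _ + 1, a => ∃ x, T.δ a = {x}

/-- An ideal: a set of unary faces that contains no codomain of a face and no face of the
domain of one of its members. -/
structure IsIdeal (J : ∀ k, Set (T.F k)) : Prop where
  unary : ∀ {k} (a : T.F k), a ∈ J k → IsUnary a
  γ_notMem : ∀ {k} (a : T.F (k + 1)), T.γ a ∉ J k
  δ_notMem : ∀ {k} (a : T.F (k + 1)), a ∈ J (k + 1) → ∀ x ∈ T.δ a, x ∉ J k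

/-- A unary ideal: an ideal contained in `δ(T^u)`. -/
structure IsUnaryIdeal (J : ∀ k, Set (T.F k)) : Prop extends IsIdeal J where
  mem_δ_unary : ∀ {k} (a : T.F k), a ∈ J k → ∃ b : T.F (k + 1), IsUnary b ∧ a ∈ T.δ b

/-- The relation `∼'` on `T_k - J_k` whose generated equivalence relation is `∼_J`. -/
def quotRel (J : ∀ k, Set (T.F k)) (k : ℕ) (x y : {x : T.F k // x ∉ J k}) : Prop :=
  ∃ a ∈ J (k + 1), T.δ a = {x.1} ∧ T.γ a = y.1

/-- The faces `(T_k - J_k)/∼_J` of the quotient. -/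
def QF (J : ∀ k, Set (T.F k)) (k : ℕ) : Type u := Quot (quotRel J k)

/-- The class `[x]` of a face `x` outside the ideal. -/
def QF.mk {J : ∀ k, Set (T.F k)} {k : ℕ} (x : T.F k) (hx : x ∉ J k) : QF J k :=
  Quot.mk _ ⟨x, hx⟩

theorem IsPositiveFaceStructure.γ_eq_of_unary (hT : IsPositiveFaceStructure T) {k : ℕ}
    {a : T.F (k + 2)} {x : T.F (k + 1)} (hx : T.δ a = {x}) :
    T.γ x = T.γ (T.γ a) ∧ T.δ x = T.δ (T.γ a) := by
  have h1 : T.γ x ∉ T.δ x := fun h =>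
    hT.upLT_irrefl (T.γ x) (Relation.TransGen.single ⟨x, h, rfl⟩)
  have hg := hT.globularity_γ a
  have hd := hT.globularity_δ a
  simp only [hx, Set.image_singleton, Set.mem_singleton_iff, Set.iUnion_iUnion_eq_left] at hg hd
  refine ⟨?_, ?_⟩
  · have : T.γ (T.γ a) ∈ ({T.γ x} \ T.δ x : Set (T.F k)) := hg ▸ rfl
    exact this.1.symm
  · rw [hd]
    ext y
    simp only [Set.mem_sdiff, Set.mem_singleton_iff]
    exact ⟨fun hy => ⟨hy, fun e => h1 (e ▸ hy)⟩, fun hy => hy.1⟩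

section Quotient

variable (hT : IsPositiveFaceStructure T) {J : ∀ k, Set (T.F k)} (hJ : IsIdeal J)

/-- `γ_{/J}([a]) = [γ(a)]`. -/
def quotγ : {k : ℕ} → QF J (k + 1) → QF J k := fun {k} =>
  Quot.lift (fun a => QF.mk (T.γ a.1) (hJ.γ_notMem a.1)) (by
    rintro ⟨x, hx⟩ ⟨y, hy⟩ ⟨a, _, h1, h2⟩
    have := (hT.γ_eq_of_unary h1).1
    simp only at h1 h2 this ⊢
    subst h2
    simp only [this])

open Classical in
/-- `δ_{/J}([a])` as a function of the representative `a`: it is `1_{[γγ(a)]}` if `δ(a) ⊆ J`, and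
the set of the classes `[x]` with `x ∈ δ(a) - J` otherwise. (In dimension `1` the first case does
not occur.) -/
def quotδAux : {k : ℕ} → T.F (k + 1) → Set (EFace (QF J) k)
  | 0, a => {z | ∃ x, ∃ hx : x ∉ J 0, x ∈ T.δ a ∧ z = .face (QF.mk x hx)}
  | k + 1, a =>
    if T.δ a ⊆ J (k + 1) then {.one (QF.mk (T.γ (T.γ a)) (hJ.γ_notMem _))}
    else {z | ∃ x, ∃ hx : x ∉ J (k + 1), x ∈ T.δ a ∧ z = .face (QF.mk x hx)}

theorem quotδAux_congr {k : ℕ} {a b : T.F (k + 1)} (h1 : T.γ a = T.γ b) (h2 : T.δ a = T.δ b) :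
    quotδAux hJ a = quotδAux hJ b := by
  cases k with
  | zero => simp only [quotδAux, h2]
  | succ k =>
    have h3 : (QF.mk (T.γ (T.γ a)) (hJ.γ_notMem _) : QF J k) =
        QF.mk (T.γ (T.γ b)) (hJ.γ_notMem _) := by congr 3
    rw [quotδAux, quotδAux, h2, h3]

/-- `δ_{/J}`. -/
def quotδ : {k : ℕ} → QF J (k + 1) → Set (EFace (QF J) k) := fun {k} =>
  Quot.lift (fun a => quotδAux hJ a.1) (by
    rintro ⟨x, hx⟩ ⟨y, hy⟩ ⟨a, _, h1, h2⟩
    have := hT.γ_eq_of_unary h1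
    simp only at h1 h2 this ⊢
    subst h2
    exact quotδAux_congr hJ this.1 this.2)

/-- The quotient `T/J` of a positive face structure by an ideal, with
`[x] <^∼ [y]` iff `x <⁻ y`. -/
def quot : OrderedHypergraph.{u} where
  F := QF J
  finite k := by
    have := hT.finite k
    unfold QF
    infer_instance
  bounded := by
    obtain ⟨N, hN⟩ := hT.bounded
    refine ⟨N, fun k hk => ⟨fun x => ?_⟩⟩
    induction x using Quot.ind with
    | mk x => exact (hN k hk).false x.1
  γ := quotγ hT hJ
  δ := quotδ hT hJ
  δ_shape {k} a := by
    induction a using Quot.ind with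
    | mk a =>
      change (∃ z, quotδAux hJ a.1 = {z}) ∨
        ((quotδAux hJ a.1).Nonempty ∧ quotδAux hJ a.1 ⊆ Set.range EFace.face)
      cases k with
      | zero =>
        right
        obtain ⟨x, hx⟩ := hT.δ_nonempty a.1
        refine ⟨⟨_, x, fun h => hJ.unary x h, hx, rfl⟩, ?_⟩
        rintro z ⟨x, hx, -, rfl⟩
        exact ⟨_, rfl⟩
      | succ k =>
        by_cases h : T.δ a.1 ⊆ J (k + 1)
        · left
          refine ⟨.one (QF.mk (T.γ (T.γ a.1)) (hJ.γ_notMem _)), ?_⟩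
          simp only [quotδAux, if_pos h]
        · right
          simp only [quotδAux, if_neg h]
          obtain ⟨x, hx, hxJ⟩ := Set.not_subset.1 h
          refine ⟨⟨_, x, hxJ, hx, rfl⟩, ?_⟩
          rintro z ⟨x, hx, -, rfl⟩
          exact ⟨_, rfl⟩
  δ_zero a := by
    induction a using Quot.ind with
    | mk a =>
      change ∃ z, quotδAux hJ a.1 = {z}
      obtain ⟨x, hx⟩ := hT.δ_zero a.1
      refine ⟨.face (QF.mk x fun h => hJ.unary x h), ?_⟩
      ext z
      constructor
      · rintro ⟨y, hy, hyx, rfl⟩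
        rw [hx, Set.mem_singleton_iff] at hyx
        subst hyx
        rfl
      · rintro rfl
        exact ⟨x, fun h => hJ.unary x h, hx ▸ rfl, rfl⟩
  lt {k} X Y := ∃ x y : {x : T.F k // x ∉ J k}, X = Quot.mk _ x ∧ Y = Quot.mk _ y ∧ lowLT x.1 y.1

open Classical in
/-- The quotient map `p_J : T → T/J`, with `p_J(a) = 1_{[γ(a)]}` for `a ∈ J` and `p_J(a) = [a]`
otherwise. -/
noncomputable def quotMap : (k : ℕ) → T.F k → EFace (QF J) k
  | 0, a => .face (QF.mk a fun h => hJ.unary a h)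
  | k + 1, a =>
    if h : a ∈ J (k + 1) then .one (QF.mk (T.γ a) (hJ.γ_notMem a)) else .face (QF.mk a h)

end Quotient

/-! ## Collapsing morphisms and positive covers -/

/-- A collapsing morphism from a positive face structure (with `<^∼` being `<⁻`) to an ordered
face structure. -/
structure IsCollapsing (T : PosData.{u}) (S : OrderedHypergraph.{u})
    (f : ∀ k, T.F k → EFace S.F k) : Prop where
  map_lt : ∀ {k} (a b : T.F k) (a' b' : S.F k), f k a = .face a' → f k b = .face b' →
    lowLT a b → S.lt a' b'
  map_γ : ∀ {k} (a : T.F (k + 1)), f k (T.γ a) = .face (S.gammaE (f (k + 1) a))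
  map_δ : ∀ {k} (a : T.F (k + 1)),
    Eqv1 (S := S.toHypergraph) (f k '' T.δ a) (S.deltaE (f (k + 1) a))

/-- The kernel of a collapsing morphism: the faces sent to empty faces. -/
def ker {S : OrderedHypergraph.{u}} (f : ∀ k, T.F k → EFace S.F k) (k : ℕ) : Set (T.F k) :=
  {a | (f k a).IsOne}

/-- A positive cover: a collapsing morphism that factors as the quotient map by an ideal followed
by a monotone isomorphism. -/
def IsPositiveCover (hT : IsPositiveFaceStructure T) (S : OrderedHypergraph.{u})
    (f : ∀ k, T.F k → EFace S.F k) : Prop :=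
  IsCollapsing T S f ∧
    ∃ (J : ∀ k, Set (T.F k)) (hJ : IsIdeal J)
      (h : ∀ k, QF J k → S.F k) (h' : ∀ k, S.F k → QF J k),
      IsMonotoneMorphism (quot hT hJ) S h ∧ IsMonotoneMorphism S (quot hT hJ) h' ∧
      (∀ k, Function.LeftInverse (h' k) (h k)) ∧ (∀ k, Function.RightInverse (h' k) (h k)) ∧
      ∀ k (a : T.F k), f k a = EFace.map h (quotMap hJ k a)

end PosData

/-! ## Cuts of initial faces -/

namespace OrderedHypergraph

/-- The set `𝓘_x` of initial faces `α` with `δ(α) = 1_x`. -/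
def initialAt (S : OrderedHypergraph.{u}) {k : ℕ} (x : S.F k) : Set (S.F (k + 2)) :=
  {α | IsInitial α ∧ S.δ α = {.one x}}

/-- A cut `(x, L, U)` of the initial faces based on a face `x` of dimension `k`. -/
@[ext] structure Cut (S : OrderedHypergraph.{u}) (k : ℕ) where
  base : S.F k
  L : Set (S.F (k + 2))
  U : Set (S.F (k + 2))
  union_eq : L ∪ U = S.initialAt base
  lt : ∀ α ∈ L, ∀ β ∈ U, S.lt (S.γ α) (S.γ β)

end OrderedHypergraph

namespace OrderedHypergraph.IsOrderedFaceStructure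

variable {S : OrderedHypergraph.{u}}

theorem γγ_eq (hS : S.IsOrderedFaceStructure) {k : ℕ} {α : S.F (k + 2)} {x : S.F k} (h : S.δ α = {.one x}) :
    S.γ (S.γ α) = x := by
  have h1 : (EFace.face (S.γ (S.γ α)) : EFace S.F k) ∈
      ((fun z => .face (S.gammaE z)) '' S.δ α \ ⋃ y ∈ dDotNL α, S.δ y : Set (EFace S.F k)) :=
    hS.globularity_γ α ▸ rfl
  obtain ⟨⟨z, hz, he⟩, -⟩ := h1
  rw [h, Set.mem_singleton_iff] at hz
  subst hz
  exact (EFace.face.inj he).symm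

theorem not_upLT_initial {k : ℕ} {a β : S.F (k + 1)} (hβ : IsInitial β) : ¬ upLT a β := by
  intro h
  obtain ⟨c, -, ξ, h1, -, h2⟩ := Relation.TransGen.tail'_iff.1 h
  exact hβ.2 ⟨ξ, h1, h2⟩

theorem not_lowLT_of_δ_eq_one {k : ℕ} {a β : S.F (k + 2)} {x : S.F k} (hβ : S.δ β = {.one x}) :
    ¬ lowLT (S := S.toHypergraph) a β := by
  intro h
  obtain ⟨c, -, h1⟩ := Relation.TransGen.tail'_iff.1 h
  simp [dDot, hβ] at h1

theorem upLT_of_lowLT {k : ℕ} {a b : S.F (k + 1)} (h : lowLT (S := S.toHypergraph) a b)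
    (hb : ¬ IsLoop b) : upLT (S := S.toHypergraph) (S.γ a) (S.γ b) := by
  obtain ⟨c, h1, h2⟩ := Relation.TransGen.tail'_iff.1 h
  refine Relation.TransGen.tail' ?_ ⟨b, hb, h2, rfl⟩
  clear h2 h
  induction h1 with
  | refl => exact .refl
  | @tail d e _ h3 ih =>
    by_cases he : IsLoop e
    · have h4 : EFace.face (S.γ d) ∈ S.δ e := h3
      rw [he, Set.mem_singleton_iff] at h4
      exact EFace.face.inj h4 ▸ ih
    · exact ih.tail ⟨e, he, h3, rfl⟩

theorem wf (hS : S.IsOrderedFaceStructure) (k : ℕ) :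
    WellFounded (upLT (S := S.toHypergraph) (k := k)) := by
  have := S.finite k
  have : IsTrans (S.F k) (upLT (S := S.toHypergraph)) := ⟨fun _ _ _ => Relation.TransGen.trans⟩
  have : Std.Irrefl (upLT (S := S.toHypergraph) (k := k)) := ⟨hS.upLT_irrefl⟩
  exact Finite.wellFounded_of_trans_of_irrefl _

theorem wf' (hS : S.IsOrderedFaceStructure) (k : ℕ) :
    WellFounded (fun x y : S.F k => upLT (S := S.toHypergraph) y x) := by
  have := S.finite k
  have : IsTrans (S.F k) (fun x y : S.F k => upLT (S := S.toHypergraph) y x) :=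
    ⟨fun _ _ _ h1 h2 => Relation.TransGen.trans h2 h1⟩
  have : Std.Irrefl (fun x y : S.F k => upLT (S := S.toHypergraph) y x) := ⟨hS.upLT_irrefl⟩
  exact Finite.wellFounded_of_trans_of_irrefl _

/-- Every element of `γδ(a)` other than `γγ(a)` lies in `δδ̇^{-λ}(a)`. -/
theorem exists_dDotNL (hS : S.IsOrderedFaceStructure) {k : ℕ} {a : S.F (k + 2)} {b : S.F (k + 1)}
    (hb : b ∈ dDot a) (h : S.γ b ≠ S.γ (S.γ a)) :
    ∃ c ∈ dDotNL (S := S.toHypergraph) a, S.γ b ∈ dDot c := by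
  by_contra hc
  have h1 : (EFace.face (S.γ b) : EFace S.F k) ∈
      ((fun z => .face (S.gammaE z)) '' S.δ a \ ⋃ y ∈ dDotNL a, S.δ y : Set (EFace S.F k)) := by
    refine ⟨⟨.face b, hb, rfl⟩, ?_⟩
    simp only [Set.mem_iUnion, not_exists]
    exact fun c hc1 hc2 => hc ⟨c, hc1, hc2⟩
  rw [← hS.globularity_γ a, Set.mem_singleton_iff] at h1
  exact h (EFace.face.inj h1)

theorem face_notMem_onesTheta {k : ℕ} (A : Set (EFace S.F k)) (y : S.F k) :
    EFace.face y ∉ onesTheta (S := S.toHypergraph) A := by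
  cases k with
  | zero => exact fun h => h
  | succ k =>
    rintro ⟨_, _, _, _, h⟩
    cases h

/-- A face with a proper face in its domain that is the codomain of a non-loop `ξ` and not a loop
itself has the same codomain as some non-loop in `δ(ξ)` with a proper face in its domain. -/
theorem exists_below (hS : S.IsOrderedFaceStructure) {k : ℕ} {ξ : S.F (k + 3)} {a c : S.F (k + 2)}
    (hc : c ∈ dDot ξ) (ha : S.γ ξ = a) (hl : ¬ IsLoop a)
    (hn : (dDot (S := S.toHypergraph) a).Nonempty) :
    ∃ b ∈ dDotNL (S := S.toHypergraph) ξ, S.γ b = S.γ a ∧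
      (dDot (S := S.toHypergraph) b).Nonempty := by
  obtain ⟨y, hy⟩ := hn
  have hya : y ≠ S.γ a := fun h =>
    hS.upLT_irrefl y (Relation.TransGen.single ⟨a, hl, hy, h.symm⟩)
  have h1 : EFace.face y ∈ S.δ (S.γ ξ) ∪ onesTheta (S := S.toHypergraph) (S.δ (S.γ ξ)) :=
    Or.inl (ha ▸ hy)
  rw [hS.globularity_δ ξ] at h1
  have h2 := (h1.resolve_right (face_notMem_onesTheta _ y)).1
  simp only [Set.mem_iUnion] at h2
  obtain ⟨z, hz, hyz⟩ := h2
  have hq : ∃ b ∈ dDotNL (S := S.toHypergraph) ξ, (dDot (S := S.toHypergraph) b).Nonempty := by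
    cases z with
    | one u =>
      exfalso
      rcases S.δ_shape ξ with ⟨w, hw⟩ | ⟨-, hw⟩
      · have e1 : EFace.face c ∈ S.δ ξ := hc
        rw [hw, Set.mem_singleton_iff] at hz e1
        rw [← e1] at hz
        cases hz
      · obtain ⟨w, hw⟩ := hw hz
        cases hw
    | face b =>
      by_cases hb : IsLoop b
      · have e1 : EFace.face y ∈ S.δ b := hyz
        rw [hb, Set.mem_singleton_iff] at e1
        have e2 := EFace.face.inj e1
        obtain ⟨b', h3, h4⟩ := hS.exists_dDotNL (a := ξ) (b := b) hz
          (by rw [← e2, ha]; exact hya)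
        exact ⟨b', h3, _, h4⟩
      · exact ⟨b, ⟨hz, hb⟩, y, hyz⟩
  obtain ⟨b, ⟨hb1, hb2⟩, hb3⟩ := (InvImage.wf S.γ (hS.wf' (k + 1))).has_min
    {b | b ∈ dDotNL (S := S.toHypergraph) ξ ∧ (dDot (S := S.toHypergraph) b).Nonempty} hq
  refine ⟨b, hb1, ?_, hb2⟩
  by_contra hne
  obtain ⟨b', h3, h4⟩ := hS.exists_dDotNL (a := ξ) (b := b) hb1.1 (by rw [ha]; exact hne)
  exact hb3 b' ⟨h3, _, h4⟩ (Relation.TransGen.single ⟨b', h3.2, h4, rfl⟩)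

/-- No face is strictly below `γ(β)` in the upper order, for `β` initial. -/
theorem not_upLT_γ_initial (hS : S.IsOrderedFaceStructure) {k : ℕ} {x : S.F k} {β : S.F (k + 2)}
    (hβ : β ∈ S.initialAt x) (y : S.F (k + 1)) : ¬ upLT y (S.γ β) := by
  intro h
  obtain ⟨y', -, a₀, ha₀, hy₀, hγ₀⟩ := Relation.TransGen.tail'_iff.1 h
  obtain ⟨a, ⟨ha1, ha2, ha3⟩, ha4⟩ := (hS.wf (k + 2)).has_min
    {a | ¬ IsLoop (S := S.toHypergraph) a ∧ S.γ a = S.γ β ∧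
      (dDot (S := S.toHypergraph) a).Nonempty} ⟨a₀, ha₀, hγ₀, y', hy₀⟩
  have hne : a ≠ β := by
    rintro rfl
    obtain ⟨w, hw⟩ := ha3
    simp [dDot, hβ.2] at hw
  rcases hS.pencil a β hne ⟨S.γ β, Or.inr (ha2 ▸ rfl), Or.inr rfl⟩ with (h1 | h1) | (h1 | h1)
  · exact not_lowLT_of_δ_eq_one hβ.2 (hS.lowLT_of_lt _ _ h1)
  · exact hS.upLT_irrefl _ (ha2 ▸ upLT_of_lowLT (hS.lowLT_of_lt _ _ h1) ha1)
  · exact not_upLT_initial hβ.1 h1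
  · obtain ⟨c, -, ξ, hξ, hc, hγ⟩ := Relation.TransGen.tail'_iff.1 h1
    obtain ⟨b, hb1, hb2, hb3⟩ := hS.exists_below hc hγ ha1 ha3
    exact ha4 b ⟨hb1.2, hb2.trans ha2, hb3⟩ (Relation.TransGen.single ⟨ξ, hξ, hb1.1, hγ⟩)

/-- The initial faces based on `x` are linearly ordered by `γ(α) <^∼ γ(β)`. -/
theorem initialAt_linear (hS : S.IsOrderedFaceStructure) {k : ℕ} {x : S.F k} {α β : S.F (k + 2)}
    (hα : α ∈ S.initialAt x) (hβ : β ∈ S.initialAt x) (hne : α ≠ β) :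
    S.lt (S.γ α) (S.γ β) ∨ S.lt (S.γ β) (S.γ α) := by
  have h1 : S.γ α ≠ S.γ β := by
    intro h
    rcases hS.pencil α β hne ⟨S.γ β, Or.inr (h ▸ rfl), Or.inr rfl⟩ with (h1 | h1) | (h1 | h1)
    · exact not_lowLT_of_δ_eq_one hβ.2 (hS.lowLT_of_lt _ _ h1)
    · exact not_lowLT_of_δ_eq_one hα.2 (hS.lowLT_of_lt _ _ h1)
    · exact not_upLT_initial hβ.1 h1
    · exact not_upLT_initial hα.1 h1
  have e1 := hS.γγ_eq hα.2
  have e2 := hS.γγ_eq hβ.2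
  rcases hS.pencil (S.γ α) (S.γ β) h1 ⟨x, Or.inr (e1 ▸ rfl), Or.inr (e2 ▸ rfl)⟩ with h | (h | h)
  · exact h
  · exact absurd h (hS.not_upLT_γ_initial hβ _)
  · exact absurd h (hS.not_upLT_γ_initial hα _)

/-- The cut `(γ(a), -, ↑a)`, where `↑a = {α ∈ 𝓘_{γ(a)} : a <^∼ γ(α)}`. -/
def upCut (hS : S.IsOrderedFaceStructure) {k : ℕ} (a : S.F (k + 1)) : S.Cut k where
  base := S.γ a
  L := S.initialAt (S.γ a) \ {α | S.lt a (S.γ α)}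
  U := {α | α ∈ S.initialAt (S.γ a) ∧ S.lt a (S.γ α)}
  union_eq := by
    ext α
    by_cases h : S.lt a (S.γ α) <;> simp [h]
  lt α hα β hβ := by
    rcases hS.initialAt_linear hα.1 hβ.1 (by rintro rfl; exact hα.2 hβ.2) with h | h
    · exact h
    · exact absurd (hS.lt_trans _ _ _ hβ.2 h) hα.2

/-- The cut `(x, ↓ₓa, -)`, where `↓ₓa = {α ∈ 𝓘_x : γ(α) <^∼ a}`. -/
def downCut (hS : S.IsOrderedFaceStructure) {k : ℕ} (x : S.F k) (a : S.F (k + 1)) : S.Cut k where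
  base := x
  L := {α | α ∈ S.initialAt x ∧ S.lt (S.γ α) a}
  U := S.initialAt x \ {α | S.lt (S.γ α) a}
  union_eq := by
    ext α
    by_cases h : S.lt (S.γ α) a <;> simp [h]
  lt α hα β hβ := by
    rcases hS.initialAt_linear hα.1 hβ.1 (by rintro rfl; exact hβ.2 hα.2) with h | h
    · exact h
    · exact absurd (hS.lt_trans _ _ _ h hα.2) hβ.2

/-! ## The positive cover -/

/-- The faces of dimension `k` of `S†`: the cuts over the faces of dimension `k` and the bars of
the initial faces of dimension `k + 1`. -/
inductive DaggerFace (S : OrderedHypergraph.{u}) (k : ℕ) : Type u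
  | cut (c : S.Cut k)
  | bar (α : S.F (k + 1)) (hα : IsInitial α)

/-- `S†`. -/
def dagger (hS : S.IsOrderedFaceStructure) : PosData.{u} where
  F := DaggerFace S
  γ
    | .cut c => .cut (hS.upCut c.base)
    | .bar α _ => .cut (hS.upCut (S.γ α))
  δ
    | .cut c => {z | ∃ (α : _) (hα : IsInitial α), upLE α c.base ∧ z = .bar α hα} ∪
        {z | ∃ x ∈ dDot c.base, z = .cut (hS.downCut x c.base)}
    | .bar α _ => {.cut (hS.downCut (S.γ (S.γ α)) (S.γ α))}

theorem not_isInitial_one (α : S.F 1) : ¬ IsInitial α := by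
  rintro ⟨⟨z, -, hz⟩, -⟩
  cases z
  exact hz

/-- The map `q_S : S† → S`, sending a cut over `a` to `a` and the bar of `α` to `1_{γγ(α)}`.
(There are no bars of dimension `0`.) -/
def q (hS : S.IsOrderedFaceStructure) : (k : ℕ) → hS.dagger.F k → EFace S.F k
  | _, .cut c => .face c.base
  | 0, .bar α hα => absurd hα (not_isInitial_one α)
  | _ + 1, .bar α _ => .one (S.γ (S.γ α))

/-- The set of all bars in `S†`. -/
def bars (hS : S.IsOrderedFaceStructure) (k : ℕ) : Set (hS.dagger.F k) :=
  {z | ∃ (α : _) (hα : IsInitial α), z = .bar α hα}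

end OrderedHypergraph.IsOrderedFaceStructure

end FaceStr

/-! For each face x of S, the initial faces with domain 1_x have as codomains loops at x. These
loops are linearly ordered by <^∼ and minimal for <⁺. S† pulls x apart into the chain of all cuts of
this order, and the bar of α is a genuine arrow between the two consecutive cuts that α separates.
Loops become non-loops, empty domains are filled by bars, and contracting the bars glues each chain
of cuts back to one face. This is why S†/bars is S.

All statements about S† are translated into S by `sface`. If `sface A = a`, then `A` has codomain
`upCut a`, and the cuts in its domain are the `downCut y a` with y ∈ δ̇(a). The upper order of S† is
lexicographic: first <⁺ on bases, then inclusion of lower parts (`dagger_upLT_iff`). The lower order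
of S† is exactly <^∼ on underlying faces (`lt_sface_of_lowLT`, `lowLT_of_lt_sface`). The decisive
fact is `lt_of_upCut_eq_downCut`: an output cut equal to an input cut forces <^∼, because every loop
contains the loop γ(β) of an initial face β, which tells the cuts on its two sides apart. The pencil
axioms come from `upLT_of_upCut_eq`, `upLT_of_downCut_eq` and `upLE_chain`.

Globularity is the main work. The faces underlying the domain of a cut over a form `refinedDom a`:
the domain of a with the loops of the initial faces inside a inserted. No two of them are
<⁺-comparable, so two that share a face are ordered by <^∼. Suppose the output cut of a member x is
neither that of γ(a) nor the input cut of a given next member. Then some initial face separates the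
two cuts, and the first one after x lies inside a or ends below the domain of a (`upLE_or_of_min`,
`initial_between`). It therefore provides a loop in the refined domain whose input cut is the output
cut of x (`upCut_refinedDom`). `downCut_refinedDom` is the mirror image, with the last separating
face. Members extreme for <^∼ realise the outer cuts. -/

namespace FaceStr
open FaceStr.Hypergraph

/-! ### Elementary facts on domains, loops and the upper order. -/

namespace Hypergraph

variable {S : Hypergraph.{u}} {k : ℕ}

theorem upLE.refl (a : S.F k) : upLE a a := Or.inl rfl

theorem upLT.trans {a b c : S.F k} (h : upLT a b) (h' : upLT b c) : upLT a c :=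
  Relation.TransGen.trans h h'

theorem upLT.trans_le {a b c : S.F k} (h : upLT a b) (h' : upLE b c) : upLT a c := by
  rcases h' with rfl | h'
  exacts [h, h.trans h']

theorem upLE.trans_lt {a b c : S.F k} (h : upLE a b) (h' : upLT b c) : upLT a c := by
  rcases h with rfl | h
  exacts [h', h.trans h']

theorem upLE.trans {a b c : S.F k} (h : upLE a b) (h' : upLE b c) : upLE a c := by
  rcases h with rfl | h
  exacts [h', Or.inr (h.trans_le h')]

theorem upLT.le {a b : S.F k} (h : upLT a b) : upLE a b := Or.inr h

theorem upLT.of_mem {a : S.F (k + 1)} {x : S.F k} (ha : ¬ IsLoop a) (hx : x ∈ dDot a) :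
    upLT x (S.γ a) := Relation.TransGen.single ⟨a, ha, hx, rfl⟩

theorem upLE.of_mem {a : S.F (k + 1)} {x : S.F k} (hx : x ∈ dDot a) : upLE x (S.γ a) := by
  by_cases ha : IsLoop a
  · have h1 : EFace.face x ∈ S.δ a := hx
    rw [ha] at h1
    exact Or.inl (EFace.face.inj h1)
  · exact (upLT.of_mem ha hx).le

theorem upLT.head {x z : S.F k} (h : upLT x z) :
    ∃ a : S.F (k + 1), ¬ IsLoop a ∧ x ∈ dDot a ∧ upLE (S.γ a) z := by
  obtain ⟨w, ⟨a, h1, h2, rfl⟩, h3⟩ := Relation.TransGen.head'_iff.1 h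
  rcases Relation.reflTransGen_iff_eq_or_transGen.1 h3 with h3 | h3
  · exact ⟨a, h1, h2, Or.inl h3.symm⟩
  · exact ⟨a, h1, h2, Or.inr h3⟩

theorem upLT.tail {x z : S.F k} (h : upLT x z) :
    ∃ (a : S.F (k + 1)) (w : S.F k), ¬ IsLoop a ∧ upLE x w ∧ w ∈ dDot a ∧ S.γ a = z := by
  obtain ⟨w, h3, ⟨a, h1, h2, rfl⟩⟩ := Relation.TransGen.tail'_iff.1 h
  rcases Relation.reflTransGen_iff_eq_or_transGen.1 h3 with h3 | h3
  · exact ⟨a, w, h1, Or.inl h3.symm, h2, rfl⟩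
  · exact ⟨a, w, h1, Or.inr h3, h2, rfl⟩

/-- The face `a` is minimal for the upper order. -/
def IsMin (a : S.F k) : Prop := ∀ x, ¬ upLT x a

theorem dDot_eq_of_isLoop {a : S.F (k + 1)} (h : IsLoop a) : dDot a = {S.γ a} := by
  ext x
  constructor
  · intro hx
    have h1 : EFace.face x ∈ S.δ a := hx
    rw [h] at h1
    exact EFace.face.inj h1
  · rintro rfl
    change EFace.face _ ∈ S.δ a
    rw [h]
    rfl

theorem mem_thetaDot {a : S.F (k + 1)} {x : S.F k} :
    x ∈ thetaDot a ↔ x ∈ dDot a ∨ x = S.γ a := by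
  constructor
  · rintro (h | h)
    exacts [Or.inl h, Or.inr (EFace.face.inj h)]
  · rintro (h | rfl)
    exacts [Or.inl h, Or.inr rfl]

theorem δ_eq_image_of_nonempty {a : S.F (k + 1)} (h : (dDot a).Nonempty) :
    S.δ a = EFace.face '' dDot a := by
  obtain ⟨x, hx⟩ := h
  have hx' : EFace.face x ∈ S.δ a := hx
  ext z
  constructor
  · intro hz
    rcases S.δ_shape a with ⟨w, hw⟩ | ⟨-, hw⟩
    · rw [hw] at hz hx'
      have e : z = EFace.face x := (Set.mem_singleton_iff.1 hz).trans (Set.mem_singleton_iff.1 hx').symm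
      exact ⟨x, hx, e.symm⟩
    · obtain ⟨w, rfl⟩ := hw hz
      exact ⟨w, hz, rfl⟩
  · rintro ⟨w, hw, rfl⟩
    exact hw

theorem dDot_nonempty_one (a : S.F 1) : (dDot a).Nonempty := by
  obtain ⟨z, hz⟩ := S.δ_zero a
  cases z with
  | face x => exact ⟨x, by change _ ∈ S.δ a; rw [hz]; rfl⟩

theorem dDot_nonempty_or (a : S.F (k + 2)) : (dDot a).Nonempty ∨ ∃ u, S.δ a = {.one u} := by
  rcases S.δ_shape a with ⟨w, hw⟩ | ⟨⟨z, hz⟩, hw⟩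
  · cases w with
    | face x => exact Or.inl ⟨x, by change _ ∈ S.δ a; rw [hw]; rfl⟩
    | one u => exact Or.inr ⟨u, hw⟩
  · obtain ⟨w, rfl⟩ := hw hz
    exact Or.inl ⟨w, hz⟩

theorem dDot_eq_empty {a : S.F (k + 2)} {u : S.F k} (h : S.δ a = {.one u}) : dDot a = ∅ := by
  ext x
  simp [dDot, h]

theorem not_isLoop_of_one {a : S.F (k + 2)} {u : S.F k} (h : S.δ a = {.one u}) : ¬ IsLoop a := by
  intro h1
  rw [IsLoop, h, Set.singleton_eq_singleton_iff] at h1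
  cases h1

theorem IsInitial.exists_one {a : S.F (k + 2)} (h : IsInitial a) : ∃ u, S.δ a = {.one u} := by
  obtain ⟨⟨z, hz, hz'⟩, -⟩ := h
  cases z with
  | face => exact hz'.elim
  | one u => exact ⟨u, hz⟩

theorem IsInitial.not_isLoop {a : S.F (k + 1)} (h : IsInitial a) : ¬ IsLoop a := by
  obtain ⟨⟨z, hz, hz'⟩, -⟩ := h
  intro h1
  rw [IsLoop, hz, Set.singleton_eq_singleton_iff] at h1
  rw [h1] at hz'
  exact hz'

theorem IsInitial.isMin {a : S.F (k + 1)} (h : IsInitial a) : IsMin a := by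
  intro x hx
  obtain ⟨ξ, w, h1, -, -, h2⟩ := hx.tail
  exact h.2 ⟨ξ, h1, h2⟩

theorem IsMin.eq {a x : S.F k} (h : IsMin a) (hx : upLE x a) : x = a :=
  hx.resolve_right (h x)

end Hypergraph

/-! ### Loops, codomains and chains in an ordered face structure. -/

namespace OrderedHypergraph.IsOrderedFaceStructure

variable {S : OrderedHypergraph.{u}} {k : ℕ}

theorem isLoop_of_mem (hS : S.IsOrderedFaceStructure) {a : S.F (k + 1)} (h : S.γ a ∈ dDot a) :
    IsLoop a := by
  by_contra h1
  exact hS.upLT_irrefl _ (upLT.of_mem h1 h)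

theorem not_lt_le (hS : S.IsOrderedFaceStructure) {a b : S.F k} (h : upLT a b) (h' : upLE b a) :
    False := hS.upLT_irrefl _ (h.trans_le h')

theorem le_antisymm (hS : S.IsOrderedFaceStructure) {a b : S.F k} (h : upLE a b) (h' : upLE b a) :
    a = b := by
  rcases h with h | h
  exacts [h, (hS.not_lt_le h h').elim]

theorem not_lt_of_upLE (hS : S.IsOrderedFaceStructure) {a b : S.F (k + 1)} (h : upLE a b) :
    ¬ S.lt a b := by
  rcases h with rfl | h
  exacts [hS.lt_irrefl _, fun h' => hS.disjoint a b ⟨Or.inl h', Or.inl h⟩]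

theorem not_lt_of_upLE' (hS : S.IsOrderedFaceStructure) {a b : S.F (k + 1)} (h : upLE a b) :
    ¬ S.lt b a := by
  rcases h with rfl | h
  exacts [hS.lt_irrefl _, fun h' => hS.disjoint a b ⟨Or.inr h', Or.inl h⟩]

theorem lt_asymm (hS : S.IsOrderedFaceStructure) {a b : S.F k} (h : S.lt a b) (h' : S.lt b a) :
    False := hS.lt_irrefl _ (hS.lt_trans _ _ _ h h')

theorem γ_eq_or (hS : S.IsOrderedFaceStructure) {a : S.F (k + 2)} {c : S.F (k + 1)}
    (hc : c ∈ dDot a) : S.γ c = S.γ (S.γ a) ∨ ∃ d ∈ dDotNL a, S.γ c ∈ dDot d := by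
  by_cases h : S.γ c = S.γ (S.γ a)
  exacts [Or.inl h, Or.inr (hS.exists_dDotNL hc h)]

theorem exists_γ_eq (hS : S.IsOrderedFaceStructure) {a : S.F (k + 2)} (h : (dDot a).Nonempty) :
    ∃ c ∈ dDot a, S.γ c = S.γ (S.γ a) := by
  have h1 : (EFace.face (S.γ (S.γ a)) : EFace S.F k) ∈
      ((fun z => .face (S.gammaE z)) '' S.δ a \ ⋃ y ∈ dDotNL a, S.δ y : Set (EFace S.F k)) :=
    hS.globularity_γ a ▸ rfl
  obtain ⟨⟨z, hz, he⟩, -⟩ := h1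
  rw [δ_eq_image_of_nonempty h] at hz
  obtain ⟨c, hc, rfl⟩ := hz
  exact ⟨c, hc, EFace.face.inj he⟩

/-- The relation ≡₁ only absorbs empty faces, so on proper faces the globularity of δ is an honest
equality. -/
theorem mem_dDot_γ_iff (hS : S.IsOrderedFaceStructure) {a : S.F (k + 2)} {y : S.F k} :
    y ∈ dDot (S.γ a) ↔ EFace.face y ∈
      ((⋃ z ∈ S.δ a, S.deltaE z) \ (fun x => .face (S.γ x)) '' dDotNL a : Set (EFace S.F k)) := by
  have h := Set.ext_iff.1 (hS.globularity_δ a) (.face y)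
  simp only [Set.mem_union, face_notMem_onesTheta, or_false] at h
  exact h

theorem exists_mem_of_mem_γ (hS : S.IsOrderedFaceStructure) {a : S.F (k + 2)} {y : S.F k}
    (h : (dDot a).Nonempty) (hy : y ∈ dDot (S.γ a)) : ∃ c ∈ dDot a, y ∈ dDot c := by
  have h1 := (hS.mem_dDot_γ_iff.1 hy).1
  simp only [Set.mem_iUnion] at h1
  obtain ⟨z, hz, h2⟩ := h1
  rw [δ_eq_image_of_nonempty h] at hz
  obtain ⟨c, hc, rfl⟩ := hz
  exact ⟨c, hc, h2⟩

theorem γ_ne_of_mem_γ (hS : S.IsOrderedFaceStructure) {a : S.F (k + 2)} {d : S.F (k + 1)}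
    (hd : d ∈ dDotNL a) : S.γ d ∉ dDot (S.γ a) :=
  fun h => (hS.mem_dDot_γ_iff.1 h).2 ⟨d, hd, rfl⟩

theorem mem_γ_or (hS : S.IsOrderedFaceStructure) {a : S.F (k + 2)} {c : S.F (k + 1)} {y : S.F k}
    (hc : c ∈ dDot a) (hy : y ∈ dDot c) : y ∈ dDot (S.γ a) ∨ ∃ d ∈ dDotNL a, S.γ d = y := by
  by_cases h : ∃ d ∈ dDotNL a, S.γ d = y
  · exact Or.inr h
  · refine Or.inl (hS.mem_dDot_γ_iff.2 ⟨Set.mem_biUnion hc hy, ?_⟩)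
    rintro ⟨d, hd, e⟩
    exact h ⟨d, hd, EFace.face.inj e⟩

theorem isLoop_γ_of_one (hS : S.IsOrderedFaceStructure) {a : S.F (k + 2)} {u : S.F k}
    (h : S.δ a = {.one u}) : IsLoop (S.γ a) := by
  apply hS.isLoop_of_mem
  rw [hS.γγ_eq h, hS.mem_dDot_γ_iff, h]
  refine ⟨by simp [deltaE], ?_⟩
  rintro ⟨d, hd, -⟩
  have := hd.1
  rw [dDot_eq_empty h] at this
  exact this

/-- Otherwise every face in the domain of a has a proper domain, since an empty domain 1_v would
survive ≡₁ and give v = u. Then 1_u can only arise from θ̇ of a proper face in δδ(a) − γδ̇^{-λ}(a).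
That face would have to lie in δγ(a), which has no proper face. -/
theorem exists_one_of_γ_one (hS : S.IsOrderedFaceStructure) {a : S.F (k + 3)} {u : S.F k}
    (h : S.δ (S.γ a) = {.one u}) : ∃ c ∈ dDot a, S.δ c = {.one u} := by
  have hne : (dDot a).Nonempty := by
    rcases dDot_nonempty_or a with h1 | ⟨v, h1⟩
    · exact h1
    · exact absurd (hS.isLoop_γ_of_one h1) (not_isLoop_of_one h)
  by_contra hc
  have key : ∀ c ∈ dDot a, (dDot (S := S.toHypergraph) c).Nonempty := by
    intro c hc1
    rcases dDot_nonempty_or c with h1 | ⟨v, h1⟩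
    · exact h1
    exfalso
    have h2 : (EFace.one v : EFace S.F (k + 1)) ∈
      ((⋃ z ∈ S.δ a, S.deltaE z) \ (fun x => .face (S.γ x)) '' dDotNL a : Set (EFace S.F (k + 1))) := by
      refine ⟨Set.mem_biUnion hc1 (by simp [deltaE, h1]), ?_⟩
      rintro ⟨d, -, e⟩
      cases e
    have h3 := Set.ext_iff.1 (hS.globularity_δ a) (.one v)
    have h4 := h3.2 (Or.inl h2)
    rw [h] at h4
    rcases h4 with h4 | ⟨x, hx, -⟩
    · cases Set.mem_singleton_iff.1 h4
      exact hc ⟨c, hc1, h1⟩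
    · cases hx
  have h3 := Set.ext_iff.1 (hS.globularity_δ a) (.one u)
  rw [h] at h3
  have h5 : ∃ x : S.F (k + 1), EFace.face x ∈
      ((⋃ z ∈ S.δ a, S.deltaE z) \ (fun x => .face (S.γ x)) '' dDotNL a : Set (EFace S.F (k + 1))) := by
    rcases h3.1 (Or.inl rfl) with h4 | ⟨x, hx, -⟩
    · obtain ⟨h4, -⟩ := h4
      simp only [Set.mem_iUnion] at h4
      obtain ⟨z, hz, h2⟩ := h4
      rw [δ_eq_image_of_nonempty hne] at hz
      obtain ⟨c, hc, rfl⟩ := hz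
      change _ ∈ S.δ c at h2
      rw [δ_eq_image_of_nonempty (key c hc)] at h2
      obtain ⟨w, -, e⟩ := h2
      cases e
    · exact ⟨x, hx⟩
  obtain ⟨x, hx⟩ := h5
  have h6 := hS.mem_dDot_γ_iff.2 hx
  rw [dDot_eq_empty h] at h6
  exact h6

/-- A domain containing a non-loop contains one with codomain `γγ(ξ)`. -/
theorem exists_NL_γ_eq (hS : S.IsOrderedFaceStructure) {ξ : S.F (k + 2)} :
    ∀ {d : S.F (k + 1)}, d ∈ dDotNL ξ →
      ∃ b ∈ dDotNL ξ, S.γ b = S.γ (S.γ ξ) ∧ upLE (S.γ d) (S.γ b) := by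
  intro d hd
  -- `wf'` is the reversed order, so `b` has a <⁺-maximal codomain. If this were not γγ(ξ),
  -- globularity would give a non-loop of the domain starting there and ending strictly higher.
  obtain ⟨b, ⟨hb1, hb2⟩, hb3⟩ := (InvImage.wf S.γ (hS.wf' k)).has_min
    {b | b ∈ dDotNL (S := S.toHypergraph) ξ ∧ upLE (S.γ d) (S.γ b)} ⟨d, hd, upLE.refl _⟩
  refine ⟨b, hb1, ?_, hb2⟩
  by_contra hne
  obtain ⟨c, hc, h⟩ := hS.exists_dDotNL hb1.1 hne
  have h1 := upLT.of_mem hc.2 h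
  exact hb3 c ⟨hc, (hb2.trans_lt h1).le⟩ h1

theorem upLE_γγ_of_mem (hS : S.IsOrderedFaceStructure) {ξ : S.F (k + 2)} {c : S.F (k + 1)}
    (hc : c ∈ dDot ξ) : upLE (S.γ c) (S.γ (S.γ ξ)) := by
  rcases hS.γ_eq_or hc with h | ⟨d, hd, h⟩
  · exact Or.inl h
  · obtain ⟨b, hb, h1, h2⟩ := hS.exists_NL_γ_eq hd
    rw [← h1]
    exact (upLE.of_mem h).trans h2

theorem upLE_γ (hS : S.IsOrderedFaceStructure) {a b : S.F (k + 1)} (h : upLE a b) :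
    upLE (S.γ a) (S.γ b) := by
  rcases h with rfl | h
  · exact upLE.refl _
  induction h with
  | single h =>
    obtain ⟨ξ, -, h1, rfl⟩ := h
    exact hS.upLE_γγ_of_mem h1
  | tail _ h ih =>
    obtain ⟨ξ, -, h1, rfl⟩ := h
    exact ih.trans (hS.upLE_γγ_of_mem h1)

/-- A non-loop in the domain yields one with codomain γγ(ξ). Globularity removes this face from
δγ(ξ), but a loop γ(ξ) has it there. -/
theorem isLoop_of_mem_of_isLoop (hS : S.IsOrderedFaceStructure) {ξ : S.F (k + 2)} {c : S.F (k + 1)}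
    (h : IsLoop (S.γ ξ)) (hc : c ∈ dDot ξ) : IsLoop c := by
  by_contra h1
  obtain ⟨b, hb, h2, -⟩ := hS.exists_NL_γ_eq ⟨hc, h1⟩
  apply hS.γ_ne_of_mem_γ hb
  rw [h2, dDot_eq_of_isLoop h]
  rfl

theorem isLoop_γ (hS : S.IsOrderedFaceStructure) {ξ : S.F (k + 2)} (hne : (dDot ξ).Nonempty)
    (h : ∀ c ∈ dDot ξ, IsLoop (S := S.toHypergraph) c) : IsLoop (S.γ ξ) := by
  obtain ⟨c, hc, e⟩ := hS.exists_γ_eq hne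
  apply hS.isLoop_of_mem
  have h1 := h c hc
  rcases hS.mem_γ_or (y := S.γ c) hc (by rw [dDot_eq_of_isLoop h1]; rfl) with h2 | ⟨d, hd, -⟩
  · rwa [← e]
  · exact absurd (h d hd.1) hd.2

/-- A face below a loop is a loop. -/
theorem isLoop_of_upLE (hS : S.IsOrderedFaceStructure) {a b : S.F (k + 1)} (h : upLE a b)
    (hb : IsLoop b) : IsLoop a := by
  rcases h with rfl | h
  · exact hb
  induction h using Relation.TransGen.head_induction_on with
  | single h =>
    obtain ⟨ξ, -, h1, rfl⟩ := h
    exact hS.isLoop_of_mem_of_isLoop hb h1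
  | head h _ ih =>
    obtain ⟨ξ, -, h1, rfl⟩ := h
    exact hS.isLoop_of_mem_of_isLoop ih h1

/-- Everything below a loop is a loop, so δ̇^{-λ} is empty along the chain and the globularity of γ
leaves a single codomain at each step. -/
theorem γ_eq_of_upLE_isLoop (hS : S.IsOrderedFaceStructure) {a b : S.F (k + 1)} (h : upLE a b)
    (hb : IsLoop b) : S.γ a = S.γ b := by
  rcases h with rfl | h
  · rfl
  obtain ⟨ξ, w, -, h1, h2, rfl⟩ := h.tail
  clear h
  have key : ∀ c ∈ dDot ξ, S.γ c = S.γ (S.γ ξ) := by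
    intro c hc
    rcases hS.γ_eq_or hc with h | ⟨d, hd, -⟩
    · exact h
    · exact absurd (hS.isLoop_of_mem_of_isLoop hb hd.1) hd.2
  have hw := hS.isLoop_of_mem_of_isLoop hb h2
  have hl := hS.isLoop_of_upLE h1 hw
  have := key w h2
  rw [← this]
  rcases h1 with rfl | h1
  · rfl
  clear h2 this key hb
  induction h1 with
  | single h =>
    obtain ⟨η, -, h3, rfl⟩ := h
    rcases hS.γ_eq_or h3 with h | ⟨d, hd, -⟩
    · exact h
    · exact absurd (hS.isLoop_of_mem_of_isLoop hw hd.1) hd.2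
  | tail _ h ih =>
    obtain ⟨η, -, h3, rfl⟩ := h
    rw [ih (hS.isLoop_of_mem_of_isLoop hw h3)]
    rcases hS.γ_eq_or h3 with h | ⟨d, hd, -⟩
    · exact h
    · exact absurd (hS.isLoop_of_mem_of_isLoop hw hd.1) hd.2

/-- If x comes from a loop in the domain, then x is its codomain. It differs from γγ(ξ) because γ(ξ)
is not a loop, so it also starts a non-loop. -/
theorem exists_NL_mem (hS : S.IsOrderedFaceStructure) {ξ : S.F (k + 2)} {x : S.F k}
    (hne : (dDot ξ).Nonempty) (hl : ¬ IsLoop (S.γ ξ)) (hx : x ∈ dDot (S.γ ξ)) :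
    ∃ d ∈ dDotNL ξ, x ∈ dDot d := by
  obtain ⟨c, hc, h⟩ := hS.exists_mem_of_mem_γ hne hx
  by_cases hcl : IsLoop c
  · rw [dDot_eq_of_isLoop hcl] at h
    have e : x = S.γ c := h
    subst e
    refine hS.exists_dDotNL hc fun e => hl (hS.isLoop_of_mem (e ▸ hx))
  · exact ⟨c, ⟨hc, hcl⟩, h⟩

theorem not_isLoop_of_upLE (hS : S.IsOrderedFaceStructure) {a b : S.F (k + 1)} (h : upLE a b)
    (ha : ¬ IsLoop a) : ¬ IsLoop b := fun hb => ha (hS.isLoop_of_upLE h hb)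

theorem upLE_of_lt (hS : S.IsOrderedFaceStructure) {a b : S.F (k + 1)} (h : S.lt a b) :
    ∃ x ∈ dDot b, upLE (S.γ a) x := by
  replace h : Relation.TransGen (fun a b : S.F (k + 1) => S.γ a ∈ dDot b) a b :=
    hS.lowLT_of_lt _ _ h
  induction h with
  | single h => exact ⟨_, h, upLE.refl _⟩
  | tail _ h ih =>
    obtain ⟨x, hx, h1⟩ := ih
    exact ⟨_, h, h1.trans (upLE.of_mem hx)⟩

theorem upLE_γ_of_lt (hS : S.IsOrderedFaceStructure) {a b : S.F (k + 1)} (h : S.lt a b) :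
    upLE (S.γ a) (S.γ b) := by
  obtain ⟨x, hx, h⟩ := hS.upLE_of_lt h
  exact h.trans (upLE.of_mem hx)

theorem upLT_γ_of_lt (hS : S.IsOrderedFaceStructure) {a b : S.F (k + 1)} (h : S.lt a b)
    (hb : ¬ IsLoop b) : upLT (S.γ a) (S.γ b) := by
  obtain ⟨x, hx, h⟩ := hS.upLE_of_lt h
  exact h.trans_lt (upLT.of_mem hb hx)

/-- Faces with a common face in their domains, the first not a loop, are not related by `<^∼`. -/
theorem not_lt_of_common (hS : S.IsOrderedFaceStructure) {a b : S.F (k + 1)} {x : S.F k}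
    (ha : ¬ IsLoop a) (hxa : x ∈ dDot a) (hxb : x ∈ dDot b) : ¬ S.lt a b := by
  intro h
  obtain ⟨w, hw, h⟩ := hS.upLE_of_lt h
  exact hS.local_discreteness b x hxb w hw ((upLT.of_mem ha hxa).trans_le h)

theorem upLT_of_common (hS : S.IsOrderedFaceStructure) {a b : S.F (k + 1)} {x : S.F k}
    (ha : ¬ IsLoop a) (hb : ¬ IsLoop b) (hxa : x ∈ dDot a) (hxb : x ∈ dDot b) (hne : a ≠ b) :
    upLT a b ∨ upLT b a := by
  rcases hS.pencil a b hne ⟨x, Or.inl hxa, Or.inl hxb⟩ with (h | h) | h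
  · exact absurd h (hS.not_lt_of_common ha hxa hxb)
  · exact absurd h (hS.not_lt_of_common hb hxb hxa)
  · exact h

theorem not_lt_of_γ_eq (hS : S.IsOrderedFaceStructure) {a b : S.F (k + 1)}
    (hb : ¬ IsLoop b) (h : S.γ a = S.γ b) : ¬ S.lt a b := by
  intro h1
  have := hS.upLT_γ_of_lt h1 hb
  rw [h] at this
  exact hS.upLT_irrefl _ this

theorem upLT_of_γ_eq (hS : S.IsOrderedFaceStructure) {a b : S.F (k + 1)}
    (ha : ¬ IsLoop a) (hb : ¬ IsLoop b) (h : S.γ a = S.γ b) (hne : a ≠ b) :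
    upLT a b ∨ upLT b a := by
  rcases hS.pencil a b hne ⟨S.γ a, Or.inr rfl, Or.inr (h ▸ rfl)⟩ with (h1 | h1) | h1
  · exact absurd h1 (hS.not_lt_of_γ_eq hb h)
  · exact absurd h1 (hS.not_lt_of_γ_eq ha h.symm)
  · exact h1

/-- The faces above a given face form a chain. -/
theorem upLE_chain (hS : S.IsOrderedFaceStructure) {a b c : S.F k} (h : upLE a b)
    (h' : upLE a c) : upLE b c ∨ upLE c b := by
  induction a using (hS.wf' k).induction with
  | _ a ih =>
  rcases h with rfl | h
  · exact Or.inl h'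
  rcases h' with rfl | h'
  · exact Or.inr h.le
  obtain ⟨α, h1, h2, h3⟩ := h.head
  obtain ⟨β, h4, h5, h6⟩ := h'.head
  -- The first steps of the two chains share `a` in their domains, hence are comparable.
  -- Monotonicity of γ then moves the fork up to the codomain of the smaller one.
  have key : upLE α β ∨ upLE β α := by
    by_cases e : α = β
    · exact Or.inl (Or.inl e)
    · exact (hS.upLT_of_common h1 h4 h2 h5 e).imp Or.inr Or.inr
  rcases key with h7 | h7
  · exact ih _ (upLT.of_mem h1 h2) h3 ((hS.upLE_γ h7).trans h6)
  · exact ih _ (upLT.of_mem h4 h5) ((hS.upLE_γ h7).trans h3) h6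

theorem not_lt_of_upLE_upLE (hS : S.IsOrderedFaceStructure) {a b c : S.F (k + 1)} (h : upLE a b)
    (h' : upLE a c) : ¬ S.lt b c := by
  rcases hS.upLE_chain h h' with h1 | h1
  exacts [hS.not_lt_of_upLE h1, hS.not_lt_of_upLE' h1]

/-- Two faces of a domain that lie above a common face are equal. -/
theorem eq_of_common_below (hS : S.IsOrderedFaceStructure) {ξ : S.F (k + 1)} {a b c : S.F k}
    (hb : b ∈ dDot ξ) (hc : c ∈ dDot ξ) (h : upLE a b) (h' : upLE a c) : b = c := by
  rcases hS.upLE_chain h h' with (h1 | h1) | (h1 | h1)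
  · exact h1
  · exact absurd h1 (hS.local_discreteness ξ _ hb _ hc)
  · exact h1.symm
  · exact absurd h1 (hS.local_discreteness ξ _ hc _ hb)

end OrderedHypergraph.IsOrderedFaceStructure
end FaceStr

namespace FaceStr
open FaceStr.Hypergraph

/-! ### Minimal faces, and recovering <^∼ from the upper order. -/

namespace OrderedHypergraph.IsOrderedFaceStructure

variable {S : OrderedHypergraph.{u}} {k : ℕ}

/-- Along the chain from d to b the codomain must change at some step; there γ(d) is not the final
codomain and so starts a non-loop. -/
theorem exists_NL_of_γ_ne (hS : S.IsOrderedFaceStructure) {d b : S.F (k + 1)} (h : upLT d b)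
    (hne : S.γ d ≠ S.γ b) :
    ∃ c : S.F (k + 1), ¬ IsLoop c ∧ upLT c b ∧ S.γ d ∈ dDot c := by
  induction h with
  | single h =>
    obtain ⟨ξ, h0, h1, rfl⟩ := h
    obtain ⟨c, hc, h2⟩ := hS.exists_dDotNL h1 hne
    exact ⟨c, hc.2, upLT.of_mem h0 hc.1, h2⟩
  | @tail b b' _ h ih =>
    obtain ⟨ξ, h0, h1, rfl⟩ := h
    by_cases e : S.γ d = S.γ b
    · obtain ⟨c, hc, h2⟩ := hS.exists_dDotNL h1 (e ▸ hne)
      exact ⟨c, hc.2, upLT.of_mem h0 hc.1, e ▸ h2⟩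
    · obtain ⟨c, hc, h2, h3⟩ := ih e
      exact ⟨c, hc, h2.trans (upLT.of_mem h0 h1), h3⟩

/-- The codomain of a non-loop strictly below `b` is not in the domain of `b`. -/
theorem γ_notMem_of_upLT (hS : S.IsOrderedFaceStructure) {d b : S.F (k + 1)} (h : upLT d b)
    (hd : ¬ IsLoop d) : S.γ d ∉ dDot b := by
  induction h with
  | single h =>
    obtain ⟨ξ, h0, h1, rfl⟩ := h
    exact hS.γ_ne_of_mem_γ ⟨h1, hd⟩
  | @tail b b' hb h ih =>
    intro hy
    have hb0 : upLT d b := hb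
    obtain ⟨ξ, h0, h1, rfl⟩ := h
    have hbl := hS.not_isLoop_of_upLE hb0.le hd
    have hl := hS.not_isLoop_of_upLE (upLE.of_mem h1) hbl
    obtain ⟨e, he, hye⟩ := hS.exists_NL_mem ⟨_, h1⟩ hl hy
    have hne : S.γ d ≠ S.γ b := fun h => hS.γ_ne_of_mem_γ ⟨h1, hbl⟩ (h ▸ hy)
    obtain ⟨c, hc, h2, h3⟩ := hS.exists_NL_of_γ_ne hb0 hne
    -- Both `c`, which is below `b`, and `e` start at γ(d). If c ≤⁺ e, then `e` and `b` lie above a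
    -- common face and coincide, against the induction hypothesis. If e ≤⁺ c, then e <⁺ b inside one
    -- domain.
    have key : upLE c e ∨ upLE e c := by
      by_cases h : c = e
      · exact Or.inl (Or.inl h)
      · exact (hS.upLT_of_common hc he.2 h3 hye h).imp Or.inr Or.inr
    rcases key with h4 | h4
    · have := hS.eq_of_common_below h1 he.1 h2.le h4
      subst this
      exact ih hye
    · exact hS.local_discreteness ξ _ he.1 _ h1 (h4.trans_lt h2)

/-- A least non-loop with x in its domain is minimal among all faces: were it γ(ξ) for a non-loop ξ
with a proper domain, `exists_NL_mem` would find a smaller one. -/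
theorem exists_min_mem (hS : S.IsOrderedFaceStructure) {a : S.F (k + 1)} {x : S.F k}
    (ha : ¬ IsLoop a) (hx : x ∈ dDot a) :
    ∃ a₀ : S.F (k + 1), IsMin a₀ ∧ ¬ IsLoop a₀ ∧ x ∈ dDot a₀ ∧ upLE a₀ a := by
  obtain ⟨b, ⟨h1, h2, h3⟩, h4⟩ := (hS.wf (k + 1)).has_min
    {b | ¬ IsLoop (S := S.toHypergraph) b ∧ x ∈ dDot b ∧ upLE b a} ⟨a, ha, hx, upLE.refl _⟩
  refine ⟨b, fun x hx => ?_, h1, h2, h3⟩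
  obtain ⟨ξ, w, h5, -, h6, rfl⟩ := hx.tail
  obtain ⟨c, hc, h7⟩ := hS.exists_NL_mem ⟨w, h6⟩ h1 h2
  have h8 := upLT.of_mem h5 hc.1
  exact h4 c ⟨hc.2, h7, (h8.trans_le h3).le⟩ h8

/-- A step of the upper order through a minimal face. -/
def minStep (x y : S.F k) : Prop :=
  ∃ a : S.F (k + 1), IsMin a ∧ ¬ IsLoop a ∧ x ∈ dDot a ∧ S.γ a = y

/-- A minimal face below the first step may end earlier than that step, so the path is rebuilt from
its codomain, by induction from the top. -/
theorem transGen_minStep (hS : S.IsOrderedFaceStructure) {x z : S.F k} (h : upLT x z) :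
    Relation.TransGen (minStep (S := S)) x z := by
  induction x using (hS.wf' k).induction with
  | _ x ih =>
  obtain ⟨a, h1, h2, h3⟩ := h.head
  obtain ⟨d, hd1, hd2, hd3, hd4⟩ := hS.exists_min_mem h1 h2
  rcases (hS.upLE_γ hd4).trans h3 with h5 | h5
  · exact .single ⟨d, hd1, hd2, hd3, h5⟩
  · exact .head ⟨d, hd1, hd2, hd3, rfl⟩ (ih _ (upLT.of_mem hd2 hd3) h5)

theorem lt_of_γ_mem_min (hS : S.IsOrderedFaceStructure) {a d : S.F (k + 1)} (hd : IsMin d)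
    (hd' : ¬ IsLoop d) (h : S.γ a ∈ dDot d) : S.lt a d := by
  have h0 := upLT.of_mem hd' h
  have hne : a ≠ d := by
    rintro rfl
    exact hd' (hS.isLoop_of_mem h)
  rcases hS.pencil a d hne ⟨S.γ a, Or.inr rfl, Or.inl h⟩ with (h1 | h1) | (h1 | h1)
  · exact h1
  · exact (hS.not_lt_le h0 (hS.upLE_γ_of_lt h1)).elim
  · exact absurd h1 (hd _)
  · exact (hS.not_lt_le h0 (hS.upLE_γ h1.le)).elim

theorem lt_of_NL_γ_mem (hS : S.IsOrderedFaceStructure) {d b : S.F (k + 1)} (hd : ¬ IsLoop d)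
    (h : S.γ d ∈ dDot b) (hbd : ¬ upLT b d) : S.lt d b := by
  have hne : d ≠ b := by
    rintro rfl
    exact hd (hS.isLoop_of_mem h)
  rcases hS.pencil d b hne ⟨S.γ d, Or.inr rfl, Or.inl h⟩ with (h1 | h1) | (h1 | h1)
  · exact h1
  · exact (hS.not_lt_le (hS.upLT_γ_of_lt h1 hd) (upLE.of_mem h)).elim
  · exact absurd h (hS.γ_notMem_of_upLT h1 hd)
  · exact absurd h1 hbd

theorem lt_of_γ_mem (hS : S.IsOrderedFaceStructure) {d b : S.F (k + 1)} (hd : ¬ IsLoop d)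
    (hb : ¬ IsLoop b) (h : S.γ d ∈ dDot b) : S.lt d b := by
  refine hS.lt_of_NL_γ_mem hd h fun h1 => ?_
  exact hS.not_lt_le (upLT.of_mem hb h) (hS.upLE_γ h1.le)

/-- A strict path refines to minimal non-loops, and consecutive ones are <^∼-related. Hence a and b
may be loops here, and θ(a) may meet θ(b). -/
theorem lt_of_upLT_mem (hS : S.IsOrderedFaceStructure) {a b : S.F (k + 1)} {x : S.F k}
    (h : upLT (S.γ a) x) (hx : x ∈ dDot b) : S.lt a b := by
  replace h := hS.transGen_minStep h
  generalize e : S.γ a = w at h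
  induction h using Relation.TransGen.head_induction_on generalizing a with
  | single h =>
    obtain ⟨d, h1, h2, h3, rfl⟩ := h
    subst e
    exact hS.lt_trans _ _ _ (hS.lt_of_γ_mem_min h1 h2 h3) (hS.lt_of_NL_γ_mem h2 hx (h1 _))
  | head h _ ih =>
    obtain ⟨d, h1, h2, h3, rfl⟩ := h
    subst e
    exact hS.lt_trans _ _ _ (hS.lt_of_γ_mem_min h1 h2 h3) (ih rfl)

theorem lt_of_upLE_mem (hS : S.IsOrderedFaceStructure) {a b : S.F (k + 1)} {x : S.F k}
    (ha : ¬ IsLoop a) (hb : ¬ IsLoop b) (h : upLE (S.γ a) x) (hx : x ∈ dDot b) : S.lt a b := by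
  rcases h with rfl | h
  exacts [hS.lt_of_γ_mem ha hb hx, hS.lt_of_upLT_mem h hx]

theorem mem_iota {ξ : S.F (k + 2)} {x : S.F k} {c d : S.F (k + 1)} (hd : d ∈ dDotNL ξ)
    (hc : c ∈ dDotNL ξ) (h : S.γ d = x) (h' : x ∈ dDot c) : x ∈ iota ξ :=
  ⟨d, hd, c, hc, h, h'⟩

/-- A face in the domain of a non-loop `e ≤⁺ a` is in the domain of `a`, or is internal to a
face inside `a`. -/
theorem mem_or_iota_of_upLE (hS : S.IsOrderedFaceStructure) {e a : S.F (k + 1)} {w : S.F k}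
    (h : upLE e a) (he : ¬ IsLoop e) (hw : w ∈ dDot e) :
    w ∈ dDot a ∨ ∃ ξ : S.F (k + 2), ¬ IsLoop ξ ∧ upLE (S.γ ξ) a ∧ w ∈ iota ξ := by
  rcases h with rfl | h
  · exact Or.inl hw
  have step : ∀ {b : S.F (k + 1)} (ξ : S.F (k + 2)), ¬ IsLoop ξ → b ∈ dDot ξ → ¬ IsLoop b →
      w ∈ dDot b → w ∈ dDot (S.γ ξ) ∨
        ∃ ξ' : S.F (k + 2), ¬ IsLoop ξ' ∧ upLE (S.γ ξ') (S.γ ξ) ∧ w ∈ iota ξ' := by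
    intro b ξ h0 h1 h2 h3
    rcases hS.mem_γ_or h1 h3 with h | ⟨d, hd, h⟩
    · exact Or.inl h
    · exact Or.inr ⟨ξ, h0, upLE.refl _, mem_iota hd ⟨h1, h2⟩ h h3⟩
  induction h with
  | single h =>
    obtain ⟨ξ, h0, h1, rfl⟩ := h
    exact step ξ h0 h1 he hw
  | @tail b b' hb h ih =>
    have hb0 : upLT e b := hb
    obtain ⟨ξ, h0, h1, rfl⟩ := h
    rcases ih with h | ⟨ξ', h2, h3, h4⟩
    · exact step ξ h0 h1 (hS.not_isLoop_of_upLE hb0.le he) h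
    · exact Or.inr ⟨ξ', h2, h3.trans (upLE.of_mem h1), h4⟩

/-- At a step ξ where w leaves θ̇, globularity makes w both the codomain of one non-loop in the
domain of ξ and a source of another. -/
theorem iota_of_notMem_thetaDot (hS : S.IsOrderedFaceStructure) {e a : S.F (k + 1)} {w : S.F k}
    (h : upLE e a) (hw : w ∈ thetaDot e) (hwa : w ∉ thetaDot a) :
    ∃ ξ : S.F (k + 2), ¬ IsLoop ξ ∧ upLE (S.γ ξ) a ∧ w ∈ iota ξ := by
  rcases h with rfl | h
  · exact absurd hw hwa
  have step : ∀ {b : S.F (k + 1)} (ξ : S.F (k + 2)), b ∈ dDot ξ →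
      w ∈ thetaDot b → w ∉ thetaDot (S.γ ξ) → w ∈ iota ξ := by
    intro b ξ h1 h2 h3
    rw [mem_thetaDot, not_or] at h3
    rcases mem_thetaDot.1 h2 with h4 | h4
    · rcases hS.mem_γ_or h1 h4 with h | ⟨d, hd, h⟩
      · exact absurd h h3.1
      · obtain ⟨c, hc, h5⟩ := hS.exists_dDotNL hd.1 (h ▸ h3.2)
        exact mem_iota hd hc h (h ▸ h5)
    · obtain ⟨c, hc, h5⟩ := hS.exists_dDotNL h1 (h4 ▸ h3.2)
      rw [← h4] at h5
      rcases hS.mem_γ_or hc.1 h5 with h | ⟨d, hd, h⟩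
      · exact absurd h h3.1
      · exact mem_iota hd hc h h5
  induction h with
  | single h =>
    obtain ⟨ξ, h0, h1, rfl⟩ := h
    exact ⟨ξ, h0, upLE.refl _, step ξ h1 hw hwa⟩
  | @tail b b' hb h ih =>
    obtain ⟨ξ, h0, h1, rfl⟩ := h
    by_cases hwb : w ∈ thetaDot b
    · exact ⟨ξ, h0, upLE.refl _, step ξ h1 hwb hwa⟩
    · obtain ⟨ξ', h2, h3, h4⟩ := ih hwb
      exact ⟨ξ', h2, h3.trans (upLE.of_mem h1), h4⟩

theorem upLE_of_min_γ_eq (hS : S.IsOrderedFaceStructure) {d a : S.F (k + 1)} (hd : IsMin d)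
    (hd' : ¬ IsLoop d) (ha : ¬ IsLoop a) (h : S.γ d = S.γ a) : upLE d a := by
  by_cases e : d = a
  · exact Or.inl e
  · rcases hS.upLT_of_γ_eq hd' ha h e with h1 | h1
    exacts [h1.le, absurd h1 (hd _)]

theorem upLE_or_of_γ_mem (hS : S.IsOrderedFaceStructure) {d e a : S.F (k + 1)} (hd : IsMin d)
    (hd' : ¬ IsLoop d) (he : ¬ IsLoop e) (h : S.γ d ∈ dDot e) (hea : upLE e a) :
    upLE d a ∨ ∃ x ∈ dDot a, upLE (S.γ d) x := by
  rcases hS.mem_or_iota_of_upLE hea he h with h1 | ⟨ξ, h0, h1, f, hf, -, -, h2, -⟩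
  · exact Or.inr ⟨_, h1, upLE.refl _⟩
  · exact Or.inl ((hS.upLE_of_min_γ_eq hd hd' hf.2 h2.symm).trans ((upLE.of_mem hf.1).trans h1))

/-- A minimal face whose codomain is below `γ(a)` is inside `a` or ends below the domain of `a`. -/
theorem upLE_or_of_min (hS : S.IsOrderedFaceStructure) {d a : S.F (k + 1)} (hd : IsMin d)
    (hd' : ¬ IsLoop d) (ha : ¬ IsLoop a) (h : upLE (S.γ d) (S.γ a)) :
    upLE d a ∨ ∃ x ∈ dDot a, upLE (S.γ d) x := by
  rcases h with h | h
  · exact Or.inl (hS.upLE_of_min_γ_eq hd hd' ha h)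
  -- The last minimal face of the path ends at γ(a), hence is inside `a`. The alternative then
  -- passes back from each minimal face to its predecessor.
  replace h := hS.transGen_minStep h
  generalize e : S.γ d = w at h
  induction h using Relation.TransGen.head_induction_on generalizing d with
  | single h =>
    obtain ⟨f, h1, h2, h3, h4⟩ := h
    subst e
    exact hS.upLE_or_of_γ_mem hd hd' h2 h3 (hS.upLE_of_min_γ_eq h1 h2 ha h4)
  | head h _ ih =>
    obtain ⟨f, h1, h2, h3, rfl⟩ := h
    subst e
    rcases ih h1 h2 rfl with h5 | ⟨x, hx, h5⟩
    · exact hS.upLE_or_of_γ_mem hd hd' h2 h3 h5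
    · exact Or.inr ⟨x, hx, ((upLT.of_mem h2 h3).trans_le h5).le⟩

theorem isLoop_γ_of_isMin (hS : S.IsOrderedFaceStructure) {f : S.F (k + 2)} (hf : ¬ IsLoop f)
    (h : IsMin (S.γ f)) : IsLoop (S.γ f) := by
  rcases dDot_nonempty_or f with ⟨x, hx⟩ | ⟨u, hu⟩
  · exact absurd (upLT.of_mem hf hx) (h x)
  · exact hS.isLoop_γ_of_one hu

/-- A minimal non-loop strictly below `γ(a)` is below the domain of `a`. -/
theorem upLE_mem_of_min (hS : S.IsOrderedFaceStructure) {β : S.F (k + 1)} {a : S.F (k + 2)}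
    (hβ : IsMin β) (hβ' : ¬ IsLoop β) (ha : ¬ IsLoop a) (h : upLT β (S.γ a)) :
    ∃ x ∈ dDot a, upLE β x := by
  -- A minimal first step out of β is either inside `a` or ends below the domain of `a`. Inside `a`,
  -- β cannot become internal: it would be the codomain of a non-loop, and a minimal codomain of a
  -- non-loop is a loop.
  obtain ⟨d, h1, h2, h3, h4⟩ : ∃ d : S.F (k + 2), IsMin d ∧ ¬ IsLoop d ∧ β ∈ dDot d ∧
      upLE (S.γ d) (S.γ a) := by
    obtain ⟨b, h1, h2, h3⟩ := h.head
    obtain ⟨d, hd1, hd2, hd3, hd4⟩ := hS.exists_min_mem h1 h2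
    exact ⟨d, hd1, hd2, hd3, (hS.upLE_γ hd4).trans h3⟩
  rcases hS.upLE_or_of_min h1 h2 ha h4 with h5 | ⟨x, hx, h5⟩
  · rcases hS.mem_or_iota_of_upLE h5 h2 h3 with h6 | ⟨ξ, -, -, f, hf, -, -, rfl, -⟩
    · exact ⟨β, h6, upLE.refl _⟩
    · exact absurd (hS.isLoop_γ_of_isMin hf.2 hβ) hβ'
  · exact ⟨x, hx, ((upLT.of_mem h2 h3).trans_le h5).le⟩

/-- If `α` is an initial face inside `a` with `γγ(α) ≠ γγ(a)`, then `γγ(α)` is in the domain of a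
non-loop in the domain of `a`. -/
theorem exists_NL_of_initial (hS : S.IsOrderedFaceStructure) {α a : S.F (k + 2)}
    (hα : IsInitial α) (h : upLE α a) (hne : S.γ (S.γ α) ≠ S.γ (S.γ a)) :
    ∃ c ∈ dDotNL a, S.γ (S.γ α) ∈ dDot c := by
  have ha := hS.not_isLoop_of_upLE h hα.not_isLoop
  have h1 : upLT (S.γ α) (S.γ a) := (hS.upLE_γ h).resolve_left fun e => hne (by rw [e])
  obtain ⟨c, hc, h2, h3⟩ := hS.exists_NL_of_γ_ne h1 hne
  obtain ⟨d, hd1, hd2, hd3, hd4⟩ := hS.exists_min_mem hc h3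
  obtain ⟨x, hx, h4⟩ := hS.upLE_mem_of_min hd1 hd2 ha (hd4.trans_lt h2)
  rcases hS.mem_or_iota_of_upLE h4 hd2 hd3 with h5 | ⟨ξ, hξ, h5, h6⟩
  · exact ⟨x, ⟨hx, hS.not_isLoop_of_upLE h4 hd2⟩, h5⟩
  -- What remains is γγ(α) internal to some ξ with γ(ξ) ≤⁺ x ∈ δ(a), so that ξ <^∼ a. The axiom on
  -- empty domains puts α before or inside ξ, and both contradict α ≤⁺ a.
  exfalso
  have h7 : S.lt ξ a := hS.lt_of_upLE_mem hξ ha h5 hx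
  rcases hS.pencil_empty α ξ hα.1 h6 with h8 | h8
  · obtain ⟨w, hw, h9⟩ := hS.upLE_of_lt h8
    exact hS.not_lt_of_upLE h
      (hS.lt_of_upLT_mem ((h9.trans_lt (upLT.of_mem hξ hw)).trans_le h5) hx)
  · exact hS.not_lt_of_upLE_upLE h8.le h h7

/-! ### Refined domains. -/

/-- The set `{γ(α) : α ∈ 𝓘, α ≤⁺ a} ∪ δ̇(a)`. -/
def refinedDom (a : S.F (k + 2)) : Set (S.F (k + 1)) :=
  {x | x ∈ dDot a ∨ ∃ α, IsInitial α ∧ upLE α a ∧ S.γ α = x}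

theorem upLE_of_mem_refinedDom (hS : S.IsOrderedFaceStructure) {a : S.F (k + 2)} {x : S.F (k + 1)}
    (hx : x ∈ refinedDom a) : upLE x (S.γ a) := by
  rcases hx with hx | ⟨α, -, h, rfl⟩
  exacts [upLE.of_mem hx, hS.upLE_γ h]

theorem _root_.FaceStr.Hypergraph.IsInitial.mem_initialAt (hS : S.IsOrderedFaceStructure)
    {α : S.F (k + 2)} (h : IsInitial α) : α ∈ S.initialAt (S.γ (S.γ α)) := by
  obtain ⟨u, hu⟩ := h.exists_one
  exact ⟨h, by rw [hu, hS.γγ_eq hu]⟩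

theorem isMin_γ (hS : S.IsOrderedFaceStructure) {α : S.F (k + 2)} (h : IsInitial α) :
    IsMin (S.γ α) := fun y => hS.not_upLT_γ_initial (h.mem_initialAt hS) y

theorem isLoop_γ_initial (hS : S.IsOrderedFaceStructure) {α : S.F (k + 2)} (h : IsInitial α) :
    IsLoop (S.γ α) := by
  obtain ⟨u, hu⟩ := h.exists_one
  exact hS.isLoop_γ_of_one hu

/-- Nothing lies below an inserted loop γ(α'). An inserted γ(α) strictly below a face of δ(a) would
give α <^∼ a, against α ≤⁺ a. -/
theorem not_upLT_refinedDom (hS : S.IsOrderedFaceStructure) {a : S.F (k + 2)} {x x' : S.F (k + 1)}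
    (hx : x ∈ refinedDom a) (hx' : x' ∈ refinedDom a) : ¬ upLT x x' := by
  intro h
  rcases hx' with hx' | ⟨α', h1, -, rfl⟩
  · rcases hx with hx | ⟨α, -, h1, rfl⟩
    · exact hS.local_discreteness a _ hx _ hx' h
    · exact hS.not_lt_of_upLE h1 (hS.lt_of_upLT_mem h hx')
  · exact hS.isMin_γ h1 _ h

theorem lt_or_of_refinedDom (hS : S.IsOrderedFaceStructure) {a : S.F (k + 2)} {x x' : S.F (k + 1)}
    {y : S.F k} (hx : x ∈ refinedDom a) (hx' : x' ∈ refinedDom a) (hy : y ∈ thetaDot x)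
    (hy' : y ∈ thetaDot x') (hne : x ≠ x') : S.lt x x' ∨ S.lt x' x := by
  rcases hS.pencil x x' hne ⟨y, hy, hy'⟩ with h | (h | h)
  · exact h
  · exact absurd h (hS.not_upLT_refinedDom hx hx')
  · exact absurd h (hS.not_upLT_refinedDom hx' hx)

/-! ### Comparison of cuts -/

theorem γγ_eq_of_mem (hS : S.IsOrderedFaceStructure) {y : S.F k} {β : S.F (k + 2)}
    (hβ : β ∈ S.initialAt y) : S.γ (S.γ β) = y := hS.γγ_eq hβ.2

theorem mem_thetaDot_initialAt (hS : S.IsOrderedFaceStructure) {y : S.F k} {β : S.F (k + 2)}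
    (hβ : β ∈ S.initialAt y) : y ∈ thetaDot (S.γ β) :=
  mem_thetaDot.2 (Or.inr (hS.γγ_eq_of_mem hβ).symm)

theorem mem_dDot_initialAt (hS : S.IsOrderedFaceStructure) {y : S.F k} {β : S.F (k + 2)}
    (hβ : β ∈ S.initialAt y) : y ∈ dDot (S.γ β) := by
  rw [dDot_eq_of_isLoop (hS.isLoop_γ_initial hβ.1), hS.γγ_eq_of_mem hβ]
  rfl

/-- The pencil axiom at y, where the alternative x <⁺ γ(β) drops out because γ(β) is minimal. -/
theorem initialAt_cases (hS : S.IsOrderedFaceStructure) {y : S.F k} {β : S.F (k + 2)}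
    {x : S.F (k + 1)} (hβ : β ∈ S.initialAt y) (hx : y ∈ thetaDot x) :
    S.lt x (S.γ β) ∨ S.lt (S.γ β) x ∨ upLE (S.γ β) x := by
  by_cases e : S.γ β = x
  · exact Or.inr (Or.inr (Or.inl e))
  rcases hS.pencil _ _ e ⟨y, hS.mem_thetaDot_initialAt hβ, hx⟩ with (h | h) | (h | h)
  · exact Or.inr (Or.inl h)
  · exact Or.inl h
  · exact Or.inr (Or.inr h.le)
  · exact absurd h (hS.isMin_γ hβ.1 _)

/-- A least face below a with the same empty domain is initial: if it were a codomain of a non-loop,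
that non-loop would have in its domain a smaller face of this kind. -/
theorem exists_initial_le (hS : S.IsOrderedFaceStructure) {a : S.F (k + 2)} {u : S.F k}
    (h : S.δ a = {.one u}) : ∃ α ∈ S.initialAt u, upLE α a := by
  obtain ⟨b, ⟨h1, h2⟩, h3⟩ := (hS.wf (k + 2)).has_min
    {b | S.δ b = {.one u} ∧ upLE b a} ⟨a, h, upLE.refl _⟩
  refine ⟨b, ⟨⟨⟨_, h1, trivial⟩, ?_⟩, h1⟩, h2⟩
  rintro ⟨ξ, h4, rfl⟩
  obtain ⟨c, hc, h5⟩ := hS.exists_one_of_γ_one h1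
  have h6 := upLT.of_mem h4 hc
  exact h3 c ⟨h5, (h6.trans_le h2).le⟩ h6

/-- This makes loops visible to cuts. A least loop below b has a filler by the last axiom, and
leastness forces the filler to have an empty domain. -/
theorem exists_initial_of_isLoop (hS : S.IsOrderedFaceStructure) {b : S.F (k + 1)}
    (hb : IsLoop b) : ∃ β ∈ S.initialAt (S.γ b), upLE (S.γ β) b := by
  obtain ⟨c, ⟨h1, h2⟩, h3⟩ := (hS.wf (k + 1)).has_min {c | upLE c b ∧ IsLoop (S := S.toHypergraph) c}
    ⟨b, upLE.refl _, hb⟩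
  obtain ⟨ξ, h4, rfl⟩ := hS.loop_filling c h2
  rcases dDot_nonempty_or ξ with ⟨d, hd⟩ | ⟨u, hu⟩
  · have h5 := upLT.of_mem h4 hd
    exact absurd h5 (h3 d ⟨(h5.trans_le h1).le, hS.isLoop_of_mem_of_isLoop h2 hd⟩)
  · obtain ⟨α, hα, h5⟩ := hS.exists_initial_le hu
    rw [← hS.γ_eq_of_upLE_isLoop h1 hb, hS.γγ_eq hu]
    exact ⟨α, hα, (hS.upLE_γ h5).trans h1⟩

theorem Cut.ext_L {c d : S.Cut k} (hS : S.IsOrderedFaceStructure) (h : c.base = d.base)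
    (hL : c.L = d.L) : c = d := by
  have key : ∀ c : S.Cut k, c.U = S.initialAt c.base \ c.L := by
    intro c
    rw [← c.union_eq]
    ext β
    simp only [Set.mem_sdiff, Set.mem_union]
    exact ⟨fun hβ => ⟨Or.inr hβ, fun h => hS.lt_irrefl _ (c.lt β h β hβ)⟩,
      fun hβ => hβ.1.resolve_left hβ.2⟩
  refine Cut.ext h hL ?_
  rw [key c, key d, h, hL]

theorem upCut_eq_upCut_iff (hS : S.IsOrderedFaceStructure) {a b : S.F (k + 1)}
    (h : S.γ a = S.γ b) : hS.upCut a = hS.upCut b ↔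
      ∀ β ∈ S.initialAt (S.γ b), S.lt a (S.γ β) ↔ S.lt b (S.γ β) := by
  constructor
  · intro e β hβ
    have h1 := Set.ext_iff.1 (congrArg Cut.U e) β
    simp only [upCut, Set.mem_ofPred_eq, h, hβ, true_and] at h1
    exact h1
  · intro h1
    refine Cut.ext_L hS h ?_
    ext β
    simp only [upCut, Set.mem_sdiff, Set.mem_ofPred_eq, h]
    exact and_congr_right fun hβ => not_congr (h1 β hβ)

theorem downCut_eq_downCut_iff (hS : S.IsOrderedFaceStructure) {a b : S.F (k + 1)} {y : S.F k} :
    hS.downCut y a = hS.downCut y b ↔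
      ∀ β ∈ S.initialAt y, S.lt (S.γ β) a ↔ S.lt (S.γ β) b := by
  constructor
  · intro e β hβ
    have h1 := Set.ext_iff.1 (congrArg Cut.L e) β
    simp only [downCut, Set.mem_ofPred_eq, hβ, true_and] at h1
    exact h1
  · intro h1
    refine Cut.ext_L hS rfl ?_
    ext β
    simp only [downCut, Set.mem_ofPred_eq]
    exact and_congr_right fun hβ => h1 β hβ

theorem upCut_eq_downCut_iff (hS : S.IsOrderedFaceStructure) {a b : S.F (k + 1)} :
    hS.upCut a = hS.downCut (S.γ a) b ↔
      ∀ β ∈ S.initialAt (S.γ a), ¬ S.lt a (S.γ β) ↔ S.lt (S.γ β) b := by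
  constructor
  · intro e β hβ
    have h1 := Set.ext_iff.1 (congrArg Cut.L e) β
    simp only [upCut, downCut, Set.mem_sdiff, Set.mem_ofPred_eq, hβ, true_and] at h1
    exact h1
  · intro h1
    refine Cut.ext_L hS rfl ?_
    ext β
    simp only [upCut, downCut, Set.mem_sdiff, Set.mem_ofPred_eq]
    exact and_congr_right fun hβ => h1 β hβ

/-- Equality of the cuts forbids a loop γ(β) inside both a and b: it would count as not after a,
hence as before b. In each alternative of the pencil axiom other than a <^∼ b, either a or b is a
loop and provides such a β or a contradictory position of it, or the positions of the codomains are
impossible. -/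
theorem lt_of_upCut_eq_downCut (hS : S.IsOrderedFaceStructure) {a b : S.F (k + 1)} {y : S.F k}
    (hy : y ∈ dDot b) (e : hS.upCut a = hS.downCut y b) : S.lt a b := by
  have hya : S.γ a = y := congrArg Cut.base e
  subst hya
  rw [hS.upCut_eq_downCut_iff] at e
  have below : ∀ β ∈ S.initialAt (S.γ a), upLE (S.γ β) a → upLE (S.γ β) b → False :=
    fun β hβ h1 h2 => hS.not_lt_of_upLE h2 ((e β hβ).1 (hS.not_lt_of_upLE' h1))
  have loops : IsLoop a → upLE a b → False := by
    intro ha hab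
    obtain ⟨β, hβ, h1⟩ := hS.exists_initial_of_isLoop ha
    exact below β hβ h1 (h1.trans hab)
  have loops' : IsLoop b → upLE b a → False := by
    intro hb hba
    have h2 : S.γ a = S.γ b := by
      rw [dDot_eq_of_isLoop hb] at hy
      exact hy
    obtain ⟨β, hβ, h1⟩ := hS.exists_initial_of_isLoop hb
    exact below β (h2 ▸ hβ) (h1.trans hba) h1
  by_cases hab : a = b
  · subst hab
    exact (loops (hS.isLoop_of_mem hy) (upLE.refl _)).elim
  rcases hS.pencil a b hab ⟨_, Or.inr rfl, Or.inl hy⟩ with (h | h) | (h | h)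
  · exact h
  · by_cases hb : IsLoop b
    · have h2 : S.γ a = S.γ b := by
        rw [dDot_eq_of_isLoop hb] at hy
        exact hy
      obtain ⟨β, hβ, h1⟩ := hS.exists_initial_of_isLoop hb
      refine absurd ((e β (h2 ▸ hβ)).1 fun h3 => ?_) (hS.not_lt_of_upLE h1)
      exact hS.not_lt_of_upLE' h1 (hS.lt_trans _ _ _ h h3)
    · exact (hS.not_lt_le (upLT.of_mem hb hy) (hS.upLE_γ_of_lt h)).elim
  · by_cases ha : IsLoop a
    · exact (loops ha h.le).elim
    · exact absurd hy (hS.γ_notMem_of_upLT h ha)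
  · by_cases hb : IsLoop b
    · exact (loops' hb h.le).elim
    · exact (hS.not_lt_le (upLT.of_mem hb hy) (hS.upLE_γ h.le)).elim

/-- If a <^∼ b, no γ(β) is inside both, since faces above a common face are not <^∼-related. Thus
the lower part of `upCut a` is contained in that of `downCut (γ a) b`, and the cuts can differ only
by initial faces strictly between a and b. -/
theorem not_lt_or_lt_of_lt (hS : S.IsOrderedFaceStructure) {a b : S.F (k + 1)}
    (h : S.lt a b) (hy : S.γ a ∈ dDot b) {β : S.F (k + 2)} (hβ : β ∈ S.initialAt (S.γ a))
    (h1 : ¬ S.lt a (S.γ β)) : S.lt (S.γ β) b := by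
  rcases hS.initialAt_cases hβ (x := a) (Or.inr rfl) with h2 | h2 | h2
  · exact absurd h2 h1
  · exact hS.lt_trans _ _ _ h2 h
  · rcases hS.initialAt_cases hβ (x := b) (Or.inl hy) with h3 | h3 | h3
    · exact absurd (hS.lt_trans _ _ _ h h3) h1
    · exact h3
    · exact absurd h (hS.not_lt_of_upLE_upLE h2 h3)

/-- Only a <^∼ b must be excluded, by symmetry. Equal codomains exclude it when b is not a loop.
When b is a loop, it contains some γ(β), which is not after b, hence not after a, hence before b: a
contradiction. -/
theorem upLT_of_upCut_eq (hS : S.IsOrderedFaceStructure) {a b : S.F (k + 1)}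
    (e : hS.upCut a = hS.upCut b) (hne : a ≠ b) : upLT a b ∨ upLT b a := by
  have key : ∀ {a b : S.F (k + 1)}, hS.upCut a = hS.upCut b → ¬ S.lt a b := by
    intro a b e h
    have hγ : S.γ a = S.γ b := congrArg Cut.base e
    rw [hS.upCut_eq_upCut_iff hγ] at e
    by_cases hb : IsLoop b
    · obtain ⟨β, hβ, h1⟩ := hS.exists_initial_of_isLoop hb
      have h2 : ¬ S.lt a (S.γ β) := fun h2 => hS.not_lt_of_upLE' h1 ((e β hβ).1 h2)
      have h3 := hS.not_lt_or_lt_of_lt h (by rw [dDot_eq_of_isLoop hb, hγ]; rfl)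
        (hγ.symm ▸ hβ) h2
      exact hS.not_lt_of_upLE h1 h3
    · exact hS.not_lt_of_γ_eq hb hγ h
  rcases hS.pencil a b hne ⟨_, Or.inr rfl, Or.inr (congrArg EFace.face (congrArg Cut.base e))⟩
    with (h | h) | h
  · exact absurd h (key e)
  · exact absurd h (key e.symm)
  · exact h

theorem upLT_of_downCut_eq (hS : S.IsOrderedFaceStructure) {a b : S.F (k + 1)} {y : S.F k}
    (ha : y ∈ dDot a) (hb : y ∈ dDot b)
    (e : hS.downCut y a = hS.downCut y b) (hne : a ≠ b) : upLT a b ∨ upLT b a := by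
  have key : ∀ {a b : S.F (k + 1)}, y ∈ dDot a → y ∈ dDot b →
      hS.downCut y a = hS.downCut y b → ¬ S.lt a b := by
    intro a b ha hb e h
    rw [hS.downCut_eq_downCut_iff] at e
    by_cases hl : IsLoop a
    · have hγ : S.γ a = y := by
        rw [dDot_eq_of_isLoop hl] at ha
        exact ha.symm
      subst hγ
      obtain ⟨β, hβ, h1⟩ := hS.exists_initial_of_isLoop hl
      exact hS.not_lt_of_upLE h1 ((e β hβ).2
        (hS.not_lt_or_lt_of_lt h hb hβ (hS.not_lt_of_upLE' h1)))
    · exact hS.not_lt_of_common hl ha hb h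
  rcases hS.pencil a b hne ⟨_, Or.inl ha, Or.inl hb⟩ with (h | h) | h
  · exact absurd h (key ha hb e)
  · exact absurd h (key hb ha e.symm)
  · exact h

end OrderedHypergraph.IsOrderedFaceStructure
end FaceStr

namespace FaceStr
open FaceStr.Hypergraph

/-! ### Matching output cuts with input cuts along a refined domain. -/

namespace OrderedHypergraph.IsOrderedFaceStructure

variable {S : OrderedHypergraph.{u}} {k : ℕ}

theorem wf_lt (hS : S.IsOrderedFaceStructure) : WellFounded (S.lt (k := k)) := by
  have := S.finite k
  have : IsTrans (S.F k) S.lt := ⟨hS.lt_trans⟩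
  have : Std.Irrefl (S.lt (k := k)) := ⟨hS.lt_irrefl⟩
  exact Finite.wellFounded_of_trans_of_irrefl _

theorem wf_gt (hS : S.IsOrderedFaceStructure) : WellFounded (fun x y : S.F k => S.lt y x) := by
  have := S.finite k
  have : IsTrans (S.F k) (fun x y : S.F k => S.lt y x) :=
    ⟨fun _ _ _ h1 h2 => hS.lt_trans _ _ _ h2 h1⟩
  have : Std.Irrefl (fun x y : S.F k => S.lt y x) := ⟨hS.lt_irrefl⟩
  exact Finite.wellFounded_of_trans_of_irrefl _

theorem exists_first (hS : S.IsOrderedFaceStructure) {y : S.F k} {p : S.F (k + 2) → Prop}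
    (h : ∃ β ∈ S.initialAt y, p β) :
    ∃ β₀ ∈ S.initialAt y, p β₀ ∧
      ∀ β ∈ S.initialAt y, p β → β = β₀ ∨ S.lt (S.γ β₀) (S.γ β) := by
  obtain ⟨β, hβ, hp⟩ := h
  obtain ⟨β₀, ⟨h1, h2⟩, h3⟩ := (InvImage.wf S.γ hS.wf_lt).has_min
    {β | β ∈ S.initialAt y ∧ p β} ⟨β, hβ, hp⟩
  refine ⟨β₀, h1, h2, fun β hβ hp => ?_⟩
  by_cases e : β = β₀
  · exact Or.inl e
  · exact Or.inr ((hS.initialAt_linear hβ h1 e).resolve_left (h3 β ⟨hβ, hp⟩))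

theorem exists_last (hS : S.IsOrderedFaceStructure) {y : S.F k} {p : S.F (k + 2) → Prop}
    (h : ∃ β ∈ S.initialAt y, p β) :
    ∃ β₀ ∈ S.initialAt y, p β₀ ∧
      ∀ β ∈ S.initialAt y, p β → β = β₀ ∨ S.lt (S.γ β) (S.γ β₀) := by
  obtain ⟨β, hβ, hp⟩ := h
  obtain ⟨β₀, ⟨h1, h2⟩, h3⟩ := (InvImage.wf S.γ hS.wf_gt).has_min
    {β | β ∈ S.initialAt y ∧ p β} ⟨β, hβ, hp⟩
  refine ⟨β₀, h1, h2, fun β hβ hp => ?_⟩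
  by_cases e : β = β₀
  · exact Or.inl e
  · exact Or.inr ((hS.initialAt_linear hβ h1 e).resolve_right (h3 β ⟨hβ, hp⟩))

/-- No initial face fits strictly between x and x' when x' contains the first one after x. -/
theorem upCut_eq_downCut_of_first (hS : S.IsOrderedFaceStructure) {x x' : S.F (k + 1)}
    {β₀ : S.F (k + 2)} (hβ₀ : β₀ ∈ S.initialAt (S.γ x)) (h0 : S.lt x (S.γ β₀))
    (hmin : ∀ β ∈ S.initialAt (S.γ x), S.lt x (S.γ β) → β = β₀ ∨ S.lt (S.γ β₀) (S.γ β))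
    (hle : upLE (S.γ β₀) x') (hx' : S.γ x ∈ dDot x') (hxx' : S.lt x x') :
    hS.upCut x = hS.downCut (S.γ x) x' := by
  rw [hS.upCut_eq_downCut_iff]
  refine fun β hβ => ⟨hS.not_lt_or_lt_of_lt hxx' hx' hβ, fun h1 h2 => ?_⟩
  rcases hmin β hβ h2 with rfl | h3
  · exact hS.not_lt_of_upLE hle h1
  · exact hS.not_lt_of_upLE hle (hS.lt_trans _ _ _ h3 h1)

theorem upCut_eq_downCut_of_last (hS : S.IsOrderedFaceStructure) {x x' : S.F (k + 1)}
    {β₀ : S.F (k + 2)} (hx : S.γ x' ∈ dDot x)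
    (hmax : ∀ β ∈ S.initialAt (S.γ x'), S.lt (S.γ β) x → β = β₀ ∨ S.lt (S.γ β) (S.γ β₀))
    (hle : upLE (S.γ β₀) x') (hxx' : S.lt x' x) :
    hS.upCut x' = hS.downCut (S.γ x') x := by
  rw [hS.upCut_eq_downCut_iff]
  refine fun β hβ => ⟨hS.not_lt_or_lt_of_lt hxx' hx hβ, fun h1 h2 => ?_⟩
  rcases hmax β hβ h1 with rfl | h3
  · exact hS.not_lt_of_upLE' hle h2
  · exact hS.not_lt_of_upLE' hle (hS.lt_trans _ _ _ h2 h3)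

theorem γ_eq_of_initial_le_isLoop (hS : S.IsOrderedFaceStructure) {y : S.F k} {β : S.F (k + 2)}
    {x : S.F (k + 1)} (hβ : β ∈ S.initialAt y) (h : upLE (S.γ β) x) (hx : IsLoop x) :
    S.γ x = y := by
  rw [← hS.γ_eq_of_upLE_isLoop h hx, hS.γγ_eq_of_mem hβ]

/-- A loop above `γ(β)` that belongs to the refined domain of `a`, for `β` inside `a` or ending
below the domain of `a`. -/
theorem exists_isLoop_refinedDom (hS : S.IsOrderedFaceStructure) {a : S.F (k + 2)} {y : S.F k}
    {β : S.F (k + 2)} (hβ : β ∈ S.initialAt y)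
    (h : upLE β a ∨ ∃ x ∈ dDot a, upLE (S.γ β) x)
    (hNL : ∀ x ∈ dDotNL a, ¬ upLE (S.γ β) x) :
    ∃ x ∈ refinedDom a, IsLoop x ∧ S.γ x = y ∧ y ∈ dDot x ∧ upLE (S.γ β) x := by
  obtain ⟨x, h1, h2, h3⟩ : ∃ x ∈ refinedDom a, IsLoop x ∧ upLE (S.γ β) x := by
    rcases h with h | ⟨x, hx, h⟩
    · exact ⟨S.γ β, Or.inr ⟨β, hβ.1, h, rfl⟩, hS.isLoop_γ_initial hβ.1, upLE.refl _⟩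
    · refine ⟨x, Or.inl hx, ?_, h⟩
      by_contra hl
      exact hNL x ⟨hx, hl⟩ h
  have h4 := hS.γ_eq_of_initial_le_isLoop hβ h3 h2
  exact ⟨x, h1, h2, h4, by rw [dDot_eq_of_isLoop h2, h4]; rfl, h3⟩

theorem exists_upCut_eq_downCut (hS : S.IsOrderedFaceStructure) {a : S.F (k + 2)}
    {x : S.F (k + 1)} (hx : x ∈ refinedDom a)
    {β₀ : S.F (k + 2)} (hβ₀ : β₀ ∈ S.initialAt (S.γ x)) (h0 : S.lt x (S.γ β₀))
    (hmin : ∀ β ∈ S.initialAt (S.γ x), S.lt x (S.γ β) → β = β₀ ∨ S.lt (S.γ β₀) (S.γ β))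
    (h : upLE β₀ a ∨ ∃ x ∈ dDot a, upLE (S.γ β₀) x)
    (hNL : ∀ x ∈ dDotNL a, ¬ upLE (S.γ β₀) x) :
    ∃ x' ∈ refinedDom a, S.γ x ∈ dDot x' ∧ hS.upCut x = hS.downCut (S.γ x) x' := by
  obtain ⟨x', h1, h2, h3, h4, h5⟩ := hS.exists_isLoop_refinedDom hβ₀ h hNL
  refine ⟨x', h1, h4, hS.upCut_eq_downCut_of_first hβ₀ h0 hmin h5 h4 ?_⟩
  have hne : x ≠ x' := by
    rintro rfl
    exact hS.not_lt_of_upLE' h5 h0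
  rcases hS.lt_or_of_refinedDom hx h1 (mem_thetaDot.2 (Or.inr rfl)) (mem_thetaDot.2 (Or.inl h4)) hne
    with h | h
  · exact h
  · exact absurd (hS.lt_trans _ _ _ h h0) (hS.not_lt_of_upLE' h5)

theorem exists_upCut_eq_downCut' (hS : S.IsOrderedFaceStructure) {a : S.F (k + 2)}
    {x : S.F (k + 1)} {y : S.F k} (hx : x ∈ refinedDom a) (hy : y ∈ dDot x)
    {β₀ : S.F (k + 2)} (hβ₀ : β₀ ∈ S.initialAt y) (h0 : S.lt (S.γ β₀) x)
    (hmax : ∀ β ∈ S.initialAt y, S.lt (S.γ β) x → β = β₀ ∨ S.lt (S.γ β) (S.γ β₀))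
    (h : upLE β₀ a ∨ ∃ x ∈ dDot a, upLE (S.γ β₀) x)
    (hNL : ∀ x ∈ dDotNL a, ¬ upLE (S.γ β₀) x) :
    ∃ x' ∈ refinedDom a, S.γ x' = y ∧ hS.upCut x' = hS.downCut y x := by
  obtain ⟨x', h1, h2, rfl, h4, h5⟩ := hS.exists_isLoop_refinedDom hβ₀ h hNL
  refine ⟨x', h1, rfl, hS.upCut_eq_downCut_of_last hy hmax h5 ?_⟩
  have hne : x' ≠ x := by
    rintro rfl
    exact hS.not_lt_of_upLE h5 h0
  rcases hS.lt_or_of_refinedDom h1 hx (mem_thetaDot.2 (Or.inl h4)) (mem_thetaDot.2 (Or.inl hy)) hne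
    with h | h
  · exact h
  · exact absurd (hS.lt_trans _ _ _ h0 h) (hS.not_lt_of_upLE h5)

theorem eq_γ_of_isLoop (hS : S.IsOrderedFaceStructure) {a : S.F (k + 2)} {x : S.F (k + 1)}
    (ha : IsLoop a) (hx : x ∈ refinedDom a) : x = S.γ a := by
  rcases hx with hx | ⟨α, h1, h2, -⟩
  · rw [dDot_eq_of_isLoop ha] at hx
    exact hx
  · exact absurd (hS.isLoop_of_upLE h2 ha) h1.not_isLoop

theorem exists_NL_mem_of_refinedDom (hS : S.IsOrderedFaceStructure) {a : S.F (k + 2)}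
    {x : S.F (k + 1)} (hx : x ∈ refinedDom a) (hne : S.γ x ≠ S.γ (S.γ a)) :
    ∃ c ∈ dDotNL a, S.γ x ∈ dDot c := by
  rcases hx with hx | ⟨α, h1, h2, rfl⟩
  · exact hS.exists_dDotNL hx hne
  · exact hS.exists_NL_of_initial h1 h2 hne

/-- The alternative for an initial face `β` at `y`, with `γ(β)` between two faces of the refined
domain of `a`. -/
theorem initial_between (hS : S.IsOrderedFaceStructure) {a : S.F (k + 2)} (ha : ¬ IsLoop a)
    {y : S.F k} {β : S.F (k + 2)} {x x' : S.F (k + 1)} (hβ : β ∈ S.initialAt y)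
    (hx : x ∈ refinedDom a) (hx' : x' ∈ refinedDom a) (h1 : S.lt x (S.γ β)) (h2 : S.lt (S.γ β) x')
    (hy : y ∈ thetaDot (S.γ a) ∨ y ∈ iota a) :
    upLE β a ∨ ∃ x ∈ dDot a, upLE (S.γ β) x := by
  rcases hy with hy | hy
  · apply hS.upLE_or_of_min hβ.1.isMin hβ.1.not_isLoop ha
    rcases hS.initialAt_cases hβ hy with h | h | h
    · exact absurd (hS.lt_trans _ _ _ h h2) (hS.not_lt_of_upLE' (hS.upLE_of_mem_refinedDom hx'))
    · exact absurd (hS.lt_trans _ _ _ h1 h) (hS.not_lt_of_upLE (hS.upLE_of_mem_refinedDom hx))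
    · exact h
  · rcases hS.pencil_empty β a hβ.1.1 (by rwa [hS.γγ_eq_of_mem hβ]) with h | h
    · exact Or.inr (hS.upLE_of_lt h)
    · exact Or.inl h.le

/-- The codomain half of globularity: an output that is not the final one is consumed inside the
domain. A candidate consumer is compared with x; if the cuts differ, the first initial face β₀ after
x supplies a loop of the refined domain instead. It must be checked that β₀ is not hidden inside a
non-loop of δ(a). -/
theorem upCut_refinedDom (hS : S.IsOrderedFaceStructure) {a : S.F (k + 2)} {x : S.F (k + 1)}
    (hx : x ∈ refinedDom a) : hS.upCut x = hS.upCut (S.γ a) ∨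
      ∃ x' ∈ refinedDom a, S.γ x ∈ dDot x' ∧ hS.upCut x = hS.downCut (S.γ x) x' := by
  by_cases ha : IsLoop a
  · exact Or.inl (by rw [hS.eq_γ_of_isLoop ha hx])
  have hxa := hS.upLE_of_mem_refinedDom hx
  have hNLeq : ∀ β₀ ∈ S.initialAt (S.γ x), S.lt x (S.γ β₀) →
      ∀ x' ∈ dDotNL a, upLE (S.γ β₀) x' → S.γ x' ≠ S.γ x := by
    intro β₀ hβ₀ h0 x' hx' hle e
    have hne : x ≠ x' := by
      rintro rfl
      exact hS.not_lt_of_upLE' hle h0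
    rcases hS.lt_or_of_refinedDom (y := S.γ x) hx (Or.inl hx'.1) (mem_thetaDot.2 (Or.inr rfl))
      (mem_thetaDot.2 (Or.inr e.symm)) hne with h | h
    · exact hS.not_lt_of_γ_eq hx'.2 e.symm h
    · exact hS.not_lt_of_upLE' hle (hS.lt_trans _ _ _ h h0)
  by_cases hz : S.γ x = S.γ (S.γ a)
  · by_cases hcut : hS.upCut x = hS.upCut (S.γ a)
    · exact Or.inl hcut
    right
    have hex : ∃ β ∈ S.initialAt (S.γ x), S.lt x (S.γ β) ∧ ¬ S.lt (S.γ a) (S.γ β) := by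
      by_contra hno
      push Not at hno
      refine hcut ((hS.upCut_eq_upCut_iff hz).2 fun β hβ => ?_)
      have hβ' : β ∈ S.initialAt (S.γ x) := hz ▸ hβ
      refine ⟨hno β hβ', fun h => ?_⟩
      rcases hS.initialAt_cases hβ' (x := x) (Or.inr rfl) with h1 | h1 | h1
      · exact h1
      · exact absurd (hS.lt_trans _ _ _ h h1) (hS.not_lt_of_upLE' hxa)
      · exact absurd h (hS.not_lt_of_upLE' (h1.trans hxa))
    obtain ⟨β₁, hβ₁, h1, h2⟩ := hex
    obtain ⟨β₀, hβ₀, h0, hmin⟩ := hS.exists_first (p := fun β => S.lt x (S.γ β)) ⟨β₁, hβ₁, h1⟩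
    have h3 : ¬ S.lt (S.γ a) (S.γ β₀) := by
      rcases hmin β₁ hβ₁ h1 with rfl | h
      · exact h2
      · exact fun h' => h2 (hS.lt_trans _ _ _ h' h)
    -- γ(β₀) is not after γ(a) by choice, and not before it because x ≤⁺ γ(a).
    have h4 : upLE (S.γ β₀) (S.γ a) := by
      rcases hS.initialAt_cases hβ₀ (x := S.γ a) (mem_thetaDot.2 (Or.inr hz)) with h | h | h
      · exact absurd h h3
      · exact absurd (hS.lt_trans _ _ _ h0 h) (hS.not_lt_of_upLE hxa)
      · exact h
    refine hS.exists_upCut_eq_downCut hx hβ₀ h0 hmin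
      (hS.upLE_or_of_min hβ₀.1.isMin hβ₀.1.not_isLoop ha h4) fun x' hx' hle => ?_
    refine hNLeq β₀ hβ₀ h0 x' hx' hle (hS.le_antisymm ?_ ?_)
    · rw [hz]
      exact hS.upLE_γγ_of_mem hx'.1
    · have := hS.upLE_γ hle
      rwa [hS.γγ_eq_of_mem hβ₀] at this
  · right
    obtain ⟨c, hc, hyc⟩ := hS.exists_NL_mem_of_refinedDom hx hz
    have hxc : S.lt x c := by
      have hne : x ≠ c := by
        rintro rfl
        exact hc.2 (hS.isLoop_of_mem hyc)
      rcases hS.lt_or_of_refinedDom (y := S.γ x) hx (Or.inl hc.1) (mem_thetaDot.2 (Or.inr rfl))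
        (mem_thetaDot.2 (Or.inl hyc)) hne with h | h
      · exact h
      · exact (hS.not_lt_le (upLT.of_mem hc.2 hyc) (hS.upLE_γ_of_lt h)).elim
    by_cases hcut : hS.upCut x = hS.downCut (S.γ x) c
    · exact ⟨c, Or.inl hc.1, hyc, hcut⟩
    have hex : ∃ β ∈ S.initialAt (S.γ x), S.lt x (S.γ β) ∧ S.lt (S.γ β) c := by
      by_contra hno
      push Not at hno
      exact hcut (hS.upCut_eq_downCut_iff.2 fun β hβ =>
        ⟨hS.not_lt_or_lt_of_lt hxc hyc hβ, fun h h' => hno β hβ h' h⟩)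
    obtain ⟨β₁, hβ₁, h1, h2⟩ := hex
    obtain ⟨β₀, hβ₀, h0, hmin⟩ := hS.exists_first (p := fun β => S.lt x (S.γ β)) ⟨β₁, hβ₁, h1⟩
    have h3 : S.lt (S.γ β₀) c := by
      rcases hmin β₁ hβ₁ h1 with rfl | h
      · exact h2
      · exact hS.lt_trans _ _ _ h h2
    have hy : S.γ x ∈ thetaDot (S.γ a) ∨ S.γ x ∈ iota a := by
      rcases hS.mem_γ_or hc.1 hyc with h | ⟨d, hd, h⟩
      · exact Or.inl (mem_thetaDot.2 (Or.inl h))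
      · exact Or.inr (mem_iota hd hc h hyc)
    refine hS.exists_upCut_eq_downCut hx hβ₀ h0 hmin
      (hS.initial_between ha hβ₀ hx (Or.inl hc.1) h0 h3 hy) fun x' hx' hle => ?_
    have hne : c ≠ x' := by
      rintro rfl
      exact hS.not_lt_of_upLE hle h3
    by_cases hyx' : S.γ x ∈ thetaDot x'
    · rcases mem_thetaDot.1 hyx' with h | h
      · rcases hS.upLT_of_common hc.2 hx'.2 hyc h hne with h' | h'
        · exact hS.local_discreteness a _ hc.1 _ hx'.1 h'
        · exact hS.local_discreteness a _ hx'.1 _ hc.1 h'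
      · exact hNLeq β₀ hβ₀ h0 x' hx' hle h.symm
    -- Here γ(x) is internal to a face inside `x'`, so some non-loop `e` <⁺ `x'` starts at it, as
    -- `c` does. Comparing `c` with `e` either orders `c` below `x'` or identifies them.
    · obtain ⟨ξ, hξ, h5, -, -, e, he, -, h6⟩ :=
        hS.iota_of_notMem_thetaDot hle (hS.mem_thetaDot_initialAt hβ₀) hyx'
      have h7 : upLT e x' := (upLT.of_mem hξ he.1).trans_le h5
      have key : upLE c e ∨ upLE e c := by
        by_cases h : c = e
        · exact Or.inl (Or.inl h)
        · exact (hS.upLT_of_common hc.2 he.2 hyc h6 h).imp Or.inr Or.inr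
      rcases key with h | h
      · exact hS.local_discreteness a _ hc.1 _ hx'.1 (h.trans_lt h7)
      · exact hne (hS.eq_of_common_below hc.1 hx'.1 h h7.le)

/-- The new case is an inserted loop at y. If y = γγ(a), then γ(a) is not a loop, so the domain of a
contains a non-loop and hence one ending at γγ(a). Otherwise y starts a non-loop of the domain, and
globularity of δ makes it a codomain too. -/
theorem exists_NL_γ_of_refinedDom (hS : S.IsOrderedFaceStructure) {a : S.F (k + 2)}
    {x : S.F (k + 1)} {y : S.F k} (hx : x ∈ refinedDom a) (hy : y ∈ dDot x)
    (hya : y ∉ dDot (S.γ a)) : ∃ c ∈ dDotNL a, S.γ c = y := by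
  rcases hx with hx | ⟨α, h1, h2, rfl⟩
  · exact (hS.mem_γ_or hx hy).resolve_left hya
  · rw [dDot_eq_of_isLoop (hS.isLoop_γ_initial h1)] at hy
    have e : y = S.γ (S.γ α) := hy
    subst e
    by_cases hz : S.γ (S.γ α) = S.γ (S.γ a)
    · rw [hz] at hya ⊢
      have hl : ¬ IsLoop (S.γ a) := fun h => hya (by rw [dDot_eq_of_isLoop h]; rfl)
      have hne : (dDot a).Nonempty := by
        rcases dDot_nonempty_or a with h | ⟨u, hu⟩
        · exact h
        · exact absurd (hS.isLoop_γ_of_one hu) hl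
      obtain ⟨d, hd, hdl⟩ : ∃ d ∈ dDot a, ¬ IsLoop (S := S.toHypergraph) d := by
        by_contra h
        push Not at h
        exact hl (hS.isLoop_γ hne h)
      obtain ⟨c, hc, h, -⟩ := hS.exists_NL_γ_eq ⟨hd, hdl⟩
      exact ⟨c, hc, h⟩
    · obtain ⟨c, hc, h⟩ := hS.exists_NL_of_initial h1 h2 hz
      exact (hS.mem_γ_or hc.1 h).resolve_left hya

/-- The mirror image of `upCut_refinedDom`: an input cut not inherited by γ(a) is produced inside
the domain, the last initial face before x replacing the first one after it. -/
theorem downCut_refinedDom (hS : S.IsOrderedFaceStructure) {a : S.F (k + 2)} {x : S.F (k + 1)}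
    {y : S.F k} (hx : x ∈ refinedDom a) (hy : y ∈ dDot x) :
    (y ∈ dDot (S.γ a) ∧ hS.downCut y x = hS.downCut y (S.γ a)) ∨
      ∃ x' ∈ refinedDom a, S.γ x' = y ∧ hS.upCut x' = hS.downCut y x := by
  by_cases ha : IsLoop a
  · rw [hS.eq_γ_of_isLoop ha hx] at hy ⊢
    exact Or.inl ⟨hy, rfl⟩
  have hxa := hS.upLE_of_mem_refinedDom hx
  have hNLmem : ∀ β₀ ∈ S.initialAt y, S.lt (S.γ β₀) x →
      ∀ x' ∈ dDotNL a, upLE (S.γ β₀) x' → y ∉ dDot x' := by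
    intro β₀ hβ₀ h0 x' hx' hle h
    have hne : x ≠ x' := by
      rintro rfl
      exact hS.not_lt_of_upLE hle h0
    rcases hS.lt_or_of_refinedDom hx (Or.inl hx'.1) (mem_thetaDot.2 (Or.inl hy))
      (mem_thetaDot.2 (Or.inl h)) hne with h' | h'
    · exact hS.not_lt_of_upLE hle (hS.lt_trans _ _ _ h0 h')
    · exact hS.not_lt_of_common hx'.2 h hy h'
  by_cases hya : y ∈ dDot (S.γ a)
  · by_cases hcut : hS.downCut y x = hS.downCut y (S.γ a)
    · exact Or.inl ⟨hya, hcut⟩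
    right
    have hex : ∃ β ∈ S.initialAt y, S.lt (S.γ β) x ∧ ¬ S.lt (S.γ β) (S.γ a) := by
      by_contra hno
      push Not at hno
      refine hcut (hS.downCut_eq_downCut_iff.2 fun β hβ => ⟨hno β hβ, fun h => ?_⟩)
      rcases hS.initialAt_cases hβ (x := x) (mem_thetaDot.2 (Or.inl hy)) with h1 | h1 | h1
      · exact absurd (hS.lt_trans _ _ _ h1 h) (hS.not_lt_of_upLE hxa)
      · exact h1
      · exact absurd h (hS.not_lt_of_upLE (h1.trans hxa))
    obtain ⟨β₁, hβ₁, h1, h2⟩ := hex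
    obtain ⟨β₀, hβ₀, h0, hmax⟩ := hS.exists_last (p := fun β => S.lt (S.γ β) x) ⟨β₁, hβ₁, h1⟩
    have h3 : ¬ S.lt (S.γ β₀) (S.γ a) := by
      rcases hmax β₁ hβ₁ h1 with rfl | h
      · exact h2
      · exact fun h' => h2 (hS.lt_trans _ _ _ h h')
    have h4 : upLE (S.γ β₀) (S.γ a) := by
      rcases hS.initialAt_cases hβ₀ (x := S.γ a) (mem_thetaDot.2 (Or.inl hya)) with h | h | h
      · exact absurd (hS.lt_trans _ _ _ h h0) (hS.not_lt_of_upLE' hxa)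
      · exact absurd h h3
      · exact h
    refine hS.exists_upCut_eq_downCut' hx hy hβ₀ h0 hmax
      (hS.upLE_or_of_min hβ₀.1.isMin hβ₀.1.not_isLoop ha h4) fun x' hx' hle => ?_
    have hx'a := upLT.of_mem ha hx'.1
    by_cases hyx' : y ∈ thetaDot x'
    · rcases mem_thetaDot.1 hyx' with h | h
      · exact hNLmem β₀ hβ₀ h0 x' hx' hle h
      · exact hS.γ_notMem_of_upLT hx'a hx'.2 (h ▸ hya)
    · obtain ⟨ξ, hξ, h5, f, hf, -, -, h6, -⟩ :=
        hS.iota_of_notMem_thetaDot hle (hS.mem_thetaDot_initialAt hβ₀) hyx'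
      exact hS.γ_notMem_of_upLT (((upLT.of_mem hξ hf.1).trans_le h5).trans hx'a) hf.2 (h6 ▸ hya)
  · right
    obtain ⟨c, hc, rfl⟩ := hS.exists_NL_γ_of_refinedDom hx hy hya
    have hcx : S.lt c x := by
      have hne : c ≠ x := by
        rintro rfl
        exact hc.2 (hS.isLoop_of_mem hy)
      rcases hS.lt_or_of_refinedDom (y := S.γ c) (Or.inl hc.1) hx (mem_thetaDot.2 (Or.inr rfl))
        (mem_thetaDot.2 (Or.inl hy)) hne with h | h
      · exact h
      · exact (hS.not_lt_le (hS.upLT_γ_of_lt h hc.2) (upLE.of_mem hy)).elim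
    by_cases hcut : hS.upCut c = hS.downCut (S.γ c) x
    · exact ⟨c, Or.inl hc.1, rfl, hcut⟩
    have hex : ∃ β ∈ S.initialAt (S.γ c), S.lt (S.γ β) x ∧ S.lt c (S.γ β) := by
      by_contra hno
      push Not at hno
      exact hcut (hS.upCut_eq_downCut_iff.2 fun β hβ =>
        ⟨hS.not_lt_or_lt_of_lt hcx hy hβ, fun h => hno β hβ h⟩)
    obtain ⟨β₁, hβ₁, h1, h2⟩ := hex
    obtain ⟨β₀, hβ₀, h0, hmax⟩ := hS.exists_last (p := fun β => S.lt (S.γ β) x) ⟨β₁, hβ₁, h1⟩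
    have h3 : S.lt c (S.γ β₀) := by
      rcases hmax β₁ hβ₁ h1 with rfl | h
      · exact h2
      · exact hS.lt_trans _ _ _ h2 h
    have hyy : S.γ c ∈ thetaDot (S.γ a) ∨ S.γ c ∈ iota a := by
      rcases hS.γ_eq_or hc.1 with h | ⟨d, hd, h⟩
      · exact Or.inl (mem_thetaDot.2 (Or.inr h))
      · exact Or.inr (mem_iota hc hd rfl h)
    refine hS.exists_upCut_eq_downCut' hx hy hβ₀ h0 hmax
      (hS.initial_between ha hβ₀ (Or.inl hc.1) hx h3 h0 hyy) fun x' hx' hle => ?_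
    have hne : c ≠ x' := by
      rintro rfl
      exact hS.not_lt_of_upLE' hle h3
    by_cases hyx' : S.γ c ∈ thetaDot x'
    · rcases mem_thetaDot.1 hyx' with h | h
      · exact hNLmem β₀ hβ₀ h0 x' hx' hle h
      · rcases hS.upLT_of_γ_eq hc.2 hx'.2 h hne with h' | h'
        · exact hS.local_discreteness a _ hc.1 _ hx'.1 h'
        · exact hS.local_discreteness a _ hx'.1 _ hc.1 h'
    · obtain ⟨ξ, hξ, h5, f, hf, -, -, h6, -⟩ :=
        hS.iota_of_notMem_thetaDot hle (hS.mem_thetaDot_initialAt hβ₀) hyx'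
      have h7 : upLT f x' := (upLT.of_mem hξ hf.1).trans_le h5
      have key : upLE c f ∨ upLE f c := by
        by_cases h : c = f
        · exact Or.inl (Or.inl h)
        · exact (hS.upLT_of_γ_eq hc.2 hf.2 h6.symm h).imp Or.inr Or.inr
      rcases key with h | h
      · exact hS.local_discreteness a _ hc.1 _ hx'.1 (h.trans_lt h7)
      · exact hne (hS.eq_of_common_below hc.1 hx'.1 h h7.le)

/-- Equality would give γ(a) <^∼ x, whereas x ≤⁺ γ(a). -/
theorem upCut_γ_ne_downCut (hS : S.IsOrderedFaceStructure) {a : S.F (k + 2)} {x : S.F (k + 1)}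
    {y : S.F k} (hx : x ∈ refinedDom a) (hy : y ∈ dDot x) :
    hS.upCut (S.γ a) ≠ hS.downCut y x := fun e =>
  hS.not_lt_of_upLE' (hS.upLE_of_mem_refinedDom hx) (hS.lt_of_upCut_eq_downCut hy e)

theorem downCut_γ_ne_upCut (hS : S.IsOrderedFaceStructure) {a : S.F (k + 2)} {x : S.F (k + 1)}
    {y : S.F k} (hx : x ∈ refinedDom a) (hy : y ∈ dDot (S.γ a)) :
    hS.downCut y (S.γ a) ≠ hS.upCut x := fun e =>
  hS.not_lt_of_upLE (hS.upLE_of_mem_refinedDom hx) (hS.lt_of_upCut_eq_downCut hy e.symm)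

theorem refinedDom_nonempty (hS : S.IsOrderedFaceStructure) (a : S.F (k + 2)) :
    (refinedDom a).Nonempty := by
  rcases dDot_nonempty_or a with ⟨x, hx⟩ | ⟨u, hu⟩
  · exact ⟨x, Or.inl hx⟩
  · obtain ⟨α, hα, h⟩ := hS.exists_initial_le hu
    exact ⟨_, Or.inr ⟨α, hα.1, h, rfl⟩⟩

/-- A <^∼-maximal member works: if its output were the input of another member, that member would be
larger. -/
theorem exists_upCut_eq_γ (hS : S.IsOrderedFaceStructure) (a : S.F (k + 2)) :
    ∃ x ∈ refinedDom a, hS.upCut x = hS.upCut (S.γ a) := by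
  obtain ⟨x, hx, hmax⟩ := hS.wf_gt.has_min (refinedDom a) (hS.refinedDom_nonempty a)
  refine ⟨x, hx, (hS.upCut_refinedDom hx).resolve_right ?_⟩
  rintro ⟨x', hx', hy, e⟩
  exact hmax x' hx' (hS.lt_of_upCut_eq_downCut hy e)

theorem exists_downCut_eq_γ (hS : S.IsOrderedFaceStructure) {a : S.F (k + 2)} {y : S.F k}
    (hy : y ∈ dDot (S.γ a)) :
    ∃ x ∈ refinedDom a, y ∈ dDot x ∧ hS.downCut y x = hS.downCut y (S.γ a) := by
  by_cases ha : IsLoop a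
  · exact ⟨S.γ a, Or.inl (by rw [dDot_eq_of_isLoop ha]; rfl), hy, rfl⟩
  have hex : {x | x ∈ refinedDom a ∧ y ∈ dDot x}.Nonempty := by
    rcases dDot_nonempty_or a with h | ⟨u, hu⟩
    · obtain ⟨c, hc, h'⟩ := hS.exists_mem_of_mem_γ h hy
      exact ⟨c, Or.inl hc, h'⟩
    · obtain ⟨α, hα, h⟩ := hS.exists_initial_le hu
      refine ⟨S.γ α, Or.inr ⟨α, hα.1, h, rfl⟩, ?_⟩
      rw [dDot_eq_of_isLoop (hS.isLoop_γ_of_one hu), hS.γγ_eq hu] at hy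
      exact hy ▸ hS.mem_dDot_initialAt hα
  obtain ⟨x, ⟨hx, hyx⟩, hmin⟩ := hS.wf_lt.has_min _ hex
  rcases hS.downCut_refinedDom hx hyx with ⟨-, h⟩ | ⟨x', hx', rfl, e⟩
  · exact ⟨x, hx, hyx, h⟩
  exfalso
  have hlt := hS.lt_of_upCut_eq_downCut hyx e
  -- A loop `x'` also has y in its domain, against the minimality of `x`. A non-loop inside γ(a)
  -- cannot end in the domain of γ(a).
  by_cases hl : IsLoop x'
  · exact hmin x' ⟨hx', by rw [dDot_eq_of_isLoop hl]; rfl⟩ hlt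
  · rcases hS.upLE_of_mem_refinedDom hx' with rfl | h
    · exact hl (hS.isLoop_of_mem hy)
    · exact hS.γ_notMem_of_upLT h hl hy

end OrderedHypergraph.IsOrderedFaceStructure
end FaceStr

namespace FaceStr
open FaceStr.Hypergraph

/-! ### The upper and lower orders of S†. -/

namespace OrderedHypergraph

variable {S : OrderedHypergraph.{u}} {k : ℕ}

/-- The cut `(x, ∅, 𝓘_x)`. -/
def botCut (x : S.F k) : S.Cut k where
  base := x
  L := ∅
  U := S.initialAt x
  union_eq := Set.empty_union _
  lt _ hα := hα.elim

theorem Cut.L_subset (c : S.Cut k) : c.L ⊆ S.initialAt c.base := by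
  rw [← c.union_eq]
  exact Set.subset_union_left

namespace IsOrderedFaceStructure

instance (k : ℕ) : Finite (S.Cut k) := by
  have := S.finite k
  have := S.finite (k + 2)
  refine Finite.of_injective (β := S.F k × Set (S.F (k + 2)) × Set (S.F (k + 2)))
    (fun c => (c.base, c.L, c.U)) fun c d h => ?_
  simp only [Prod.mk.injEq] at h
  exact Cut.ext h.1 h.2.1 h.2.2

/-- Elements of the two differences would precede each other under <^∼. -/
theorem cut_L_cases (hS : S.IsOrderedFaceStructure) {c d : S.Cut k} (h : c.base = d.base) :
    c = d ∨ c.L ⊂ d.L ∨ d.L ⊂ c.L := by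
  have key : ∀ {c d : S.Cut k}, c.base = d.base → ¬ c.L ⊆ d.L → d.L ⊆ c.L := by
    intro c d h hcd β hβ
    obtain ⟨α, hα, hαd⟩ := Set.not_subset.1 hcd
    have hαU : α ∈ d.U := by
      have h1 : α ∈ d.L ∪ d.U := by
        rw [d.union_eq, ← h]
        exact c.L_subset hα
      exact h1.resolve_left hαd
    have hβ' : β ∈ c.L ∪ c.U := by
      rw [c.union_eq, h]
      exact d.L_subset hβ
    refine hβ'.resolve_right fun hβU => ?_
    exact hS.lt_asymm (c.lt _ hα _ hβU) (d.lt _ hβ _ hαU)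
  by_cases h1 : c.L ⊆ d.L
  · by_cases h2 : d.L ⊆ c.L
    · exact Or.inl (Cut.ext_L hS h (h1.antisymm h2))
    · exact Or.inr (Or.inl ⟨h1, h2⟩)
  · exact Or.inr (Or.inr ⟨key h h1, h1⟩)

/-- A cut with a nonempty lower part ends at the loop `γ(α)` of its last initial face. -/
theorem exists_eq_upCut (hS : S.IsOrderedFaceStructure) {d : S.Cut k} (h : d.L.Nonempty) :
    ∃ α ∈ S.initialAt d.base, d = hS.upCut (S.γ α) ∧
      (hS.downCut d.base (S.γ α)).L ⊂ d.L ∧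
      ∀ c : S.Cut k, c.base = d.base → c.L ⊂ d.L → c.L ⊆ (hS.downCut d.base (S.γ α)).L := by
  obtain ⟨β, hβ⟩ := h
  -- With α the last element of `d.L`, the cut `downCut d.base (γ α)` is the immediate predecessor
  -- of `d`.
  obtain ⟨α, hα, hαL, hmax⟩ := hS.exists_last (p := fun β => β ∈ d.L) ⟨β, d.L_subset hβ, hβ⟩
  refine ⟨α, hα, Cut.ext_L hS (hS.γγ_eq_of_mem hα).symm ?_, ⟨?_, fun h => ?_⟩, ?_⟩
  · ext β
    simp only [upCut, hS.γγ_eq_of_mem hα, Set.mem_sdiff, Set.mem_ofPred_eq]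
    refine ⟨fun hβ => ⟨d.L_subset hβ, fun h => ?_⟩, fun ⟨hβ, h⟩ => ?_⟩
    · rcases hmax β (d.L_subset hβ) hβ with rfl | h'
      · exact hS.lt_irrefl _ h
      · exact hS.lt_asymm h h'
    · rw [← d.union_eq] at hβ
      exact hβ.resolve_right fun hU => h (d.lt _ hαL _ hU)
  · rintro β ⟨hβ, h⟩
    rw [← d.union_eq] at hβ
    exact hβ.resolve_right fun hU => hS.lt_asymm h (d.lt _ hαL _ hU)
  · exact hS.lt_irrefl _ (h hαL).2
  · rintro c hc ⟨h1, h2⟩ β hβ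
    rcases hmax β (d.L_subset (h1 hβ)) (h1 hβ) with rfl | h
    · exfalso
      apply h2
      intro δ hδ
      have hδ' : δ ∈ c.L ∪ c.U := by
        rw [c.union_eq, hc]
        exact d.L_subset hδ
      refine hδ'.resolve_right fun hU => ?_
      have h3 := c.lt _ hβ _ hU
      rcases hmax δ (d.L_subset hδ) hδ with rfl | h4
      · exact hS.lt_irrefl _ h3
      · exact hS.lt_asymm h3 h4
    · exact ⟨d.L_subset (h1 hβ), h⟩

/-- With `upCut_L_of_isMin`: a minimal non-loop leads from the top cut over x to the bottom cut over
its codomain, since no initial loop at either end can be inside it or on its other side. -/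
theorem downCut_L_of_isMin (hS : S.IsOrderedFaceStructure) {a : S.F (k + 1)} {x : S.F k}
    (ha : IsMin a) (hl : ¬ IsLoop a) (hx : x ∈ dDot a) :
    (hS.downCut x a).L = S.initialAt x := by
  ext β
  refine ⟨fun h => h.1, fun hβ => ⟨hβ, ?_⟩⟩
  rcases hS.initialAt_cases hβ (x := a) (mem_thetaDot.2 (Or.inl hx)) with h | h | h
  · exact absurd h (hS.not_lt_of_common hl hx (hS.mem_dDot_initialAt hβ))
  · exact h
  · exact absurd (ha.eq h ▸ hS.isLoop_γ_initial hβ.1) hl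

theorem upCut_L_of_isMin (hS : S.IsOrderedFaceStructure) {a : S.F (k + 1)}
    (ha : IsMin a) (hl : ¬ IsLoop a) : (hS.upCut a).L = ∅ := by
  ext β
  simp only [Set.mem_empty_iff_false, iff_false]
  rintro ⟨hβ, h0⟩
  have hβ' : β ∈ S.initialAt (S.γ a) := hβ
  rcases hS.initialAt_cases hβ' (x := a) (mem_thetaDot.2 (Or.inr rfl)) with h | h | h
  · exact h0 h
  · exact hS.not_lt_of_γ_eq hl (hS.γγ_eq_of_mem hβ') h
  · exact absurd (ha.eq h ▸ hS.isLoop_γ_initial hβ.1) hl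

/-- The initial loop contained in a is neither before nor after a, so it separates the two cuts.
This is how a loop of S moves strictly upwards in S†. -/
theorem downCut_L_ssubset (hS : S.IsOrderedFaceStructure) {a : S.F (k + 1)} (hl : IsLoop a) :
    (hS.downCut (S.γ a) a).L ⊂ (hS.upCut a).L := by
  refine ⟨?_, fun h => ?_⟩
  · rintro β ⟨hβ, h⟩
    exact ⟨hβ, fun h' => hS.lt_asymm h h'⟩
  · obtain ⟨β, hβ, h1⟩ := hS.exists_initial_of_isLoop hl
    exact hS.not_lt_of_upLE h1 (h ⟨hβ, fun h' => hS.not_lt_of_upLE' h1 h'⟩).2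

/-- The face of `S` underlying a face of `S†`: `a` for a cut over `a`, and `γ(α)` for the bar
of `α`. -/
def sface : DaggerFace S k → S.F k
  | .cut c => c.base
  | .bar α _ => S.γ α

theorem dagger_γ (hS : S.IsOrderedFaceStructure) (A : hS.dagger.F (k + 1)) :
    hS.dagger.γ A = .cut (hS.upCut (sface A)) := by
  cases A <;> rfl

theorem cut_mem_dagger_δ (hS : S.IsOrderedFaceStructure) {A : hS.dagger.F (k + 1)} {d : S.Cut k} :
    DaggerFace.cut d ∈ hS.dagger.δ A ↔
      ∃ y ∈ dDot (sface A), d = hS.downCut y (sface A) := by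
  cases A with
  | cut c =>
    constructor
    · rintro (⟨_, _, _, h⟩ | ⟨y, hy, h⟩)
      · cases h
      · exact ⟨y, hy, DaggerFace.cut.inj h⟩
    · rintro ⟨y, hy, rfl⟩
      exact Or.inr ⟨y, hy, rfl⟩
  | bar α hα =>
    change d ∈ {d | DaggerFace.cut d = DaggerFace.cut _} ↔ _
    simp only [sface, dDot_eq_of_isLoop (hS.isLoop_γ_initial hα), Set.mem_singleton_iff,
      exists_eq_left, Set.mem_ofPred_eq, DaggerFace.cut.injEq]

theorem bar_mem_dagger_δ (hS : S.IsOrderedFaceStructure) {A : hS.dagger.F (k + 1)}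
    {α : S.F (k + 1)} {hα : IsInitial α} :
    DaggerFace.bar α hα ∈ hS.dagger.δ A ↔ ∃ c : S.Cut (k + 1), A = .cut c ∧ upLE α c.base := by
  cases A with
  | cut c =>
    constructor
    · rintro (⟨β, hβ, h1, h⟩ | ⟨y, hy, h⟩)
      · cases h
        exact ⟨c, rfl, h1⟩
      · cases h
    · rintro ⟨d, h, h1⟩
      cases h
      exact Or.inl ⟨α, hα, h1, rfl⟩
  | bar α hα =>
    constructor
    · intro h
      cases Set.mem_singleton_iff.1 h
    · rintro ⟨d, h, -⟩
      cases h

/-- The description of the upper order of `S†`. -/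
def daggerLT : DaggerFace S k → DaggerFace S k → Prop
  | .cut c, .cut d => upLT c.base d.base ∨ (c.base = d.base ∧ c.L ⊂ d.L)
  | .bar α _, .cut d => upLE (S.γ α) d.base
  | _, .bar _ _ => False

theorem daggerLT_trans {A B C : DaggerFace S k} (h : daggerLT A B) (h' : daggerLT B C) :
    daggerLT A C := by
  cases C with
  | bar => cases B <;> exact h'.elim
  | cut c =>
  cases B with
  | bar => cases A <;> exact h.elim
  | cut b =>
  cases A with
  | cut a =>
    rcases h with h | ⟨h, h1⟩
    · rcases h' with h' | ⟨h', -⟩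
      · exact Or.inl (h.trans h')
      · exact Or.inl (h' ▸ h)
    · rcases h' with h' | ⟨h', h2⟩
      · exact Or.inl (h ▸ h')
      · exact Or.inr ⟨h.trans h', h1.trans h2⟩
  | bar α hα =>
    rcases h' with h' | ⟨h', -⟩
    · exact upLE.trans h h'.le
    · change upLE _ _
      exact h' ▸ h

theorem daggerLT_of_upLT (hS : S.IsOrderedFaceStructure) {A B : hS.dagger.F k}
    (h : PosData.upLT A B) : daggerLT A B := by
  have step : ∀ {A B : hS.dagger.F k}, (∃ α, A ∈ hS.dagger.δ α ∧ hS.dagger.γ α = B) →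
      daggerLT A B := by
    rintro A B ⟨C, h1, rfl⟩
    rw [hS.dagger_γ]
    cases A with
    | cut c =>
      obtain ⟨y, hy, rfl⟩ := hS.cut_mem_dagger_δ.1 h1
      by_cases hl : IsLoop (sface C)
      · rw [dDot_eq_of_isLoop hl] at hy
        cases Set.mem_singleton_iff.1 hy
        exact Or.inr ⟨rfl, hS.downCut_L_ssubset hl⟩
      · exact Or.inl (upLT.of_mem hl hy)
    | bar α hα =>
      obtain ⟨c, rfl, h⟩ := hS.bar_mem_dagger_δ.1 h1
      exact hS.upLE_γ h
  induction h with
  | single h => exact step h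
  | tail _ h ih => exact daggerLT_trans ih (step h)

theorem upLT_cut_of_ssubset (hS : S.IsOrderedFaceStructure) {c d : S.Cut k} (h : c.base = d.base)
    (hL : c.L ⊂ d.L) : PosData.upLT (T := hS.dagger) (.cut c) (.cut d) := by
  have := S.finite (k + 2)
  induction d using (InvImage.wf Cut.L (wellFounded_lt (α := Set (S.F (k + 2))))).induction with
  | _ d ih =>
  obtain ⟨β, hβ, -⟩ := Set.exists_of_ssubset hL
  -- The bar of the last α in `d.L` joins the predecessor of `d` to `d`, and `c` is at or below that
  -- predecessor.
  obtain ⟨α, hα, h1, h2, h3⟩ := hS.exists_eq_upCut ⟨β, hβ⟩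
  have hstep : PosData.upLT (T := hS.dagger) (.cut (hS.downCut d.base (S.γ α))) (.cut d) := by
    refine .single ⟨.bar α hα.1, ?_, ?_⟩
    · exact hS.cut_mem_dagger_δ.2 ⟨_, hS.mem_dDot_initialAt hα, rfl⟩
    · conv_rhs => rw [h1]
      rfl
  rcases hS.cut_L_cases (c := c) (d := hS.downCut d.base (S.γ α)) h with e | e | e
  · rw [e]
    exact hstep
  · exact (ih _ h2 h e).trans hstep
  · exact absurd (h3 c h hL) e.2

theorem upLT_cut_of_upLT (hS : S.IsOrderedFaceStructure) {c d : S.Cut k}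
    (h : upLT c.base d.base) : PosData.upLT (T := hS.dagger) (.cut c) (.cut d) := by
  have le_of : ∀ {c d : S.Cut k}, c.base = d.base → c.L ⊆ d.L →
      Relation.ReflTransGen (fun x y => ∃ α : hS.dagger.F (k + 1), x ∈ hS.dagger.δ α ∧
        hS.dagger.γ α = y) (.cut c) (.cut d) := by
    intro c d h h'
    rcases hS.cut_L_cases h with e | e | e
    · rw [e]
      exact .refl
    · exact Relation.TransGen.to_reflTransGen (hS.upLT_cut_of_ssubset h e)
    · exact absurd h' e.2
  have step : ∀ {c d : S.Cut k}, minStep (S := S) c.base d.base →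
      PosData.upLT (T := hS.dagger) (.cut c) (.cut d) := by
    rintro c d ⟨a, h1, h2, h3, h4⟩
    -- Bars climb from `c` to the top cut over its base, a cut over the minimal face `a` crosses to
    -- the bottom cut over γ(a), and bars climb on to `d`.
    refine Relation.TransGen.trans_right
      (le_of (d := hS.downCut c.base a) rfl ?_) (Relation.TransGen.trans_left
      (.single ⟨.cut (botCut a), ?_, rfl⟩) (le_of (c := hS.upCut a) h4 ?_))
    · rw [hS.downCut_L_of_isMin h1 h2 h3]
      exact c.L_subset
    · exact hS.cut_mem_dagger_δ.2 ⟨_, h3, rfl⟩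
    · rw [hS.upCut_L_of_isMin h1 h2]
      exact Set.empty_subset _
  replace h := hS.transGen_minStep h
  generalize e : d.base = z at h
  induction h generalizing d with
  | single h => exact step (e ▸ h)
  | @tail y z _ h ih => exact (ih (d := botCut y) rfl).trans (step (e ▸ h))

theorem upLT_of_daggerLT (hS : S.IsOrderedFaceStructure) {A B : hS.dagger.F k}
    (h : daggerLT A B) : PosData.upLT A B := by
  cases B with
  | bar => cases A <;> exact h.elim
  | cut d =>
  cases A with
  | cut c =>
    rcases h with h | ⟨h, h'⟩
    · exact hS.upLT_cut_of_upLT h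
    · exact hS.upLT_cut_of_ssubset h h'
  | bar α hα =>
    -- A cut over α has the bar of α in its domain, and it ends at the bottom cut over γ(α) because
    -- α is a minimal non-loop.
    have h1 : PosData.upLT (T := hS.dagger) (.bar α hα) (.cut (hS.upCut α)) := by
      refine .single ⟨.cut (botCut α), ?_, rfl⟩
      exact hS.bar_mem_dagger_δ.2 ⟨_, rfl, upLE.refl _⟩
    rcases h with h | h
    · rcases hS.cut_L_cases (c := hS.upCut α) (d := d) h with e | e | e
      · exact e ▸ h1
      · exact h1.trans (hS.upLT_cut_of_ssubset h e)
      · rw [hS.upCut_L_of_isMin hα.isMin hα.not_isLoop] at e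
        exact absurd (Set.empty_subset _) e.2
    · exact h1.trans (hS.upLT_cut_of_upLT h)

theorem dagger_upLT_iff (hS : S.IsOrderedFaceStructure) {A B : hS.dagger.F k} :
    PosData.upLT A B ↔ daggerLT A B := ⟨hS.daggerLT_of_upLT, hS.upLT_of_daggerLT⟩

theorem lt_sface_of_lowLT (hS : S.IsOrderedFaceStructure) {A B : hS.dagger.F (k + 1)}
    (h : PosData.lowLT A B) : S.lt (sface A) (sface B) := by
  have step : ∀ {A B : hS.dagger.F (k + 1)}, hS.dagger.γ A ∈ hS.dagger.δ B →
      S.lt (sface A) (sface B) := by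
    intro A B h
    rw [hS.dagger_γ] at h
    obtain ⟨y, hy, e⟩ := hS.cut_mem_dagger_δ.1 h
    exact hS.lt_of_upCut_eq_downCut hy e
  replace h : Relation.TransGen (fun A B => hS.dagger.γ A ∈ hS.dagger.δ B) A B := h
  induction h with
  | single h => exact step h
  | tail _ h ih => exact hS.lt_trans _ _ _ ih (step h)

theorem _root_.FaceStr.PosData.lowLT_of_upLT_mem {T : PosData.{u}} {A B : T.F (k + 1)} {w : T.F k}
    (h : PosData.upLT (T.γ A) w) (hw : w ∈ T.δ B) : PosData.lowLT A B := by
  change Relation.TransGen (fun a b : T.F (k + 1) => T.γ a ∈ T.δ b) A B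
  generalize e : T.γ A = x at h
  induction h using Relation.TransGen.head_induction_on generalizing A with
  | single h =>
    obtain ⟨C, h1, rfl⟩ := h
    exact .head (e ▸ h1 : T.γ A ∈ T.δ C) (.single hw)
  | head h _ ih =>
    obtain ⟨C, h1, rfl⟩ := h
    exact .head (e ▸ h1 : T.γ A ∈ T.δ C) (ih rfl)

/-- The output cut of A lies at or below an input cut of B. The gap, over one base or over several,
is crossed by a path of the upper order, which is itself a chain for <⁻. -/
theorem lowLT_of_lt_sface (hS : S.IsOrderedFaceStructure) {A B : hS.dagger.F (k + 1)}
    (h : S.lt (sface A) (sface B)) : PosData.lowLT A B := by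
  obtain ⟨x, hx, h1⟩ := hS.upLE_of_lt h
  have hw : DaggerFace.cut (hS.downCut x (sface B)) ∈ hS.dagger.δ B :=
    hS.cut_mem_dagger_δ.2 ⟨x, hx, rfl⟩
  rcases h1 with rfl | h1
  · rcases hS.cut_L_cases (c := hS.upCut (sface A)) (d := hS.downCut _ (sface B)) rfl with e | e | e
    · refine .single ?_
      rw [hS.dagger_γ, e]
      exact hw
    · refine PosData.lowLT_of_upLT_mem ?_ hw
      rw [hS.dagger_γ]
      exact hS.upLT_cut_of_ssubset rfl e
    · refine absurd ?_ e.2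
      rintro β ⟨hβ, h2⟩
      exact ⟨hβ, hS.not_lt_or_lt_of_lt h hx hβ h2⟩
  · refine PosData.lowLT_of_upLT_mem ?_ hw
    rw [hS.dagger_γ]
    exact hS.upLT_cut_of_upLT h1

end IsOrderedFaceStructure
end OrderedHypergraph
end FaceStr

namespace FaceStr
open FaceStr.Hypergraph

/-! ### S† is a positive face structure, and the bars form a unary ideal. -/

namespace PosData

variable {T : PosData.{u}} {k : ℕ} {a : T.F (k + 2)} {x : T.F (k + 1)}

theorem globularity_γ_of_unary (h : T.δ a = {x}) (hγ : T.γ x = T.γ (T.γ a))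
    (hx : T.γ x ∉ T.δ x) :
    ({T.γ (T.γ a)} : Set (T.F k)) = T.γ '' T.δ a \ ⋃ y ∈ T.δ a, T.δ y := by
  simp only [h, Set.image_singleton, Set.mem_singleton_iff, Set.iUnion_iUnion_eq_left, ← hγ]
  exact (Disjoint.sdiff_eq_left (Set.disjoint_singleton_left.2 hx)).symm

theorem globularity_δ_of_unary (h : T.δ a = {x}) (hδ : T.δ x = T.δ (T.γ a))
    (hx : T.γ x ∉ T.δ x) :
    T.δ (T.γ a) = (⋃ y ∈ T.δ a, T.δ y) \ T.γ '' T.δ a := by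
  simp only [h, Set.image_singleton, Set.mem_singleton_iff, Set.iUnion_iUnion_eq_left, ← hδ]
  exact (Set.sdiff_singleton_eq_self hx).symm

end PosData

namespace OrderedHypergraph.IsOrderedFaceStructure

variable {S : OrderedHypergraph.{u}} {k : ℕ}

theorem finite_dagger (hS : S.IsOrderedFaceStructure) (k : ℕ) : Finite (hS.dagger.F k) := by
  have := S.finite (k + 1)
  refine Finite.of_injective (β := S.Cut k ⊕ S.F (k + 1)) (fun A : DaggerFace S k => match A with
    | .cut c => .inl c
    | .bar α _ => .inr α) fun A B h => ?_
  cases A <;> cases B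
  · exact congrArg _ (Sum.inl.inj h)
  · cases h
  · cases h
  · cases Sum.inr.inj h
    rfl

theorem dagger_δ_nonempty (hS : S.IsOrderedFaceStructure) (A : hS.dagger.F (k + 1)) :
    (hS.dagger.δ A).Nonempty := by
  have key : (dDot (sface A)).Nonempty → (hS.dagger.δ A).Nonempty := fun ⟨y, hy⟩ =>
    ⟨_, hS.cut_mem_dagger_δ.2 ⟨y, hy, rfl⟩⟩
  cases k with
  | zero => exact key (dDot_nonempty_one _)
  | succ k =>
    rcases dDot_nonempty_or (sface A) with h | ⟨u, hu⟩
    · exact key h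
    · cases A with
      | cut c =>
        obtain ⟨α, hα, h⟩ := hS.exists_initial_le hu
        exact ⟨.bar α hα.1, hS.bar_mem_dagger_δ.2 ⟨c, rfl, h⟩⟩
      | bar α hα => exact absurd (hS.isLoop_γ_initial hα) (not_isLoop_of_one hu)

theorem isPositiveHypergraph_dagger (hS : S.IsOrderedFaceStructure) :
    PosData.IsPositiveHypergraph hS.dagger where
  finite := hS.finite_dagger
  bounded := by
    obtain ⟨N, hN⟩ := S.bounded
    refine ⟨N, fun k hk => ⟨fun A => ?_⟩⟩
    cases A with
    | cut c => exact (hN k hk).false c.base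
    | bar α _ => exact (hN (k + 1) (by omega)).false α
  δ_nonempty := hS.dagger_δ_nonempty
  δ_zero A := by
    obtain ⟨x, hx⟩ := dDot_nonempty_one (sface A)
    refine ⟨.cut (hS.downCut x (sface A)), ?_⟩
    obtain ⟨z, hz⟩ := S.δ_zero (sface A)
    refine Set.ext fun B => ?_
    cases B with
    | bar α hα => exact absurd hα (not_isInitial_one α)
    | cut c =>
      constructor
      · intro h
        obtain ⟨y, hy, rfl⟩ := hS.cut_mem_dagger_δ.1 h
        have h1 : EFace.face x ∈ S.δ (sface A) := hx
        have h2 : EFace.face y ∈ S.δ (sface A) := hy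
        rw [hz, Set.mem_singleton_iff] at h1 h2
        cases EFace.face.inj (h1.trans h2.symm)
        exact rfl
      · intro h
        cases h
        exact hS.cut_mem_dagger_δ.2 ⟨x, hx, rfl⟩

theorem mem_refinedDom_iff (hS : S.IsOrderedFaceStructure) {c : S.Cut (k + 2)} {x : S.F (k + 1)} :
    x ∈ refinedDom c.base ↔
      ∃ A ∈ hS.dagger.δ (DaggerFace.cut c : DaggerFace S (k + 2)), sface A = x := by
  constructor
  · rintro (hx | ⟨α, hα, h, rfl⟩)
    · exact ⟨_, hS.cut_mem_dagger_δ.2 ⟨x, hx, rfl⟩, rfl⟩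
    · exact ⟨.bar α hα, hS.bar_mem_dagger_δ.2 ⟨_, rfl, h⟩, rfl⟩
  · rintro ⟨A, hA, rfl⟩
    cases A with
    | cut d =>
      obtain ⟨y, hy, rfl⟩ := hS.cut_mem_dagger_δ.1 hA
      exact Or.inl hy
    | bar α hα =>
      obtain ⟨d, h, h1⟩ := hS.bar_mem_dagger_δ.1 hA
      cases h
      exact Or.inr ⟨α, hα, h1, rfl⟩

theorem dagger_γ_notMem_δ (hS : S.IsOrderedFaceStructure) (A : hS.dagger.F (k + 1)) :
    hS.dagger.γ A ∉ hS.dagger.δ A := by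
  intro h
  exact hS.lt_irrefl _ (hS.lt_sface_of_lowLT (.single h))

/-- The codomains of the domain of a cut over `a`. -/
theorem mem_γδ_iff (hS : S.IsOrderedFaceStructure) {c : S.Cut (k + 2)} {B : hS.dagger.F k} :
    B ∈ hS.dagger.γ '' hS.dagger.δ (DaggerFace.cut c : DaggerFace S (k + 2)) ↔
      ∃ x ∈ refinedDom c.base, B = .cut (hS.upCut x) := by
  constructor
  · rintro ⟨A, hA, rfl⟩
    exact ⟨_, hS.mem_refinedDom_iff.2 ⟨A, hA, rfl⟩, hS.dagger_γ A⟩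
  · rintro ⟨x, hx, rfl⟩
    obtain ⟨A, hA, rfl⟩ := hS.mem_refinedDom_iff.1 hx
    exact ⟨A, hA, hS.dagger_γ A⟩

theorem cut_mem_δδ_iff (hS : S.IsOrderedFaceStructure) {c : S.Cut (k + 2)} {d : S.Cut k} :
    DaggerFace.cut d ∈ (⋃ A ∈ hS.dagger.δ (DaggerFace.cut c : DaggerFace S (k + 2)),
      hS.dagger.δ A) ↔ ∃ x ∈ refinedDom c.base, ∃ y ∈ dDot x, d = hS.downCut y x := by
  constructor
  · intro h
    obtain ⟨A, hA, h⟩ := Set.mem_iUnion₂.1 h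
    obtain ⟨y, hy, rfl⟩ := hS.cut_mem_dagger_δ.1 h
    exact ⟨_, hS.mem_refinedDom_iff.2 ⟨A, hA, rfl⟩, y, hy, rfl⟩
  · rintro ⟨x, hx, y, hy, rfl⟩
    obtain ⟨A, hA, rfl⟩ := hS.mem_refinedDom_iff.1 hx
    exact Set.mem_biUnion hA (hS.cut_mem_dagger_δ.2 ⟨y, hy, rfl⟩)

theorem bar_mem_δδ_iff (hS : S.IsOrderedFaceStructure) {c : S.Cut (k + 2)} {α : S.F (k + 1)}
    {hα : IsInitial α} :
    DaggerFace.bar α hα ∈ (⋃ A ∈ hS.dagger.δ (DaggerFace.cut c : DaggerFace S (k + 2)),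
      hS.dagger.δ A) ↔ ∃ x ∈ dDot c.base, upLE α x := by
  constructor
  · intro h
    obtain ⟨A, hA, h⟩ := Set.mem_iUnion₂.1 h
    obtain ⟨d, rfl, h1⟩ := hS.bar_mem_dagger_δ.1 h
    obtain ⟨y, hy, rfl⟩ := hS.cut_mem_dagger_δ.1 hA
    exact ⟨y, hy, h1⟩
  · rintro ⟨x, hx, h⟩
    exact Set.mem_biUnion (hS.cut_mem_dagger_δ.2 ⟨x, hx, rfl⟩)
      (hS.bar_mem_dagger_δ.2 ⟨_, rfl, h⟩)

/-- This settles globularity for bars. If a is not a loop, γ(a) is not initial, so α is strictly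
below γ(a), and minimality of α pushes it below the domain of a. -/
theorem upLE_γ_iff_of_initial (hS : S.IsOrderedFaceStructure) {α : S.F (k + 1)} {a : S.F (k + 2)}
    (hα : IsInitial α) : upLE α (S.γ a) ↔ ∃ x ∈ dDot a, upLE α x := by
  constructor
  · intro h
    by_cases ha : IsLoop a
    · exact ⟨_, by rw [dDot_eq_of_isLoop ha]; rfl, h⟩
    rcases h with rfl | h
    · exact absurd ⟨a, ha, rfl⟩ hα.2
    · exact hS.upLE_mem_of_min hα.isMin hα.not_isLoop ha h
  · rintro ⟨x, hx, h⟩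
    exact h.trans (upLE.of_mem hx)

theorem dagger_globularity_γ (hS : S.IsOrderedFaceStructure) (A : hS.dagger.F (k + 2)) :
    ({hS.dagger.γ (hS.dagger.γ A)} : Set (hS.dagger.F k)) =
      hS.dagger.γ '' hS.dagger.δ A \ ⋃ x ∈ hS.dagger.δ A, hS.dagger.δ x := by
  cases A with
  | bar α hα =>
    -- Domain and codomain of a bar are cuts over the same face γγ(α), so they have equal γ and δ by
    -- definition.
    exact PosData.globularity_γ_of_unary (x := DaggerFace.cut (hS.downCut _ _)) rfl rfl
      (hS.dagger_γ_notMem_δ (.cut (hS.downCut _ _)))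
  | cut c =>
    ext B
    simp only [Set.mem_singleton_iff, Set.mem_sdiff]
    rw [hS.mem_γδ_iff]
    constructor
    · rintro rfl
      obtain ⟨x, hx, e⟩ := hS.exists_upCut_eq_γ c.base
      refine ⟨⟨x, hx, congrArg DaggerFace.cut e.symm⟩, fun h => ?_⟩
      obtain ⟨x, hx, y, hy, e⟩ := hS.cut_mem_δδ_iff.1 h
      exact hS.upCut_γ_ne_downCut hx hy e
    · rintro ⟨⟨x, hx, rfl⟩, h⟩
      rcases hS.upCut_refinedDom hx with h1 | ⟨x', hx', hy, e⟩
      · exact congrArg DaggerFace.cut h1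
      · exact absurd (hS.cut_mem_δδ_iff.2 ⟨x', hx', _, hy, e⟩) h

theorem dagger_globularity_δ (hS : S.IsOrderedFaceStructure) (A : hS.dagger.F (k + 2)) :
    hS.dagger.δ (hS.dagger.γ A) =
      (⋃ x ∈ hS.dagger.δ A, hS.dagger.δ x) \ hS.dagger.γ '' hS.dagger.δ A := by
  cases A with
  | bar α hα =>
    exact PosData.globularity_δ_of_unary (x := DaggerFace.cut (hS.downCut _ _)) rfl rfl
      (hS.dagger_γ_notMem_δ (.cut (hS.downCut _ _)))
  | cut c =>
    ext B
    simp only [Set.mem_sdiff]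
    rw [hS.mem_γδ_iff]
    cases B with
    | bar α hα =>
      refine hS.bar_mem_dagger_δ.trans
        (Iff.trans ⟨?_, ?_⟩ (and_congr_left fun _ => hS.bar_mem_δδ_iff.symm))
      · rintro ⟨d, e, h⟩
        cases e
        refine ⟨(hS.upLE_γ_iff_of_initial hα).1 h, ?_⟩
        rintro ⟨_, _, e⟩
        cases e
      · rintro ⟨h, -⟩
        exact ⟨_, rfl, (hS.upLE_γ_iff_of_initial hα).2 h⟩
    | cut d =>
      refine hS.cut_mem_dagger_δ.trans
        (Iff.trans ⟨?_, ?_⟩ (and_congr_left fun _ => hS.cut_mem_δδ_iff.symm))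
      · rintro ⟨y, hy, rfl⟩
        refine ⟨?_, ?_⟩
        · obtain ⟨x, hx, h1, h2⟩ := hS.exists_downCut_eq_γ hy
          exact ⟨x, hx, y, h1, h2.symm⟩
        · rintro ⟨x, hx, e⟩
          exact hS.downCut_γ_ne_upCut hx hy (DaggerFace.cut.inj e)
      · rintro ⟨⟨x, hx, y, hy, rfl⟩, h⟩
        rcases hS.downCut_refinedDom hx hy with ⟨h1, h2⟩ | ⟨x', hx', -, e⟩
        · exact ⟨y, h1, h2⟩
        · exact absurd ⟨x', hx', congrArg DaggerFace.cut e.symm⟩ h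

theorem not_upLT_of_lt_sface (hS : S.IsOrderedFaceStructure) {A B : hS.dagger.F (k + 1)}
    (h : S.lt (sface A) (sface B) ∨ S.lt (sface B) (sface A)) : ¬ PosData.upLT A B := by
  intro h1
  have h2 : upLE (sface A) (sface B) := by
    replace h1 := hS.daggerLT_of_upLT h1
    cases B with
    | bar => cases A <;> exact h1.elim
    | cut d =>
      cases A with
      | cut c => exact h1.elim Or.inr fun h => Or.inl h.1
      | bar α hα => exact h1
  rcases h with h | h
  exacts [hS.not_lt_of_upLE h2 h, hS.not_lt_of_upLE' h2 h]

theorem eq_or_daggerLT (hS : S.IsOrderedFaceStructure) {A B : DaggerFace S (k + 1)}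
    (h : upLE (sface A) (sface B)) (hcut : ∀ β hβ, B ≠ DaggerFace.bar β hβ) :
    A = B ∨ daggerLT A B ∨ daggerLT B A := by
  cases B with
  | bar β hβ => exact absurd rfl (hcut β hβ)
  | cut d =>
    cases A with
    | bar α hα => exact Or.inr (Or.inl h)
    | cut c =>
      rcases h with h | h
      · rcases hS.cut_L_cases h with e | e | e
        · exact Or.inl (congrArg _ e)
        · exact Or.inr (Or.inl (Or.inr ⟨h, e⟩))
        · exact Or.inr (Or.inr (Or.inr ⟨h.symm, e⟩))
      · exact Or.inr (Or.inl (Or.inl h))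

/-- Faces of `S†` whose underlying faces are comparable are comparable. -/
theorem upLT_or_of_sface (hS : S.IsOrderedFaceStructure) {A B : hS.dagger.F (k + 1)} (hne : A ≠ B)
    (h : upLE (sface A) (sface B) ∨ upLE (sface B) (sface A)) :
    PosData.upLT A B ∨ PosData.upLT B A := by
  rw [dagger_upLT_iff, dagger_upLT_iff]
  -- γ(β) is minimal, so `A` lies over γ(β) itself. Distinct initial faces cannot share this
  -- codomain, so `A` is a cut, which is above the bar.
  have bar : ∀ {A : DaggerFace S (k + 1)} {β : S.F (k + 2)} (hβ : IsInitial β),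
      upLE (sface A) (S.γ β) → A ≠ .bar β hβ → daggerLT (.bar β hβ) A := by
    intro A β hβ h hne
    have e := (hS.isMin_γ hβ).eq h
    cases A with
    | cut c => exact Or.inl e.symm
    | bar α hα =>
      have h1 := hα.mem_initialAt hS
      have h2 := hβ.mem_initialAt hS
      change S.γ α = S.γ β at e
      rw [e] at h1
      have h3 : α ≠ β := by
        rintro rfl
        exact hne rfl
      rcases hS.initialAt_linear h1 h2 h3 with h | h
      · exact absurd (e ▸ h) (hS.lt_irrefl (S.γ β))
      · exact absurd (e ▸ h) (hS.lt_irrefl (S.γ β))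
  have main : ∀ {A B : DaggerFace S (k + 1)}, A ≠ B → upLE (sface A) (sface B) →
      daggerLT A B ∨ daggerLT B A := by
    intro A B hne h
    cases B with
    | bar β hβ => exact Or.inr (bar hβ h hne)
    | cut d => exact (hS.eq_or_daggerLT h (fun _ _ e => by cases e)).resolve_left hne
  rcases h with h | h
  · exact main hne h
  · exact (main (Ne.symm hne) h).symm

theorem isPositiveFaceStructure_dagger (hS : S.IsOrderedFaceStructure) :
    PosData.IsPositiveFaceStructure hS.dagger where
  toIsPositiveHypergraph := hS.isPositiveHypergraph_dagger
  nonempty := hS.nonempty.map fun x => .cut (botCut x)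
  globularity_γ := hS.dagger_globularity_γ
  globularity_δ := hS.dagger_globularity_δ
  upLT_irrefl A h := by
    replace h := hS.daggerLT_of_upLT h
    cases A with
    | bar => exact h
    | cut c =>
      rcases h with h | ⟨-, h⟩
      exacts [hS.upLT_irrefl _ h, h.2 subset_rfl]
  upLT_linear A B hne := by
    rw [dagger_upLT_iff, dagger_upLT_iff]
    cases A with
    | bar α hα => exact absurd hα (not_isInitial_one α)
    | cut c =>
    cases B with
    | bar α hα => exact absurd hα (not_isInitial_one α)
    | cut d =>
    by_cases h : c.base = d.base
    · rcases hS.cut_L_cases h with e | e | e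
      · exact absurd (congrArg _ e) hne
      · exact Or.inl (Or.inr ⟨h, e⟩)
      · exact Or.inr (Or.inr ⟨h.symm, e⟩)
    · exact (hS.upLT_linear _ _ h).imp Or.inl Or.inl
  disjoint A B := by
    rintro ⟨h1, h2⟩
    have h1 := h1.imp hS.lt_sface_of_lowLT hS.lt_sface_of_lowLT
    rcases h2 with h2 | h2
    exacts [hS.not_upLT_of_lt_sface h1 h2, hS.not_upLT_of_lt_sface h1.symm h2]
  pencil_γ A B hne h := by
    rw [dagger_γ, dagger_γ] at h
    refine hS.upLT_or_of_sface hne ?_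
    by_cases e : sface A = sface B
    · exact Or.inl (Or.inl e)
    · exact (hS.upLT_of_upCut_eq (DaggerFace.cut.inj h) e).imp Or.inr Or.inr
  pencil_δ A B hne := by
    rintro ⟨C, h1, h2⟩
    refine hS.upLT_or_of_sface hne ?_
    cases C with
    | bar α hα =>
      obtain ⟨c, rfl, h3⟩ := hS.bar_mem_dagger_δ.1 h1
      obtain ⟨d, rfl, h4⟩ := hS.bar_mem_dagger_δ.1 h2
      exact hS.upLE_chain h3 h4
    | cut c =>
      obtain ⟨y, hy, rfl⟩ := hS.cut_mem_dagger_δ.1 h1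
      obtain ⟨y', hy', e'⟩ := hS.cut_mem_dagger_δ.1 h2
      cases congrArg Cut.base e'
      by_cases e : sface A = sface B
      · exact Or.inl (Or.inl e)
      · exact (hS.upLT_of_downCut_eq hy hy' e' e).imp Or.inr Or.inr

theorem isUnaryIdeal_bars (hS : S.IsOrderedFaceStructure) : PosData.IsUnaryIdeal hS.bars where
  unary {k} A hA := by
    obtain ⟨α, hα, rfl⟩ := hA
    cases k with
    | zero => exact absurd hα (not_isInitial_one α)
    | succ k => exact ⟨_, rfl⟩
  γ_notMem A := by
    rintro ⟨α, hα, h⟩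
    rw [dagger_γ] at h
    cases h
  δ_notMem A := by
    rintro ⟨α, hα, rfl⟩ x hx ⟨β, hβ, rfl⟩
    cases Set.mem_singleton_iff.1 hx
  mem_δ_unary {k} A hA := by
    obtain ⟨α, hα, rfl⟩ := hA
    cases k with
    | zero => exact absurd hα (not_isInitial_one α)
    | succ k =>
    -- A cut over α itself is unary: δ(α) is empty, and α is the only initial face below the minimal
    -- face α.
    refine ⟨.cut (botCut α), ⟨.bar α hα, ?_⟩, hS.bar_mem_dagger_δ.2 ⟨_, rfl, upLE.refl _⟩⟩
    refine Set.ext fun B => ?_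
    cases B with
    | cut c =>
      refine ⟨fun h => ?_, fun h => by cases h⟩
      obtain ⟨y, hy, -⟩ := hS.cut_mem_dagger_δ.1 h
      obtain ⟨u, hu⟩ := hα.exists_one
      change y ∈ dDot α at hy
      rw [dDot_eq_empty hu] at hy
      exact hy.elim
    | bar β hβ =>
      constructor
      · intro h
        obtain ⟨c, h1, h2⟩ := hS.bar_mem_dagger_δ.1 h
        cases h1
        cases hα.isMin.eq h2
        rfl
      · intro h
        cases h
        exact hS.bar_mem_dagger_δ.2 ⟨_, rfl, upLE.refl _⟩

end OrderedHypergraph.IsOrderedFaceStructure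
end FaceStr

namespace FaceStr
open FaceStr.Hypergraph

/-! ### Collapsing the bars: q_S is a positive cover. -/

theorem EFace.map_injective {F G : ℕ → Type u} {f : ∀ k, F k → G k}
    (hf : ∀ k, Function.Injective (f k)) {k : ℕ} :
    Function.Injective (EFace.map f : EFace F k → EFace G k) := by
  intro z w h
  cases z with
  | face x =>
    cases w with
    | face y => exact congrArg _ (hf _ (EFace.face.inj h))
    | one y => cases h
  | one x =>
    cases w with
    | face y => cases h
    | one y => exact congrArg _ (hf _ (EFace.one.inj h))

theorem EFace.map_leftInverse {F G : ℕ → Type u} {f : ∀ k, F k → G k} {g : ∀ k, G k → F k}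
    (h : ∀ k, Function.LeftInverse (g k) (f k)) {k : ℕ} :
    Function.LeftInverse (EFace.map g : EFace G k → EFace F k) (EFace.map f) := by
  intro z
  cases z with
  | face x => exact congrArg _ (h _ x)
  | one x => exact congrArg _ (h _ x)

namespace PosData

variable {T : PosData.{u}} {J : ∀ k, Set (T.F k)} (hJ : IsIdeal J) {k : ℕ}

theorem quotδAux_of_subset {a : T.F (k + 2)} (h : T.δ a ⊆ J (k + 1)) :
    quotδAux hJ a = {.one (QF.mk (T.γ (T.γ a)) (hJ.γ_notMem _))} := by
  rw [quotδAux, if_pos h]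

theorem quotδAux_of_not_subset {a : T.F (k + 2)} (h : ¬ T.δ a ⊆ J (k + 1)) :
    quotδAux hJ a = {z | ∃ x, ∃ hx : x ∉ J (k + 1), x ∈ T.δ a ∧ z = .face (QF.mk x hx)} := by
  rw [quotδAux, if_neg h]

theorem quotMap_of_mem {a : T.F (k + 1)} (h : a ∈ J (k + 1)) :
    quotMap hJ (k + 1) a = .one (QF.mk (T.γ a) (hJ.γ_notMem a)) := by
  rw [quotMap, dif_pos h]

theorem quotMap_of_notMem {a : T.F (k + 1)} (h : a ∉ J (k + 1)) :
    quotMap hJ (k + 1) a = .face (QF.mk a h) := by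
  rw [quotMap, dif_neg h]

end PosData

namespace OrderedHypergraph.IsOrderedFaceStructure

variable {S : OrderedHypergraph.{u}} {k : ℕ}

theorem q_cut (hS : S.IsOrderedFaceStructure) (c : S.Cut k) :
    hS.q k (DaggerFace.cut c : DaggerFace S k) = .face c.base := by
  cases k <;> rfl

theorem face_mem_q_image (hS : S.IsOrderedFaceStructure) {c : S.Cut (k + 1)} {x : S.F k} :
    EFace.face x ∈ hS.q k '' hS.dagger.δ (DaggerFace.cut c : DaggerFace S (k + 1)) ↔
      x ∈ dDot c.base := by
  constructor
  · rintro ⟨A, hA, h⟩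
    cases A with
    | cut d =>
      obtain ⟨y, hy, rfl⟩ := hS.cut_mem_dagger_δ.1 hA
      rw [hS.q_cut] at h
      exact EFace.face.inj h ▸ hy
    | bar α hα =>
      cases k with
      | zero => exact absurd hα (not_isInitial_one α)
      | succ k => cases h
  · intro hx
    exact ⟨_, hS.cut_mem_dagger_δ.2 ⟨x, hx, rfl⟩, hS.q_cut _⟩

theorem one_mem_q_image (hS : S.IsOrderedFaceStructure) {c : S.Cut (k + 2)} {u : S.F k} :
    EFace.one u ∈ hS.q (k + 1) '' hS.dagger.δ (DaggerFace.cut c : DaggerFace S (k + 2)) ↔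
      ∃ α, IsInitial α ∧ upLE α c.base ∧ S.γ (S.γ α) = u := by
  constructor
  · rintro ⟨A, hA, h⟩
    cases A with
    | cut d => cases h
    | bar α hα =>
      obtain ⟨d, h1, h2⟩ := hS.bar_mem_dagger_δ.1 hA
      cases h1
      exact ⟨α, hα, h2, EFace.one.inj h⟩
  · rintro ⟨α, hα, h, rfl⟩
    exact ⟨.bar α hα, hS.bar_mem_dagger_δ.2 ⟨_, rfl, h⟩, rfl⟩

/-- The bars in the domain of a cut over a are sent to extra empty faces 1_{γγ(α)}. When a has a
proper domain, these are of the kind that ≡₁ ignores. -/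
theorem exists_mem_thetaDot_of_initial (hS : S.IsOrderedFaceStructure) {α a : S.F (k + 2)}
    (hα : IsInitial α) (h : upLE α a) (hne : (dDot a).Nonempty) :
    ∃ x ∈ dDot a, S.γ (S.γ α) ∈ thetaDot x := by
  by_cases e : S.γ (S.γ α) = S.γ (S.γ a)
  · obtain ⟨x, hx, h1⟩ := hS.exists_γ_eq hne
    exact ⟨x, hx, mem_thetaDot.2 (Or.inr (e.trans h1.symm))⟩
  · obtain ⟨x, hx, h1⟩ := hS.exists_NL_of_initial hα h e
    exact ⟨x, hx.1, mem_thetaDot.2 (Or.inl h1)⟩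

theorem eqv1_q_image (hS : S.IsOrderedFaceStructure) (c : S.Cut (k + 1)) :
    Eqv1 (S := S.toHypergraph)
      (hS.q k '' hS.dagger.δ (DaggerFace.cut c : DaggerFace S (k + 1))) (S.δ c.base) := by
  ext z
  simp only [Set.mem_union]
  cases z with
  | face x =>
    simp only [face_notMem_onesTheta, or_false]
    exact hS.face_mem_q_image
  | @one k u =>
    have hθ : EFace.one u ∈ onesTheta (S := S.toHypergraph)
        (hS.q (k + 1) '' hS.dagger.δ (DaggerFace.cut c : DaggerFace S (k + 2))) ↔
        EFace.one u ∈ onesTheta (S := S.toHypergraph) (S.δ c.base) :=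
      exists_congr fun x => and_congr_left fun _ => hS.face_mem_q_image
    rw [hθ, hS.one_mem_q_image]
    constructor
    · rintro (⟨α, hα, h, rfl⟩ | h)
      · rcases dDot_nonempty_or c.base with hne | ⟨v, hv⟩
        · obtain ⟨x, hx, h1⟩ := hS.exists_mem_thetaDot_of_initial hα h hne
          exact Or.inr ⟨x, hx, _, h1, rfl⟩
        · left
          rw [hv, hS.γ_eq_of_upLE_isLoop (hS.upLE_γ h) (hS.isLoop_γ_of_one hv), hS.γγ_eq hv]
          rfl
      · exact Or.inr h
    · rintro (h | h)
      · rcases dDot_nonempty_or c.base with hne | ⟨v, hv⟩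
        · rw [δ_eq_image_of_nonempty hne] at h
          obtain ⟨x, -, e⟩ := h
          cases e
        · rw [hv] at h
          cases Set.mem_singleton_iff.1 h
          obtain ⟨α, hα, h1⟩ := hS.exists_initial_le hv
          exact Or.inl ⟨α, hα.1, h1, hS.γγ_eq_of_mem hα⟩
      · exact Or.inr h

theorem isCollapsing_q (hS : S.IsOrderedFaceStructure) :
    PosData.IsCollapsing hS.dagger S hS.q where
  map_lt {k} A B a b hA hB h := by
    cases k with
    | zero => exact h.elim
    | succ k =>
      have h1 := hS.lt_sface_of_lowLT h
      cases A with
      | bar => cases hA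
      | cut c =>
      cases B with
      | bar => cases hB
      | cut d =>
      cases hA
      cases hB
      exact h1
  map_γ A := by
    rw [hS.dagger_γ, hS.q_cut]
    cases A <;> rfl
  map_δ A := by
    cases A with
    | cut c => exact hS.eqv1_q_image c
    | @bar α hα =>
      have e : hS.q _ '' hS.dagger.δ (DaggerFace.bar α hα : DaggerFace S (_ + 1)) =
          {EFace.face (S.γ (S.γ α))} := by
        change hS.q _ '' {DaggerFace.cut (hS.downCut (S.γ (S.γ α)) (S.γ α))} = _
        exact Set.image_singleton.trans (congrArg _ (hS.q_cut _))
      rw [e]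
      rfl

theorem cut_notMem_bars (hS : S.IsOrderedFaceStructure) (c : S.Cut k) :
    (DaggerFace.cut c : DaggerFace S k) ∉ hS.bars k := by
  rintro ⟨α, hα, h⟩
  cases h

/-- The face of `S` underlying a class of the quotient of `S†` by the bars. -/
def quotBase (hS : S.IsOrderedFaceStructure) (k : ℕ) : PosData.QF hS.bars k → S.F k :=
  Quot.lift (fun A => sface A.1) (by
    -- The bar of α identifies only two cuts over the same face γγ(α).
    rintro ⟨A, hA⟩ ⟨B, hB⟩ ⟨C, ⟨α, hα, rfl⟩, h1, h2⟩
    have h1 : ({DaggerFace.cut (hS.downCut (S.γ (S.γ α)) (S.γ α))} : Set (DaggerFace S k)) = {A} :=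
      h1
    have h2 : DaggerFace.cut (hS.upCut (S.γ α)) = B := h2
    subst h2
    cases Set.singleton_eq_singleton_iff.1 h1
    rfl)

/-- The class of the cuts over a face of `S`. -/
def quotCut (hS : S.IsOrderedFaceStructure) (k : ℕ) (x : S.F k) : PosData.QF hS.bars k :=
  PosData.QF.mk (DaggerFace.cut (botCut x) : DaggerFace S k) (hS.cut_notMem_bars _)

theorem quotBase_quotCut (hS : S.IsOrderedFaceStructure) (k : ℕ) :
    Function.RightInverse (hS.quotCut k) (hS.quotBase k) := fun _ => rfl

/-- Each cut is joined to its predecessor by a bar, so descending on the lower part reaches the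
bottom cut. -/
theorem quotCut_base (hS : S.IsOrderedFaceStructure) (c : S.Cut k) :
    hS.quotCut k c.base =
      PosData.QF.mk (DaggerFace.cut c : DaggerFace S k) (hS.cut_notMem_bars c) := by
  have := S.finite (k + 2)
  induction c using (InvImage.wf Cut.L (wellFounded_lt (α := Set (S.F (k + 2))))).induction with
  | _ c ih =>
  rcases Set.eq_empty_or_nonempty c.L with h | h
  · have e : botCut c.base = c := Cut.ext_L hS rfl h.symm
    unfold quotCut
    simp only [e]
  · obtain ⟨α, hα, h1, h2, -⟩ := hS.exists_eq_upCut h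
    refine (ih (hS.downCut c.base (S.γ α)) h2).trans (Quot.sound ?_)
    refine ⟨.bar α hα.1, ⟨α, hα.1, rfl⟩, ?_, congrArg DaggerFace.cut h1.symm⟩
    change ({DaggerFace.cut (hS.downCut (S.γ (S.γ α)) (S.γ α))} : Set (DaggerFace S k)) = _
    rw [hS.γγ_eq_of_mem hα]
    rfl

theorem exists_cut_of_quot (hS : S.IsOrderedFaceStructure) (X : PosData.QF hS.bars k) :
    ∃ c : S.Cut k,
      X = PosData.QF.mk (DaggerFace.cut c : DaggerFace S k) (hS.cut_notMem_bars c) := by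
  induction X using Quot.ind with
  | mk A =>
    obtain ⟨A, hA⟩ := A
    cases A with
    | cut c => exact ⟨c, rfl⟩
    | bar α hα => exact absurd ⟨α, hα, rfl⟩ hA

theorem quotCut_quotBase (hS : S.IsOrderedFaceStructure) (k : ℕ) :
    Function.LeftInverse (hS.quotCut k) (hS.quotBase k) := by
  intro X
  obtain ⟨c, rfl⟩ := hS.exists_cut_of_quot X
  exact hS.quotCut_base c

/-- The cuts in the domain correspond to the proper faces of δ(a). If there are none, δ(a) is an
empty face 1_u with u = γγ(a), which is the value the quotient assigns. -/
theorem map_image_quotδAux (hS : S.IsOrderedFaceStructure) (c : S.Cut (k + 1)) :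
    EFace.map hS.quotBase '' PosData.quotδAux hS.isUnaryIdeal_bars.toIsIdeal
      (DaggerFace.cut c : DaggerFace S (k + 1)) = S.δ c.base := by
  have main : (dDot c.base).Nonempty → EFace.map hS.quotBase '' {z | ∃ x, ∃ hx : x ∉ hS.bars k,
      x ∈ hS.dagger.δ (DaggerFace.cut c : DaggerFace S (k + 1)) ∧
        z = .face (PosData.QF.mk x hx)} = S.δ c.base := by
    intro hne
    rw [δ_eq_image_of_nonempty hne]
    ext z
    constructor
    · rintro ⟨_, ⟨A, hA, h, rfl⟩, rfl⟩
      cases A with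
      | bar α hα => exact absurd ⟨α, hα, rfl⟩ hA
      | cut d =>
        obtain ⟨y, hy, rfl⟩ := hS.cut_mem_dagger_δ.1 h
        exact ⟨y, hy, rfl⟩
    · rintro ⟨y, hy, rfl⟩
      exact ⟨_, ⟨_, hS.cut_notMem_bars _, hS.cut_mem_dagger_δ.2 ⟨y, hy, rfl⟩, rfl⟩, rfl⟩
  cases k with
  | zero => exact main (dDot_nonempty_one _)
  | succ k =>
    by_cases h : hS.dagger.δ (DaggerFace.cut c : DaggerFace S (k + 2)) ⊆ hS.bars (k + 1)
    · rw [PosData.quotδAux_of_subset _ h]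
      rcases dDot_nonempty_or c.base with ⟨y, hy⟩ | ⟨u, hu⟩
      · exact absurd (h (hS.cut_mem_dagger_δ.2 ⟨y, hy, rfl⟩)) (hS.cut_notMem_bars _)
      · rw [hu, Set.image_singleton, ← hS.γγ_eq hu]
        rfl
    · rw [PosData.quotδAux_of_not_subset _ h]
      apply main
      obtain ⟨A, hA, hA'⟩ := Set.not_subset.1 h
      cases A with
      | bar α hα => exact absurd ⟨α, hα, rfl⟩ hA'
      | cut d =>
        obtain ⟨y, hy, -⟩ := hS.cut_mem_dagger_δ.1 hA
        exact ⟨y, hy⟩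

theorem isMonotoneMorphism_quotBase (hS : S.IsOrderedFaceStructure) :
    IsMonotoneMorphism (PosData.quot hS.isPositiveFaceStructure_dagger
      hS.isUnaryIdeal_bars.toIsIdeal) S hS.quotBase where
  map_γ X := by
    obtain ⟨c, rfl⟩ := hS.exists_cut_of_quot X
    rfl
  bijOn_δ X := by
    obtain ⟨c, rfl⟩ := hS.exists_cut_of_quot X
    have h := hS.map_image_quotδAux c
    exact h ▸ ((EFace.map_injective fun k => (hS.quotCut_quotBase k).injective).injOn).bijOn_image
  map_lt {k} := by
    rintro _ _ ⟨A, B, rfl, rfl, h⟩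
    cases k with
    | zero => exact h.elim
    | succ k => exact hS.lt_sface_of_lowLT h

theorem isMonotoneMorphism_quotCut (hS : S.IsOrderedFaceStructure) :
    IsMonotoneMorphism S (PosData.quot hS.isPositiveFaceStructure_dagger
      hS.isUnaryIdeal_bars.toIsIdeal) hS.quotCut where
  map_γ {k} x := by
    refine (hS.quotCut_quotBase k).injective ?_
    exact (hS.isMonotoneMorphism_quotBase.map_γ (hS.quotCut _ x)).symm
  bijOn_δ {k} x := by
    refine Set.BijOn.symm ⟨?_, ?_⟩ (hS.isMonotoneMorphism_quotBase.bijOn_δ (hS.quotCut _ x))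
    · exact (EFace.map_leftInverse hS.quotBase_quotCut).leftInvOn _
    · exact (EFace.map_leftInverse hS.quotCut_quotBase).leftInvOn _
  map_lt {k} a b h := by
    refine ⟨⟨_, hS.cut_notMem_bars (botCut a)⟩, ⟨_, hS.cut_notMem_bars (botCut b)⟩, rfl, rfl, ?_⟩
    cases k with
    | zero => exact (hS.lowLT_of_lt _ _ h).elim
    | succ k => exact hS.lowLT_of_lt_sface h

theorem isPositiveCover_q (hS : S.IsOrderedFaceStructure) :
    PosData.IsPositiveCover hS.isPositiveFaceStructure_dagger S hS.q := by
  refine ⟨hS.isCollapsing_q, hS.bars, hS.isUnaryIdeal_bars.toIsIdeal, hS.quotBase, hS.quotCut,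
    hS.isMonotoneMorphism_quotBase, hS.isMonotoneMorphism_quotCut, hS.quotCut_quotBase,
    hS.quotBase_quotCut, fun k A => ?_⟩
  cases A with
  | cut c =>
    cases k with
    | zero => rfl
    | succ k =>
      exact congrArg (EFace.map hS.quotBase)
        (PosData.quotMap_of_notMem _ (hS.cut_notMem_bars c)).symm
  | bar α hα =>
    cases k with
    | zero => exact absurd hα (not_isInitial_one α)
    | succ k =>
      exact congrArg (EFace.map hS.quotBase)
        (PosData.quotMap_of_mem hS.isUnaryIdeal_bars.toIsIdeal ⟨α, hα, rfl⟩).symm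

theorem ker_q (hS : S.IsOrderedFaceStructure) : PosData.ker hS.q = hS.bars := by
  funext k
  refine Set.ext fun A => ?_
  change (hS.q k A).IsOne ↔ _
  cases A with
  | cut c =>
    rw [hS.q_cut]
    exact ⟨fun h => h.elim, fun h => hS.cut_notMem_bars c h⟩
  | bar α hα =>
    refine ⟨fun _ => ⟨α, hα, rfl⟩, fun _ => ?_⟩
    cases k with
    | zero => exact absurd hα (not_isInitial_one α)
    | succ k => trivial

end OrderedHypergraph.IsOrderedFaceStructure
end FaceStr

open FaceStr in
theorem mainTheorem6 (S : OrderedHypergraph.{u}) (hS : S.IsOrderedFaceStructure) :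
    ∃ hT : PosData.IsPositiveFaceStructure hS.dagger,
      PosData.IsUnaryIdeal hS.bars ∧
      PosData.IsPositiveCover hT S hS.q ∧
      PosData.ker hS.q = hS.bars :=
  ⟨hS.isPositiveFaceStructure_dagger, hS.isUnaryIdeal_bars, hS.isPositiveCover_q, hS.ker_q⟩
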